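/- Let $\Omega\subset\mathbb{R}^d$ be compact and convex with non-empty interior $\Omega^\circ$, and let $p_0,p_1$ be probability densities that vanish off $\Omega$ and are continuous and bounded away from zero on $\Omega$. For functions $p,q$ on $\Omega$ put $$\omega_{p,q}(\eta)=\sup_{z,z'\in\Omega,\ \|z-z'\|\le\eta}\max\Big\{\Big|\tfrac{p(z)}{p(z')}-1\Big|,\Big|\tfrac{q(z)}{q(z')}-1\Big|\Big\},\qquad S_t(z)=\{\delta\in\mathbb{R}^d:\ z-t\delta\in\Omega,\ z+(1-t)\delta\in\Omega\},$$ $$v_{p,q}(t,z)=\frac{\int_{S_t(z)}\delta\,p(z-t\delta)\,q(z+(1-t)\delta)\,d\delta}{\int_{S_t(z)}p(z-t\delta)\,q(z+(1-t)\delta)\,d\delta}\qquad(t\in[0,1],\ z\in\Omega^\circ).$$ Let $v=v_{p_0,p_1}$, so that $v(t,z)=\mathbb{E}[X_1-X_0\mid(1-t)X_0+tX_1=z]$ for independent $X_0\sim p_0$, $X_1\sim p_1$. Assume that $\omega_{p_0,p_1}(\eta)\le L\eta$ for some $L<\infty$ and all $\eta>0$. Let $\widehat p_0=\widehat p_{0,n}$,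 $\widehat p_1=\widehat p_{1,n}$ be estimators (random functions on $\Omega$), and let $G_n$ be the event that $\omega_{\widehat p_0,\widehat p_1}(\eta)\le L_n\eta$ for some (possibly random) $L_n<\infty$ and all $\eta>0$; assume $\mathbb{P}(G_n)\to1$. Let $\widehat v^{\mathrm{den}}=v_{\widehat p_0,\widehat p_1}$ and $$r_n=\sup_{x\in\Omega}\max_{j=0,1}\Big|\ln\frac{\widehat p_j(x)}{p_j(x)}\Big|,\qquad s_n=\operatorname*{ess\,sup}_{x\in\Omega^\circ}\max_{j=0,1}\big\|\nabla\log\widehat p_j(x)-\nabla\log p_j(x)\big\|,$$ with $r_n=\infty$ if some $\widehat p_j$ is not positive on $\Omega$. For $x\in\Omega^\circ$ let $\mathfrak R(\cdot,x)$ and $\widehat{\mathfrak R}(\cdot,x)$ be the solutions, with values in $\Omega^\circ$ for $t\in[0,1)$, of $$\mathfrak R(t,x)=x+\int_0^t v(s,\mathfrak R(s,x))\,ds,\qquad \widehat{\mathfrak R}(t,x)=x+\int_0^t\widehat v^{\mathrm{den}}(s,\widehat{\mathfrak R}(s,x))\,ds,\qquad t\in[0,1].$$ Fix $x\in\Omega$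 such that $\mathrm{dist}(x,\partial\Omega)>0$, $\mathrm{dist}(\mathfrak R(1,x),\partial\Omega)>0$, and the set of $t\in[0,1]$ for which $z\mapsto v(t,z)$ is not differentiable at $\mathfrak R(t,x)$ is Lebesgue-null. Then the following hold. 1. $\mathfrak R(\cdot,x)$ exists and is unique; on $G_n$, $\widehat{\mathfrak R}(\cdot,x)$ exists and is unique; and $z\mapsto v(s,z)$ is differentiable at $\mathfrak R(s,x)$ for almost every $s\in[0,1]$. Write $\partial_zv(s,\mathfrak R(s,x))$ for the derivative (the Jacobian matrix). 2. The equation $\Phi(t)=I+\int_0^t\partial_zv(s,\mathfrak R(s,x))\,\Phi(s)\,ds$, $t\in[0,1]$, has a unique solution $\Phi:[0,1]\to\mathbb{R}^{d\times d}$, and $\Phi(t)$ is invertible for every $t$. On $G_n$ the equation $$\widetilde E(t,x)=\int_0^t\{\widehat v^{\mathrm{den}}(s,\mathfrak R(s,x))-v(s,\mathfrak R(s,x))\}\,ds+\int_0^t\partial_zv(s,\mathfrak R(s,x))\,\widetilde E(s,x)\,ds,\qquad t\in[0,1],$$ has a unique solution, namely $$\widetilde E(t,x)=\Phi(t)\int_0^t\Phi(s)^{-1}\{\widehat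 v^{\mathrm{den}}(s,\mathfrak R(s,x))-v(s,\mathfrak R(s,x))\}\,ds.$$ 3. If $r_n+s_n=o_p(1)$ as $n\to\infty$, then $$\sup_{t\in[0,1]}\big\|\widehat{\mathfrak R}(t,x)-\mathfrak R(t,x)-\widetilde E(t,x)\big\|=o_p\Big(\sup_{t\in[0,1]}\|\widetilde E(t,x)\|\Big),$$ where $A_n=o_p(B_n)$ means that $\mathbb{P}(A_n>\varepsilon B_n)\to0$ for every $\varepsilon>0$. -/

import Mathlib

open MeasureTheory Set Filter Topology
open scoped ENNReal NNReal

namespace RectifiedFlow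

/-- `p` is a probability density with respect to Lebesgue measure that vanishes off `Ω`, is
continuous on `Ω` and is bounded away from zero on `Ω`. (Boundedness from above on a compact `Ω`
is a consequence.) -/
structure IsDensityOn {d : ℕ} (Ω : Set (EuclideanSpace ℝ (Fin d)))
    (p : EuclideanSpace ℝ (Fin d) → ℝ) : Prop where
  eq_zero_of_notMem : ∀ x ∉ Ω, p x = 0
  continuousOn : ContinuousOn p Ω
  bounded_below : ∃ c > 0, ∀ x ∈ Ω, c ≤ p x
  integral_eq_one : ∫ x, p x = 1

/-- `S_t(z)`, the set of all `δ` with `z - tδ ∈ Ω` and `z + (1-t)δ ∈ Ω`. -/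
def admissible {d : ℕ} (Ω : Set (EuclideanSpace ℝ (Fin d))) (t : ℝ)
    (z : EuclideanSpace ℝ (Fin d)) : Set (EuclideanSpace ℝ (Fin d)) :=
  {δ | z - t • δ ∈ Ω ∧ z + (1 - t) • δ ∈ Ω}

/-- The velocity field on `[0,1] × Ω°` that belongs to a pair `p, q` of functions on `Ω`:
`∫_{S_t(z)} δ p(z-tδ) q(z+(1-t)δ) dδ / ∫_{S_t(z)} p(z-tδ) q(z+(1-t)δ) dδ`.
For densities `p, q` it is the pointwise version of `E[X₁ - X₀ | (1-t)X₀ + tX₁ = z]` with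
independent `X₀ ∼ p`, `X₁ ∼ q`; for estimated densities it is the plug-in estimator. The values
of `p` and `q` off `Ω` play no role. -/
noncomputable def velocity {d : ℕ} (Ω : Set (EuclideanSpace ℝ (Fin d)))
    (p q : EuclideanSpace ℝ (Fin d) → ℝ) (t : ℝ) (z : EuclideanSpace ℝ (Fin d)) :
    EuclideanSpace ℝ (Fin d) :=
  (∫ δ in admissible Ω t z, p (z - t • δ) * q (z + (1 - t) • δ))⁻¹ •
    ∫ δ in admissible Ω t z, (p (z - t • δ) * q (z + (1 - t) • δ)) • δ

/-- `y` is, on `[0,1]`, a Carathéodory solution of `y' = v(t, y)`, `y(0) = x`. As `v` is a field on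
`[0,1] × Ω°`, a solution stays in `Ω°` at all times before `1`. -/
structure IsSolution {d : ℕ} (Ω : Set (EuclideanSpace ℝ (Fin d)))
    (v : ℝ → EuclideanSpace ℝ (Fin d) → EuclideanSpace ℝ (Fin d))
    (x : EuclideanSpace ℝ (Fin d)) (y : ℝ → EuclideanSpace ℝ (Fin d)) : Prop where
  mem_interior : ∀ t ∈ Ico (0 : ℝ) 1, y t ∈ interior Ω
  integrable : IntervalIntegrable (fun s => v s (y s)) volume 0 1
  eq_integral : ∀ t ∈ Icc (0 : ℝ) 1, y t = x + ∫ s in (0 : ℝ)..t, v s (y s)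

open Classical in
/-- The flow `t ↦ ℜ(t, x)` of the field `v`: the solution that starts at `x` (and the constant
path if there is none). -/
noncomputable def flow {d : ℕ} (Ω : Set (EuclideanSpace ℝ (Fin d)))
    (v : ℝ → EuclideanSpace ℝ (Fin d) → EuclideanSpace ℝ (Fin d))
    (t : ℝ) (x : EuclideanSpace ℝ (Fin d)) : EuclideanSpace ℝ (Fin d) :=
  if h : ∃ y, IsSolution Ω v x y then h.choose t else x

/-- The set `B(t)` of points of `Ω` at which `z ↦ v(t, z)` is not differentiable. -/
def nonDiff {d : ℕ} (Ω : Set (EuclideanSpace ℝ (Fin d)))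
    (v : ℝ → EuclideanSpace ℝ (Fin d) → EuclideanSpace ℝ (Fin d)) (t : ℝ) :
    Set (EuclideanSpace ℝ (Fin d)) :=
  {z ∈ Ω | ¬ DifferentiableAt ℝ (v t) z}

/-- `ℰ₁`: the points of `Ω` at positive distance from the boundary. -/
def E₁ {d : ℕ} (Ω : Set (EuclideanSpace ℝ (Fin d))) : Set (EuclideanSpace ℝ (Fin d)) :=
  {z ∈ Ω | 0 < Metric.infDist z (frontier Ω)}

/-- `ℰ₂`: the points that the flow takes, at time `1`, to positive distance from the boundary. -/
def E₂ {d : ℕ} (Ω : Set (EuclideanSpace ℝ (Fin d)))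
    (v : ℝ → EuclideanSpace ℝ (Fin d) → EuclideanSpace ℝ (Fin d)) :
    Set (EuclideanSpace ℝ (Fin d)) :=
  {z ∈ Ω | 0 < Metric.infDist (flow Ω v 1 z) (frontier Ω)}

/-- `ℰ₄`: the points whose path meets the non-differentiability sets at Lebesgue-almost no time. -/
def E₄ {d : ℕ} (Ω : Set (EuclideanSpace ℝ (Fin d)))
    (v : ℝ → EuclideanSpace ℝ (Fin d) → EuclideanSpace ℝ (Fin d)) :
    Set (EuclideanSpace ℝ (Fin d)) :=
  {z ∈ Ω | volume {t ∈ Icc (0 : ℝ) 1 | flow Ω v t z ∈ nonDiff Ω v t} = 0}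

/-- The modulus `ω(η) = sup max {|p(z)/p(z') - 1|, |q(z)/q(z') - 1|}` over `z, z' ∈ Ω` with
`‖z - z'‖ ≤ η`. If `p` or `q` has a zero in `Ω`, then `ω ≥ 1` by the choice `z = z'`. -/
noncomputable def modulus {d : ℕ} (Ω : Set (EuclideanSpace ℝ (Fin d)))
    (p q : EuclideanSpace ℝ (Fin d) → ℝ) (η : ℝ) : ℝ≥0∞ :=
  ⨆ (z ∈ Ω) (z' ∈ Ω) (_ : ‖z - z'‖ ≤ η),
    ENNReal.ofReal (max |p z / p z' - 1| |q z / q z' - 1|)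

/-- There is a finite `L` with `ω(η) ≤ Lη` for all `η > 0`. -/
def HasLinearModulus {d : ℕ} (Ω : Set (EuclideanSpace ℝ (Fin d)))
    (p q : EuclideanSpace ℝ (Fin d) → ℝ) : Prop :=
  ∃ L : ℝ, ∀ η > 0, modulus Ω p q η ≤ ENNReal.ofReal (L * η)

open Classical in
/-- `|ln (a / b)|` for `b > 0`, with value `∞` if `a ≤ 0`. -/
noncomputable def absLogRatio (a b : ℝ) : ℝ≥0∞ :=
  if 0 < a then ENNReal.ofReal |Real.log (a / b)| else ⊤

/-- `sup_{x ∈ Ω} max {|ln (p̂₀/p₀)|, |ln (p̂₁/p₁)|}`. -/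
noncomputable def logRatioError {d : ℕ} (Ω : Set (EuclideanSpace ℝ (Fin d)))
    (p₀ p₁ q₀ q₁ : EuclideanSpace ℝ (Fin d) → ℝ) : ℝ≥0∞ :=
  ⨆ x ∈ Ω, max (absLogRatio (q₀ x) (p₀ x)) (absLogRatio (q₁ x) (p₁ x))

/-- `ess sup_{x ∈ Ω°} max {‖∇ log p̂₀ - ∇ log p₀‖, ‖∇ log p̂₁ - ∇ log p₁‖}`. -/
noncomputable def scoreError {d : ℕ} (Ω : Set (EuclideanSpace ℝ (Fin d)))
    (p₀ p₁ q₀ q₁ : EuclideanSpace ℝ (Fin d) → ℝ) : ℝ≥0∞ :=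
  essSup (fun x =>
    max ‖gradient (fun y => Real.log (q₀ y)) x - gradient (fun y => Real.log (p₀ y)) x‖ₑ
      ‖gradient (fun y => Real.log (q₁ y)) x - gradient (fun y => Real.log (p₁ y)) x‖ₑ)
    (volume.restrict (interior Ω))

/-- `w` solves, on `[0,1]`, the linear Volterra equation `w(t) = ∫₀ᵗ a(s) ds + ∫₀ᵗ b(s) w(s) ds`. -/
structure IsVolterraSolution {d : ℕ}
    (b : ℝ → EuclideanSpace ℝ (Fin d) →L[ℝ] EuclideanSpace ℝ (Fin d))
    (a w : ℝ → EuclideanSpace ℝ (Fin d)) : Prop where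
  integrable_drift : IntervalIntegrable a volume 0 1
  integrable : IntervalIntegrable (fun s => b s (w s)) volume 0 1
  eq_integral : ∀ t ∈ Icc (0 : ℝ) 1,
    w t = (∫ s in (0 : ℝ)..t, a s) + ∫ s in (0 : ℝ)..t, b s (w s)

open Classical in
/-- The solution of the linear Volterra equation (and `0` if there is none). -/
noncomputable def volterraSolution {d : ℕ}
    (b : ℝ → EuclideanSpace ℝ (Fin d) →L[ℝ] EuclideanSpace ℝ (Fin d))
    (a : ℝ → EuclideanSpace ℝ (Fin d)) : ℝ → EuclideanSpace ℝ (Fin d) :=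
  if h : ∃ w, IsVolterraSolution b a w then h.choose else 0

/-- `Φ` solves, on `[0,1]`, the matrix equation `Φ(t) = I + ∫₀ᵗ b(s) Φ(s) ds`. -/
structure IsFundamentalSolution {d : ℕ}
    (b Φ : ℝ → EuclideanSpace ℝ (Fin d) →L[ℝ] EuclideanSpace ℝ (Fin d)) : Prop where
  integrable : IntervalIntegrable (fun s => b s ∘L Φ s) volume 0 1
  eq_integral : ∀ t ∈ Icc (0 : ℝ) 1,
    Φ t = ContinuousLinearMap.id ℝ (EuclideanSpace ℝ (Fin d)) + ∫ s in (0 : ℝ)..t, b s ∘L Φ s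

/-- `A_n = o_p(B_n)`: for every `ε > 0` the probability of `A_n > ε B_n` tends to `0`. For events
that are not measurable, `P` is the outer probability. -/
def IsLittleOP {Ξ : Type*} [MeasurableSpace Ξ] (P : Measure Ξ) (A B : ℕ → Ξ → ℝ≥0∞) : Prop :=
  ∀ ε : ℝ, 0 < ε → Tendsto (fun n => P {ξ | ENNReal.ofReal ε * B n ξ < A n ξ}) atTop (𝓝 0)

end RectifiedFlow

namespace RectifiedFlow
open Classical in
lemma IsDensityOn.measurable {d : ℕ} {Ω : Set (EuclideanSpace ℝ (Fin d))}
    {p : EuclideanSpace ℝ (Fin d) → ℝ} (h : IsDensityOn Ω p) (hΩ : IsCompact Ω) :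
    Measurable p := by
  have : p = Ω.piecewise p 0 := by
    funext x
    by_cases hx : x ∈ Ω
    · simp [hx]
    · simp [hx, h.eq_zero_of_notMem x hx]
  rw [this]
  exact h.continuousOn.measurable_piecewise continuousOn_const hΩ.measurableSet

lemma IsDensityOn.nonneg {d : ℕ} {Ω : Set (EuclideanSpace ℝ (Fin d))}
    {p : EuclideanSpace ℝ (Fin d) → ℝ} (h : IsDensityOn Ω p) (x) : 0 ≤ p x := by
  obtain ⟨c, hc, hcp⟩ := h.bounded_below
  by_cases hx : x ∈ Ω
  · exact hc.le.trans (hcp x hx)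
  · simp [h.eq_zero_of_notMem x hx]

lemma IsDensityOn.integrable {d : ℕ} {Ω : Set (EuclideanSpace ℝ (Fin d))}
    {p : EuclideanSpace ℝ (Fin d) → ℝ} (h : IsDensityOn Ω p) : Integrable p := by
  by_contra hc
  have := h.integral_eq_one
  rw [integral_undef hc] at this
  norm_num at this

/-- The change of variables `(z, δ) ↦ (z - tδ, z + (1-t)δ)` preserves volume. -/
lemma measurePreserving_chord {d : ℕ} (t : ℝ) :
    MeasurePreserving (fun w : EuclideanSpace ℝ (Fin d) × EuclideanSpace ℝ (Fin d) =>
      (w.1 - t • w.2, w.1 + (1 - t) • w.2)) (volume.prod volume) (volume.prod volume) := by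
  have h1 : MeasurePreserving (fun w : EuclideanSpace ℝ (Fin d) × EuclideanSpace ℝ (Fin d) =>
      (w.1, w.2 - t • w.1)) (volume.prod volume) (volume.prod volume) := by
    refine (MeasurePreserving.id volume).skew_product (g := fun a b => b - t • a) ?_ ?_
    · fun_prop
    · exact Filter.Eventually.of_forall fun a => (measurePreserving_sub_right volume (t • a)).map_eq
  have h2 := (measurePreserving_prod_add (volume : Measure (EuclideanSpace ℝ (Fin d)))
    (volume : Measure (EuclideanSpace ℝ (Fin d))))
  have h3 := Measure.measurePreserving_swap
    (μ := (volume : Measure (EuclideanSpace ℝ (Fin d))))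
    (ν := (volume : Measure (EuclideanSpace ℝ (Fin d))))
  have := h2.comp (h3.comp (h1.comp h3))
  convert this using 1
  funext w
  simp only [Function.comp, Prod.swap]
  ext1
  · rfl
  · simp only [sub_smul, one_smul]; abel

lemma velocity_eq {d : ℕ} {Ω : Set (EuclideanSpace ℝ (Fin d))}
    {p q : EuclideanSpace ℝ (Fin d) → ℝ} (hp : IsDensityOn Ω p) (hq : IsDensityOn Ω q)
    (t : ℝ) (z : EuclideanSpace ℝ (Fin d)) :
    velocity Ω p q t z = (∫ δ, p (z - t • δ) * q (z + (1 - t) • δ))⁻¹ •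
      ∫ δ, (p (z - t • δ) * q (z + (1 - t) • δ)) • δ := by
  have key : ∀ δ, δ ∉ admissible Ω t z → p (z - t • δ) * q (z + (1 - t) • δ) = 0 := by
    intro δ hδ
    by_cases h : z - t • δ ∈ Ω
    · rw [hq.eq_zero_of_notMem _ (fun h' => hδ ⟨h, h'⟩), mul_zero]
    · rw [hp.eq_zero_of_notMem _ h, zero_mul]
  rw [velocity, setIntegral_eq_integral_of_forall_compl_eq_zero key,
    setIntegral_eq_integral_of_forall_compl_eq_zero (fun δ hδ => by rw [key δ hδ, zero_smul])]

/-- For independent `X₀ ∼ p`, `X₁ ∼ q`, the field `velocity Ω p q` evaluated at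
`X_t = (1-t)X₀ + tX₁` is the conditional expectation `E[X₁ - X₀ | X_t]`. -/
theorem velocity_eq_condExp {d : ℕ} {Ω : Set (EuclideanSpace ℝ (Fin d))} (hΩ : IsCompact Ω)
    {p q : EuclideanSpace ℝ (Fin d) → ℝ} (hp : IsDensityOn Ω p) (hq : IsDensityOn Ω q) (t : ℝ)
    (X : EuclideanSpace ℝ (Fin d) × EuclideanSpace ℝ (Fin d) → EuclideanSpace ℝ (Fin d))
    (hX : X = fun w => (1 - t) • w.1 + t • w.2)
    (μ : Measure (EuclideanSpace ℝ (Fin d) × EuclideanSpace ℝ (Fin d)))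
    (hμ : μ = (volume.withDensity fun x => ENNReal.ofReal (p x)).prod
      (volume.withDensity fun x => ENNReal.ofReal (q x))) :
    (fun w => velocity Ω p q t (X w)) =ᵐ[μ]
      μ[fun w => w.2 - w.1 | MeasurableSpace.comap X inferInstance] := by
  have hpm := hp.measurable hΩ
  have hqm := hq.measurable hΩ
  have hXm : Measurable X := by rw [hX]; fun_prop
  set T : EuclideanSpace ℝ (Fin d) × EuclideanSpace ℝ (Fin d) →
      EuclideanSpace ℝ (Fin d) × EuclideanSpace ℝ (Fin d) :=
    fun w => (w.1 - t • w.2, w.1 + (1 - t) • w.2) with hT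
  have hTm : Measurable T := by rw [hT]; fun_prop
  have hTmp : MeasurePreserving T (volume.prod volume) (volume.prod volume) :=
    measurePreserving_chord t
  have hTX : ∀ w, X (T w) = w.1 := by
    intro w; rw [hX, hT]; simp only [smul_sub, smul_add, smul_smul, sub_smul, one_smul]
    module
  have hTd : ∀ w, (T w).2 - (T w).1 = w.2 := by
    intro w; rw [hT]; simp only; module
  set r : EuclideanSpace ℝ (Fin d) × EuclideanSpace ℝ (Fin d) → ℝ :=
    fun w => p w.1 * q w.2 with hr
  have hrm : Measurable r := by rw [hr]; fun_prop
  have hr0 : ∀ w, 0 ≤ r w := fun w => mul_nonneg (hp.nonneg _) (hq.nonneg _)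
  have hμ' : μ = (volume.prod volume).withDensity (fun w => ENNReal.ofReal (r w)) := by
    rw [hμ, prod_withDensity (by fun_prop) (by fun_prop)]
    congr 1; funext w; rw [hr, ENNReal.ofReal_mul (hp.nonneg _)]
  -- integrability over the chord coordinates
  have hri : Integrable r (volume.prod volume) := hp.integrable.mul_prod hq.integrable
  have hrT : Integrable (fun w => r (T w)) (volume.prod volume) := hTmp.integrable_comp_of_integrable hri
  have : IsFiniteMeasure μ := by
    rw [hμ']; exact isFiniteMeasure_withDensity_ofReal hri.2
  have hint : ∀ g : EuclideanSpace ℝ (Fin d) × EuclideanSpace ℝ (Fin d) → EuclideanSpace ℝ (Fin d),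
      StronglyMeasurable g →
      (∫ w, g w ∂μ = ∫ w, r (T w) • g (T w) ∂(volume.prod volume)) := by
    intro g hg
    rw [hμ', integral_withDensity_eq_integral_toReal_smul (by fun_prop) (by simp)]
    have hm : AEStronglyMeasurable (fun w => r w • g w) (Measure.map T (volume.prod volume)) :=
      (hrm.stronglyMeasurable.smul hg).aestronglyMeasurable
    have h := integral_map hTm.aemeasurable hm
    rw [hTmp.map_eq] at h
    rw [← h]
    simp only [ENNReal.toReal_ofReal (hr0 _)]
  obtain ⟨D, hD⟩ := hΩ.isBounded.exists_norm_le
  have hrD : ∀ w, r (T w) * ‖w.2‖ ≤ r (T w) * (2 * D) := by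
    intro w
    by_cases h1 : (T w).1 ∈ Ω
    · by_cases h2 : (T w).2 ∈ Ω
      · refine mul_le_mul_of_nonneg_left ?_ (hr0 _)
        rw [← hTd w]
        linarith [norm_sub_le (T w).2 (T w).1, hD _ h1, hD _ h2]
      · simp [hr, hq.eq_zero_of_notMem _ h2]
    · simp [hr, hp.eq_zero_of_notMem _ h1]
  have hf : Integrable (fun w => r (T w) • w.2) (volume.prod volume) := by
    refine (hrT.mul_const (2 * D)).mono' ?_ (Eventually.of_forall fun w => ?_)
    · exact ((hrm.comp hTm).stronglyMeasurable.smul measurable_snd.stronglyMeasurable).aestronglyMeasurable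
    · rw [norm_smul, Real.norm_of_nonneg (hr0 _)]; exact hrD w
  have hvel : ∀ z, velocity Ω p q t z = (∫ δ, r (T (z, δ)))⁻¹ • ∫ δ, r (T (z, δ)) • δ :=
    fun z => velocity_eq hp hq t z
  have hvm : StronglyMeasurable (velocity Ω p q t) := by
    have : velocity Ω p q t = fun z => (∫ δ, r (T (z, δ)))⁻¹ • ∫ δ, r (T (z, δ)) • δ :=
      funext hvel
    rw [this]
    have h1 : StronglyMeasurable fun z => ∫ δ, r (T (z, δ)) :=
      StronglyMeasurable.integral_prod_right (f := fun z δ => r (T (z, δ)))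
        (hrm.comp hTm).stronglyMeasurable
    have h2 : StronglyMeasurable fun z => ∫ δ, r (T (z, δ)) • δ :=
      StronglyMeasurable.integral_prod_right (f := fun z δ => r (T (z, δ)) • δ)
        ((hrm.comp hTm).stronglyMeasurable.smul measurable_snd.stronglyMeasurable)
    exact h1.measurable.inv.stronglyMeasurable.smul h2
  -- the field is bounded
  have hvb : ∀ z, ‖velocity Ω p q t z‖ ≤ 2 * |D| := by
    intro z
    rw [hvel, norm_smul, norm_inv, Real.norm_of_nonneg (integral_nonneg fun δ => hr0 _)]
    by_cases hi : Integrable fun δ => r (T (z, δ))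
    · have : ‖∫ δ, r (T (z, δ)) • δ‖ ≤ ∫ δ, r (T (z, δ)) * (2 * |D|) := by
        refine norm_integral_le_of_norm_le (hi.mul_const _) (Eventually.of_forall fun δ => ?_)
        rw [norm_smul, Real.norm_of_nonneg (hr0 _)]
        refine (hrD (z, δ)).trans (mul_le_mul_of_nonneg_left ?_ (hr0 _))
        linarith [le_abs_self D]
      rw [integral_mul_const] at this
      have hn : 0 ≤ ∫ δ, r (T (z, δ)) := integral_nonneg fun δ => hr0 _
      rcases hn.eq_or_lt with h0 | h0
      · rw [← h0]; simp
      · refine (mul_le_mul_of_nonneg_left this (inv_nonneg.2 h0.le)).trans ?_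
        rw [← mul_assoc, inv_mul_cancel₀ h0.ne', one_mul]
    · rw [integral_undef hi]; simp
  have hvi : Integrable (fun w => velocity Ω p q t (X w)) μ :=
    Integrable.of_bound (hvm.comp_measurable hXm).aestronglyMeasurable (2 * |D|)
      (Eventually.of_forall fun w => hvb _)
  have hdm : StronglyMeasurable
      (fun w : EuclideanSpace ℝ (Fin d) × EuclideanSpace ℝ (Fin d) => w.2 - w.1) :=
    (measurable_snd.sub measurable_fst).stronglyMeasurable
  have hdi : Integrable
      (fun w : EuclideanSpace ℝ (Fin d) × EuclideanSpace ℝ (Fin d) => w.2 - w.1) μ := by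
    rw [hμ', integrable_withDensity_iff_integrable_smul' (by fun_prop) (by simp)]
    have h1 : Integrable (fun w : EuclideanSpace ℝ (Fin d) × EuclideanSpace ℝ (Fin d) =>
        r w • (w.2 - w.1)) (volume.prod volume) := by
      have hm : AEStronglyMeasurable
          (fun w : EuclideanSpace ℝ (Fin d) × EuclideanSpace ℝ (Fin d) => r w • (w.2 - w.1))
          (volume.prod volume) := (hrm.stronglyMeasurable.smul hdm).aestronglyMeasurable
      rw [← hTmp.integrable_comp hm]
      refine hf.congr (Eventually.of_forall fun w => ?_)
      simp only [Function.comp, hTd]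
    refine h1.congr (Eventually.of_forall fun w => ?_)
    simp [ENNReal.toReal_ofReal (hr0 _)]
  refine ae_eq_condExp_of_forall_setIntegral_eq hXm.comap_le hdi
    (fun s _ _ => hvi.integrableOn) ?_ ?_
  · rintro _ ⟨B, hB, rfl⟩ _
    have hXB : MeasurableSet (X ⁻¹' B) := hXm hB
    have hvX : StronglyMeasurable fun w => velocity Ω p q t (X w) := hvm.comp_measurable hXm
    rw [← integral_indicator hXB, ← integral_indicator hXB,
      hint _ (hvX.indicator hXB), hint _ (hdm.indicator hXB)]
    have e1 : ∀ w, r (T w) • (X ⁻¹' B).indicator (fun w => velocity Ω p q t (X w)) (T w) =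
        B.indicator (fun _ => r (T w) • velocity Ω p q t w.1) w.1 := by
      intro w
      by_cases h : w.1 ∈ B <;> simp [indicator, hTX, h]
    have e2 : ∀ w, r (T w) • (X ⁻¹' B).indicator
        (fun w : EuclideanSpace ℝ (Fin d) × EuclideanSpace ℝ (Fin d) => w.2 - w.1) (T w) =
        B.indicator (fun _ => r (T w) • w.2) w.1 := by
      intro w
      by_cases h : w.1 ∈ B <;> simp [indicator, hTX, hTd, h]
    simp_rw [e1, e2]
    have hB1 : MeasurableSet {w : EuclideanSpace ℝ (Fin d) × EuclideanSpace ℝ (Fin d) | w.1 ∈ B} :=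
      measurable_fst hB
    have i1 : Integrable (fun w : EuclideanSpace ℝ (Fin d) × EuclideanSpace ℝ (Fin d) =>
        B.indicator (fun _ => r (T w) • velocity Ω p q t w.1) w.1) (volume.prod volume) := by
      have : Integrable (fun w => r (T w) • velocity Ω p q t w.1) (volume.prod volume) :=
        hrT.smul_bdd (2 * |D|)
          (hvm.comp_measurable measurable_fst).aestronglyMeasurable
          (Eventually.of_forall fun w => hvb _)
      exact this.indicator hB1
    have i2 : Integrable (fun w : EuclideanSpace ℝ (Fin d) × EuclideanSpace ℝ (Fin d) =>
        B.indicator (fun _ => r (T w) • w.2) w.1) (volume.prod volume) := hf.indicator hB1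
    rw [integral_prod _ i1, integral_prod _ i2]
    refine integral_congr_ae ?_
    filter_upwards [hrT.prod_right_ae] with z hz
    by_cases h : z ∈ B
    · simp only [indicator_of_mem h]
      rw [integral_smul_const, hvel]
      rcases eq_or_ne (∫ δ, r (T (z, δ))) 0 with h0 | h0
      · rw [h0, zero_smul]
        rw [integral_eq_zero_iff_of_nonneg (fun δ => hr0 _) hz] at h0
        symm
        apply integral_eq_zero_of_ae
        filter_upwards [h0] with δ hδ
        simp only [Pi.zero_apply] at hδ ⊢
        rw [hδ, zero_smul]
      · rw [smul_smul, mul_inv_cancel₀ h0, one_smul]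
    · simp [indicator_of_notMem h]
  · have : Measurable[MeasurableSpace.comap X inferInstance] X := comap_measurable X
    exact (hvm.comp_measurable this).aestronglyMeasurable

end RectifiedFlow

/-!
The velocity at `(t, z)` is an average of displacements `δ` with `z + (1 - t) δ ∈ Ω`, so an
integral curve `y` satisfies `(f y)' ≤ (c - f y) / (1 - t)` for every half-space `{f ≤ c}`
containing `Ω`. Hence its distance to the boundary decreases at most like `1 - t`, and solutions
exist up to time `1`. If the ball of radius `ρ` around `z` lies in `Ω`, convexity gives
`(1 - ‖z - z'‖ / ρ) S_t(z) ⊆ S_t(z')`, so the domain of integration changes by a volume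
`O(‖z - z'‖)`. Thus `v` is Lipschitz away from the boundary, and `v̂ - v` is bounded and Lipschitz
there with constant `O(rₙ + sₙ)`: by Rademacher and Fubini, `sₙ` is a Lipschitz constant of
`log (p̂ⱼ / pⱼ)`.

The remainder `R̂ - R - E` solves the linearized equation with two forcing terms. The increment of
`v̂ - v` between `R` and `R̂` is `o(1) ‖R̂ - R‖`. The linearization error of `v` at `R` is, for
almost every time, `o(‖R̂ - R‖)`, and by dominated convergence this is uniform in the mean.
Grönwall's inequality then bounds the remainder by `o(1) sup ‖R̂ - R‖`, hence by `o(1) sup ‖E‖`.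
-/

namespace RectifiedFlow

section Primitive

variable {F G W : Type*} [NormedAddCommGroup F] [NormedAddCommGroup G] [NormedAddCommGroup W]
  {T C : ℝ}

theorem intervalIntegrable_of_mem_Icc {f : ℝ → F} {s t : ℝ}
    (hf : IntervalIntegrable f volume 0 T) (hs : s ∈ Icc 0 T) (ht : t ∈ Icc 0 T) :
    IntervalIntegrable f volume s t :=
  hf.mono_set ((uIcc_subset_Icc hs ht).trans Icc_subset_uIcc)

theorem intervalIntegrable_of_norm_le {f : ℝ → F} (hT : 0 ≤ T)
    (hf : AEStronglyMeasurable f (volume.restrict (Icc 0 T)))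
    (hC : ∀ s ∈ Icc (0 : ℝ) T, ‖f s‖ ≤ C) : IntervalIntegrable f volume 0 T := by
  rw [intervalIntegrable_iff_integrableOn_Icc_of_le hT]
  exact Integrable.of_bound hf C (ae_restrict_of_forall_mem measurableSet_Icc hC)

theorem intervalIntegrable_of_forall_lt {f : ℝ → F} (hT : 0 < T)
    (hf : ∀ S ∈ Ico 0 T, IntervalIntegrable f volume 0 S)
    (hC : ∀ s ∈ Ico (0 : ℝ) T, ‖f s‖ ≤ C) : IntervalIntegrable f volume 0 T := by
  obtain ⟨S, -, hS, hST⟩ := exists_seq_strictMono_tendsto' hT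
  have hint (n : ℕ) : IntegrableOn f (Ioc 0 (S n)) :=
    (intervalIntegrable_iff_integrableOn_Ioc_of_le (hS n).1.le).1 (hf _ ⟨(hS n).1.le, (hS n).2⟩)
  have hC0 : 0 ≤ C := (norm_nonneg _).trans (hC 0 (left_mem_Ico.2 hT))
  rw [intervalIntegrable_iff_integrableOn_Ioc_of_le hT.le]
  refine integrableOn_Ioc_of_intervalIntegral_norm_bounded_right (I := C * T) hint hST
    (Eventually.of_forall fun n => ?_)
  calc ∫ s in Ioc 0 (S n), ‖f s‖ ≤ ∫ _ in Ioc 0 (S n), C :=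
        setIntegral_mono_on (hint n).norm (by simp) measurableSet_Ioc
          fun s hs => hC s ⟨hs.1.le, hs.2.trans_lt (hS n).2⟩
    _ = C * S n := by simp [(hS n).1.le, mul_comm]
    _ ≤ C * T := by gcongr; exact (hS n).2.le

variable [NormedSpace ℝ F] [NormedSpace ℝ G] [NormedSpace ℝ W]

/-- `u` is a primitive of `k` on `[0, T]` in the sense of Carathéodory: `k` is integrable and
`u t = u 0 + ∫₀ᵗ k`. All integral equations below are statements of this form in which `k`
depends on `u`. -/
structure IsPrimitiveOn (T : ℝ) (u k : ℝ → F) : Prop where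
  intervalIntegrable : IntervalIntegrable k volume 0 T
  eq_add_integral : ∀ t ∈ Icc (0 : ℝ) T, u t = u 0 + ∫ s in (0 : ℝ)..t, k s

variable {u u₁ u₂ k k₁ k₂ : ℝ → F}

theorem isPrimitiveOn_integral (hk : IntervalIntegrable k volume 0 T) :
    IsPrimitiveOn T (fun t => ∫ s in (0 : ℝ)..t, k s) k :=
  ⟨hk, fun t _ => by simp⟩

theorem IsPrimitiveOn.aestronglyMeasurable (h : IsPrimitiveOn T u k) (hT : 0 ≤ T) :
    AEStronglyMeasurable k (volume.restrict (Icc 0 T)) :=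
  ((intervalIntegrable_iff_integrableOn_Icc_of_le hT).1 h.intervalIntegrable).aestronglyMeasurable

theorem IsPrimitiveOn.mono {S : ℝ} (h : IsPrimitiveOn T u k) (hS : S ∈ Icc 0 T) :
    IsPrimitiveOn S u k where
  intervalIntegrable :=
    intervalIntegrable_of_mem_Icc h.intervalIntegrable ⟨le_rfl, hS.1.trans hS.2⟩ hS
  eq_add_integral t ht := h.eq_add_integral t ⟨ht.1, ht.2.trans hS.2⟩

theorem IsPrimitiveOn.congr_left (h : IsPrimitiveOn T u₁ k) (hu : EqOn u₂ u₁ (Icc 0 T)) :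
    IsPrimitiveOn T u₂ k where
  intervalIntegrable := h.intervalIntegrable
  eq_add_integral t ht := by
    rw [hu ht, hu ⟨le_rfl, ht.1.trans ht.2⟩, h.eq_add_integral t ht]

theorem IsPrimitiveOn.congr_right (hT : 0 ≤ T) (h : IsPrimitiveOn T u k₁)
    (hk : EqOn k₂ k₁ (Ioo 0 T)) : IsPrimitiveOn T u k₂ where
  intervalIntegrable := h.intervalIntegrable.congr_uIoo (uIoo_of_le hT ▸ hk.symm)
  eq_add_integral t ht := by
    rw [h.eq_add_integral t ht, intervalIntegral.integral_congr_Ioo_of_le ht.1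
      (hk.mono (Ioo_subset_Ioo_right ht.2))]

theorem IsPrimitiveOn.add (h₁ : IsPrimitiveOn T u₁ k₁) (h₂ : IsPrimitiveOn T u₂ k₂) :
    IsPrimitiveOn T (fun t => u₁ t + u₂ t) (fun t => k₁ t + k₂ t) where
  intervalIntegrable := h₁.intervalIntegrable.add h₂.intervalIntegrable
  eq_add_integral t ht := by
    have h0 : (0 : ℝ) ∈ Icc 0 T := ⟨le_rfl, ht.1.trans ht.2⟩
    rw [h₁.eq_add_integral t ht, h₂.eq_add_integral t ht, intervalIntegral.integral_add
      (intervalIntegrable_of_mem_Icc h₁.intervalIntegrable h0 ht)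
      (intervalIntegrable_of_mem_Icc h₂.intervalIntegrable h0 ht)]
    abel

theorem IsPrimitiveOn.sub (h₁ : IsPrimitiveOn T u₁ k₁) (h₂ : IsPrimitiveOn T u₂ k₂) :
    IsPrimitiveOn T (fun t => u₁ t - u₂ t) (fun t => k₁ t - k₂ t) where
  intervalIntegrable := h₁.intervalIntegrable.sub h₂.intervalIntegrable
  eq_add_integral t ht := by
    have h0 : (0 : ℝ) ∈ Icc 0 T := ⟨le_rfl, ht.1.trans ht.2⟩
    rw [h₁.eq_add_integral t ht, h₂.eq_add_integral t ht, intervalIntegral.integral_sub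
      (intervalIntegrable_of_mem_Icc h₁.intervalIntegrable h0 ht)
      (intervalIntegrable_of_mem_Icc h₂.intervalIntegrable h0 ht)]
    abel

theorem IsPrimitiveOn.clm_apply [CompleteSpace F] [CompleteSpace G] (h : IsPrimitiveOn T u k)
    (L : F →L[ℝ] G) : IsPrimitiveOn T (fun t => L (u t)) (fun t => L (k t)) where
  intervalIntegrable :=
    ⟨L.integrable_comp h.intervalIntegrable.1, L.integrable_comp h.intervalIntegrable.2⟩
  eq_add_integral t ht := by
    rw [h.eq_add_integral t ht, map_add, L.intervalIntegral_comp_comm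
      (intervalIntegrable_of_mem_Icc h.intervalIntegrable ⟨le_rfl, ht.1.trans ht.2⟩ ht)]

theorem IsPrimitiveOn.sub_eq_integral (h : IsPrimitiveOn T u k) {s t : ℝ} (hs : s ∈ Icc 0 T)
    (ht : t ∈ Icc 0 T) : u t - u s = ∫ r in s..t, k r := by
  have h0 : (0 : ℝ) ∈ Icc 0 T := ⟨le_rfl, hs.1.trans hs.2⟩
  rw [h.eq_add_integral t ht, h.eq_add_integral s hs, add_sub_add_left_eq_sub,
    intervalIntegral.integral_interval_sub_left
      (intervalIntegrable_of_mem_Icc h.intervalIntegrable h0 ht)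
      (intervalIntegrable_of_mem_Icc h.intervalIntegrable h0 hs)]

theorem IsPrimitiveOn.continuousOn (h : IsPrimitiveOn T u k) : ContinuousOn u (Icc 0 T) :=
  (continuousOn_const.add ((intervalIntegral.continuousOn_primitive_interval'
    h.intervalIntegrable left_mem_uIcc).mono Icc_subset_uIcc)).congr h.eq_add_integral

theorem IsPrimitiveOn.norm_sub_le (h : IsPrimitiveOn T u k)
    (hC : ∀ s ∈ Icc (0 : ℝ) T, ‖k s‖ ≤ C) {s t : ℝ} (hs : s ∈ Icc 0 T) (ht : t ∈ Icc 0 T) :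
    ‖u t - u s‖ ≤ C * |t - s| := by
  rw [h.sub_eq_integral hs ht]
  exact intervalIntegral.norm_integral_le_of_norm_le_const fun r hr =>
    hC r (uIcc_subset_Icc hs ht (uIoc_subset_uIcc hr))

theorem IsPrimitiveOn.lipschitzOnWith {K : ℝ≥0} (h : IsPrimitiveOn T u k)
    (hK : ∀ s ∈ Icc (0 : ℝ) T, ‖k s‖ ≤ K) : LipschitzOnWith K u (Icc 0 T) :=
  LipschitzOnWith.of_dist_le_mul fun s hs t ht => by
    rw [dist_comm, dist_comm s, dist_eq_norm, Real.dist_eq]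
    exact h.norm_sub_le hK hs ht

theorem IsPrimitiveOn.hasDerivWithinAt_Ici [CompleteSpace F] (h : IsPrimitiveOn T u k)
    (hk : ContinuousOn k (Icc 0 T)) {t : ℝ} (ht : t ∈ Ico 0 T) :
    HasDerivWithinAt u (k t) (Ici t) t := by
  have hIcc : Icc 0 T ∈ 𝓝[>] t :=
    mem_of_superset (Icc_mem_nhdsGT ht.2) (Icc_subset_Icc_left ht.1)
  have hmem : t ∈ Icc 0 T := Ico_subset_Icc_self ht
  have hint := intervalIntegral.integral_hasDerivWithinAt_right
    (intervalIntegrable_of_mem_Icc h.intervalIntegrable ⟨le_rfl, hmem.1.trans hmem.2⟩ hmem)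
    ⟨Icc 0 T, hIcc, hk.aestronglyMeasurable measurableSet_Icc⟩
    ((hk t hmem).mono_of_mem_nhdsWithin hIcc) (s := Ici t)
  refine (hint.const_add (u 0)).congr_of_eventuallyEq ?_ (h.eq_add_integral t hmem)
  exact eventually_of_mem (Icc_mem_nhdsGE_of_mem ht) h.eq_add_integral

theorem IsPrimitiveOn.ae_hasDerivAt [CompleteSpace F] (h : IsPrimitiveOn T u k) :
    ∀ᵐ t, t ∈ Ioo 0 T → HasDerivAt u (k t) t := by
  filter_upwards [h.intervalIntegrable.ae_hasDerivAt_integral] with t hder ht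
  refine ((hder (Icc_subset_uIcc (Ioo_subset_Icc_self ht)) 0 left_mem_uIcc).const_add
    (u 0)).congr_of_eventuallyEq ?_
  exact eventually_of_mem (Icc_mem_nhds ht.1 ht.2) h.eq_add_integral

theorem isPrimitiveOn_of_lipschitzOnWith [CompleteSpace F] {K : ℝ≥0} (hT : 0 ≤ T)
    (hu : LipschitzOnWith K u (Icc 0 T)) (hk : AEStronglyMeasurable k (volume.restrict (Icc 0 T)))
    (hC : ∀ s ∈ Icc (0 : ℝ) T, ‖k s‖ ≤ C) (hder : ∀ᵐ t, t ∈ Ioo 0 T → HasDerivAt u (k t) t) :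
    IsPrimitiveOn T u k := by
  have hki := intervalIntegrable_of_norm_le hT hk hC
  have hv := isPrimitiveOn_integral hki
  have hlip : LipschitzOnWith (K + C.toNNReal) (fun t => u t - ∫ s in (0 : ℝ)..t, k s)
      (uIcc 0 T) := by
    rw [uIcc_of_le hT]
    exact hu.sub (hv.lipschitzOnWith fun s hs => (hC s hs).trans (Real.le_coe_toNNReal C))
  have hzero : ∀ᵐ t, t ∈ uIcc 0 T → HasDerivAt (fun t => u t - ∫ s in (0 : ℝ)..t, k s) 0 t := by
    filter_upwards [hder, hv.ae_hasDerivAt, Measure.ae_ne volume 0, Measure.ae_ne volume T]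
      with t hut hvt ht0 htT ht
    rw [uIcc_of_le hT] at ht
    have hmem : t ∈ Ioo 0 T := ⟨ht.1.lt_of_ne' ht0, ht.2.lt_of_ne htT⟩
    have h := (hut hmem).fun_sub (hvt hmem)
    rwa [sub_self] at h
  obtain ⟨c, hc⟩ := hlip.absolutelyContinuousOnInterval.const_of_ae_hasDerivAt_zero hzero
  refine ⟨hki, fun t ht => sub_eq_iff_eq_add.1 ?_⟩
  rw [hc t (Icc_subset_uIcc ht), ← hc 0 left_mem_uIcc, intervalIntegral.integral_same, sub_zero]

theorem lipschitzOnWith_bilin {α : Type*} [PseudoMetricSpace α] (B : F →L[ℝ] G →L[ℝ] W)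
    {f : α → F} {g : α → G} {s : Set α} {Kf Kg Mf Mg : ℝ≥0} (hf : LipschitzOnWith Kf f s)
    (hg : LipschitzOnWith Kg g s) (hMf : ∀ x ∈ s, ‖f x‖ ≤ Mf) (hMg : ∀ x ∈ s, ‖g x‖ ≤ Mg) :
    LipschitzOnWith (‖B‖₊ * (Kf * Mg + Mf * Kg)) (fun x => B (f x) (g x)) s := by
  refine LipschitzOnWith.of_dist_le_mul fun x hx y hy => ?_
  have hfxy := hf.dist_le_mul x hx y hy
  have hgxy := hg.dist_le_mul x hx y hy
  rw [dist_eq_norm] at hfxy hgxy ⊢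
  calc ‖B (f x) (g x) - B (f y) (g y)‖ = ‖B (f x - f y) (g x) + B (f y) (g x - g y)‖ := by
        simp only [map_sub, _root_.sub_apply]; abel_nf
    _ ≤ ‖B‖ * ‖f x - f y‖ * ‖g x‖ + ‖B‖ * ‖f y‖ * ‖g x - g y‖ :=
        norm_add_le_of_le (B.le_opNorm₂ _ _) (B.le_opNorm₂ _ _)
    _ ≤ ‖B‖ * (Kf * dist x y) * Mg + ‖B‖ * Mf * (Kg * dist x y) := by
        gcongr
        exacts [hMg x hx, hMf y hy]
    _ = _ := by push_cast; ring

theorem IsPrimitiveOn.bilin [CompleteSpace F] [CompleteSpace G] [CompleteSpace W]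
    (B : F →L[ℝ] G →L[ℝ] W) {f f' : ℝ → F} {g g' : ℝ → G} {C C' : ℝ} (hT : 0 ≤ T)
    (hf : IsPrimitiveOn T f f') (hg : IsPrimitiveOn T g g')
    (hfC : ∀ s ∈ Icc (0 : ℝ) T, ‖f' s‖ ≤ C) (hgC : ∀ s ∈ Icc (0 : ℝ) T, ‖g' s‖ ≤ C') :
    IsPrimitiveOn T (fun t => B (f t) (g t)) (fun t => B (f' t) (g t) + B (f t) (g' t)) := by
  obtain ⟨Mf, hMf⟩ := isCompact_Icc.exists_bound_of_continuousOn hf.continuousOn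
  obtain ⟨Mg, hMg⟩ := isCompact_Icc.exists_bound_of_continuousOn hg.continuousOn
  have hB {x : F} {y : G} {a b : ℝ} (hx : ‖x‖ ≤ a) (hy : ‖y‖ ≤ b) : ‖B x y‖ ≤ ‖B‖ * a * b :=
    B.le_of_opNorm₂_le_of_le le_rfl hx hy
  refine isPrimitiveOn_of_lipschitzOnWith hT (C := ‖B‖ * C * Mg + ‖B‖ * Mf * C')
    (lipschitzOnWith_bilin B (Kf := C.toNNReal) (Kg := C'.toNNReal) (Mf := Mf.toNNReal)
      (Mg := Mg.toNNReal)
      (hf.lipschitzOnWith fun s hs => (hfC s hs).trans (Real.le_coe_toNNReal C))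
      (hg.lipschitzOnWith fun s hs => (hgC s hs).trans (Real.le_coe_toNNReal C'))
      (fun s hs => (hMf s hs).trans (Real.le_coe_toNNReal Mf))
      (fun s hs => (hMg s hs).trans (Real.le_coe_toNNReal Mg))) ?_ ?_ ?_
  · exact (B.aestronglyMeasurable_comp₂ (hf.aestronglyMeasurable hT)
      (hg.continuousOn.aestronglyMeasurable measurableSet_Icc)).add
      (B.aestronglyMeasurable_comp₂ (hf.continuousOn.aestronglyMeasurable measurableSet_Icc)
        (hg.aestronglyMeasurable hT))
  · exact fun s hs => norm_add_le_of_le (hB (hfC s hs) (hMg s hs)) (hB (hMf s hs) (hgC s hs))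
  · filter_upwards [hf.ae_hasDerivAt, hg.ae_hasDerivAt] with t hft hgt ht
    convert! (B.hasFDerivAt_of_bilinear (hft ht).hasFDerivAt (hgt ht).hasFDerivAt).hasDerivAt
      using 1
    simp [add_comm]

end Primitive

section Gronwall

variable {F : Type*} [NormedAddCommGroup F] [NormedSpace ℝ F] {T A C : ℝ}

theorem le_mul_exp_of_le_add_integral {φ : ℝ → ℝ} (hC : 0 ≤ C) (hφ : ContinuousOn φ (Icc 0 T))
    (h : ∀ t ∈ Icc (0 : ℝ) T, φ t ≤ A + C * ∫ s in (0 : ℝ)..t, φ s) :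
    ∀ t ∈ Icc (0 : ℝ) T, φ t ≤ A * Real.exp (C * t) := by
  intro t ht
  have hI : IsPrimitiveOn T (fun t => ∫ s in (0 : ℝ)..t, φ s) φ :=
    isPrimitiveOn_integral
      (hφ.mono (uIcc_of_le (ht.1.trans ht.2)).subset).intervalIntegrable
  have hG := le_gronwallBound_of_liminf_deriv_right_le (δ := A) (K := C) (ε := 0)
    (f := fun t => A + C * ∫ s in (0 : ℝ)..t, φ s) (f' := fun s => C * φ s)
    (continuousOn_const.add (continuousOn_const.mul hI.continuousOn))
    (fun s hs r hr => (((hI.hasDerivWithinAt_Ici hφ hs).const_mul C).const_add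
      A).liminf_right_slope_le hr) (by simp)
    (fun s hs => by
      simpa using mul_le_mul_of_nonneg_left (h s (Ico_subset_Icc_self hs)) hC) t ht
  rw [gronwallBound_ε0, sub_zero] at hG
  exact (h t ht).trans hG

theorem IsPrimitiveOn.norm_le_mul_exp {u k : ℝ → F} {ρ : ℝ → ℝ} (hu : IsPrimitiveOn T u k)
    (hC : 0 ≤ C) (hρ : IntervalIntegrable ρ volume 0 T) (hρ0 : ∀ s ∈ Icc (0 : ℝ) T, 0 ≤ ρ s)
    (hk : ∀ s ∈ Icc (0 : ℝ) T, ‖k s‖ ≤ ρ s + C * ‖u s‖) :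
    ∀ t ∈ Icc (0 : ℝ) T, ‖u t‖ ≤ (‖u 0‖ + ∫ s in (0 : ℝ)..T, ρ s) * Real.exp (C * t) := by
  refine le_mul_exp_of_le_add_integral hC hu.continuousOn.norm fun t ht => ?_
  have hT : 0 ≤ T := ht.1.trans ht.2
  have h0 : (0 : ℝ) ∈ Icc 0 T := ⟨le_rfl, hT⟩
  have hρt := intervalIntegrable_of_mem_Icc hρ h0 ht
  have hut : IntervalIntegrable (fun s => C * ‖u s‖) volume 0 t :=
    ((hu.continuousOn.norm.mono (uIcc_subset_Icc h0 ht)).intervalIntegrable).const_mul C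
  have hρT : ∫ s in (0 : ℝ)..t, ρ s ≤ ∫ s in (0 : ℝ)..T, ρ s :=
    intervalIntegral.integral_mono_interval le_rfl ht.1 ht.2
      (ae_restrict_of_forall_mem measurableSet_Ioc fun s hs =>
        hρ0 s (Ioc_subset_Icc_self hs)) hρ
  calc ‖u t‖ ≤ ‖u 0‖ + ‖∫ s in (0 : ℝ)..t, k s‖ := by
        rw [hu.eq_add_integral t ht]; exact norm_add_le _ _
    _ ≤ ‖u 0‖ + ∫ s in (0 : ℝ)..t, (ρ s + C * ‖u s‖) := by
        gcongr
        exact intervalIntegral.norm_integral_le_of_norm_le ht.1 (Eventually.of_forall fun s hs =>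
          hk s ⟨hs.1.le, hs.2.trans ht.2⟩) (hρt.add hut)
    _ = ‖u 0‖ + ((∫ s in (0 : ℝ)..t, ρ s) + C * ∫ s in (0 : ℝ)..t, ‖u s‖) := by
        rw [intervalIntegral.integral_add hρt hut, intervalIntegral.integral_const_mul]
    _ ≤ _ := by linarith

theorem IsPrimitiveOn.eqOn {u₁ u₂ k₁ k₂ : ℝ → F} (h₁ : IsPrimitiveOn T u₁ k₁)
    (h₂ : IsPrimitiveOn T u₂ k₂) (h0 : u₁ 0 = u₂ 0)
    (hk : ∀ s ∈ Icc (0 : ℝ) T, ‖k₁ s - k₂ s‖ ≤ C * ‖u₁ s - u₂ s‖) : EqOn u₁ u₂ (Icc 0 T) := by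
  intro t ht
  have h := (h₁.sub h₂).norm_le_mul_exp (C := |C|) (ρ := 0) (abs_nonneg C)
    (by simp [Pi.zero_def]) (fun _ _ => le_rfl)
    (fun s hs => (hk s hs).trans (by simpa using by gcongr; exact le_abs_self C)) t ht
  simpa [h0, sub_eq_zero] using h

end Gronwall

section Picard

variable {F : Type*} [NormedAddCommGroup F] [NormedSpace ℝ F] {f : ℝ → F → F} {T C : ℝ}

/-- The Picard operator of `y t = x + ∫₀ᵗ f s (y s)` on `C([0, T], F)`, for a right-hand side `f`
that is merely integrable in time along continuous curves. -/
noncomputable def picardOperator (hT : 0 ≤ T)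
    (hint : ∀ y : ℝ → F, Continuous y → IntervalIntegrable (fun s => f s (y s)) volume 0 T)
    (x : F) (y : C(Icc (0 : ℝ) T, F)) : C(Icc (0 : ℝ) T, F) where
  toFun t := ODE.picard f 0 x (IccExtend hT y) t
  continuous_toFun := (continuousOn_const.add (isPrimitiveOn_integral
    (hint _ y.continuous.Icc_extend')).continuousOn).domRestrict

variable {hT : 0 ≤ T}
  {hint : ∀ y : ℝ → F, Continuous y → IntervalIntegrable (fun s => f s (y s)) volume 0 T}

theorem norm_picardOperator_sub_le {φ : ℝ → ℝ} (hφ : Continuous φ)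
    (hlip : ∀ s ∈ Icc (0 : ℝ) T, ∀ y z, ‖f s y - f s z‖ ≤ C * ‖y - z‖) (hC : 0 ≤ C) {x : F}
    {y z : C(Icc (0 : ℝ) T, F)} (hyz : ∀ t, ‖y t - z t‖ ≤ φ t) (t : Icc (0 : ℝ) T) :
    ‖picardOperator hT hint x y t - picardOperator hT hint x z t‖ ≤
      C * ∫ s in (0 : ℝ)..t, φ s := by
  have h0 : (0 : ℝ) ∈ Icc 0 T := left_mem_Icc.2 hT
  have hy := intervalIntegrable_of_mem_Icc (hint _ (y.continuous.Icc_extend' (h := hT))) h0 t.2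
  have hz := intervalIntegrable_of_mem_Icc (hint _ (z.continuous.Icc_extend' (h := hT))) h0 t.2
  calc ‖picardOperator hT hint x y t - picardOperator hT hint x z t‖
      = ‖∫ s in (0 : ℝ)..t, (f s (IccExtend hT y s) - f s (IccExtend hT z s))‖ := by
        rw [intervalIntegral.integral_sub hy hz]
        simp [picardOperator, ODE.picard]
    _ ≤ ∫ s in (0 : ℝ)..t, C * φ s := by
        refine intervalIntegral.norm_integral_le_of_norm_le t.2.1
          (Eventually.of_forall fun s hs => ?_) ((hφ.const_mul C).intervalIntegrable _ _)
        have hsT : s ∈ Icc (0 : ℝ) T := ⟨hs.1.le, hs.2.trans t.2.2⟩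
        refine (hlip s hsT _ _).trans (mul_le_mul_of_nonneg_left ?_ hC)
        rw [IccExtend_of_mem hT _ hsT, IccExtend_of_mem hT _ hsT]
        exact hyz ⟨s, hsT⟩
    _ = C * ∫ s in (0 : ℝ)..t, φ s := intervalIntegral.integral_const_mul _ _

theorem norm_iterate_picardOperator_sub_le
    (hlip : ∀ s ∈ Icc (0 : ℝ) T, ∀ y z, ‖f s y - f s z‖ ≤ C * ‖y - z‖) (hC : 0 ≤ C) {x : F} (n : ℕ)
    (y z : C(Icc (0 : ℝ) T, F)) (t : Icc (0 : ℝ) T) :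
    ‖(picardOperator hT hint x)^[n] y t - (picardOperator hT hint x)^[n] z t‖ ≤
      (C * t) ^ n / n.factorial * dist y z := by
  induction n generalizing t with
  | zero => simpa [dist_eq_norm] using ContinuousMap.dist_apply_le_dist (f := y) (g := z) t
  | succ n ih =>
    rw [Function.iterate_succ_apply', Function.iterate_succ_apply']
    refine (norm_picardOperator_sub_le (φ := fun s => (C * s) ^ n / n.factorial * dist y z)
      (by fun_prop) hlip hC ih t).trans_eq ?_
    simp only [mul_pow, mul_div_right_comm, mul_right_comm _ _ (dist y z),
      intervalIntegral.integral_const_mul, integral_pow, Nat.factorial_succ]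
    push_cast
    field_simp
    simp only [ne_eq, Nat.add_eq_zero_iff, one_ne_zero, and_false, not_false_eq_true, zero_pow]
    ring

theorem exists_contractingWith_iterate_picardOperator
    (hlip : ∀ s ∈ Icc (0 : ℝ) T, ∀ y z, ‖f s y - f s z‖ ≤ C * ‖y - z‖) (hC : 0 ≤ C) (x : F) :
    ∃ n, ContractingWith (1 / 2) (picardOperator hT hint x)^[n] := by
  obtain ⟨n, hn⟩ : ∃ n : ℕ, (C * T) ^ n / n.factorial < 1 / 2 :=
    ((FloorSemiring.tendsto_pow_div_factorial_atTop (C * T)).eventually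
      (gt_mem_nhds one_half_pos)).exists
  refine ⟨n, NNReal.half_lt_self one_ne_zero, LipschitzWith.of_dist_le_mul fun y z => ?_⟩
  rw [ContinuousMap.dist_le (by positivity)]
  intro t
  have ht : (0 : ℝ) ≤ t := t.2.1
  calc dist ((picardOperator hT hint x)^[n] y t) ((picardOperator hT hint x)^[n] z t)
      ≤ (C * t) ^ n / n.factorial * dist y z := by
        rw [dist_eq_norm]
        exact norm_iterate_picardOperator_sub_le hlip hC n y z t
    _ ≤ (C * T) ^ n / n.factorial * dist y z := by
        gcongr
        exact t.2.2
    _ ≤ ((1 / 2 : ℝ≥0) : ℝ) * dist y z := by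
        gcongr
        simpa using hn.le

theorem exists_isPrimitiveOn_of_lipschitz [CompleteSpace F] (hT : 0 ≤ T)
    (hint : ∀ y : ℝ → F, Continuous y → IntervalIntegrable (fun s => f s (y s)) volume 0 T)
    (hlip : ∀ s ∈ Icc (0 : ℝ) T, ∀ y z, ‖f s y - f s z‖ ≤ C * ‖y - z‖) (x : F) :
    ∃ y : ℝ → F, y 0 = x ∧ IsPrimitiveOn T y (fun s => f s (y s)) := by
  obtain ⟨n, hn⟩ := exists_contractingWith_iterate_picardOperator (hT := hT) (hint := hint)
    (C := |C|) (fun s hs y z => (hlip s hs y z).trans (by gcongr; exact le_abs_self C))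
    (abs_nonneg C) x
  have : Nonempty C(Icc (0 : ℝ) T, F) := ⟨ContinuousMap.const _ x⟩
  set y := ContractingWith.fixedPoint _ hn
  have hfix : picardOperator hT hint x y = y := hn.isFixedPt_fixedPoint_iterate
  have heq : ∀ t ∈ Icc (0 : ℝ) T,
      IccExtend hT y t = x + ∫ s in (0 : ℝ)..t, f s (IccExtend hT y s) := fun t ht => by
    conv_lhs => rw [IccExtend_of_mem hT _ ht, ← hfix]
    rfl
  have hzero : IccExtend hT y 0 = x := by simpa using heq 0 (left_mem_Icc.2 hT)
  exact ⟨IccExtend hT y, hzero, hint _ y.continuous.Icc_extend', fun t ht => by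
    rw [hzero, heq t ht]⟩

end Picard

section LinearEquation

variable {F G W : Type*} [NormedAddCommGroup F] [NormedSpace ℝ F] [NormedAddCommGroup G]
  [NormedSpace ℝ G] [NormedAddCommGroup W] [NormedSpace ℝ W] {T C : ℝ}

theorem intervalIntegrable_bilin (B : F →L[ℝ] G →L[ℝ] W) {f : ℝ → F} {g : ℝ → G} (hT : 0 ≤ T)
    (hfm : AEStronglyMeasurable f (volume.restrict (Icc 0 T)))
    (hfC : ∀ s ∈ Icc (0 : ℝ) T, ‖f s‖ ≤ C) (hg : ContinuousOn g (Icc 0 T)) :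
    IntervalIntegrable (fun s => B (f s) (g s)) volume 0 T := by
  obtain ⟨M, hM⟩ := isCompact_Icc.exists_bound_of_continuousOn hg
  exact intervalIntegrable_of_norm_le hT
    (B.aestronglyMeasurable_comp₂ hfm (hg.aestronglyMeasurable measurableSet_Icc))
    fun s hs => B.le_of_opNorm₂_le_of_le le_rfl (hfC s hs) (hM s hs)

theorem exists_isPrimitiveOn_bilin [CompleteSpace G] (B : F →L[ℝ] G →L[ℝ] G) {b : ℝ → F}
    (hT : 0 ≤ T) (hbm : AEStronglyMeasurable b (volume.restrict (Icc 0 T)))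
    (hbC : ∀ s ∈ Icc (0 : ℝ) T, ‖b s‖ ≤ C) (x : G) :
    ∃ y : ℝ → G, y 0 = x ∧ IsPrimitiveOn T y (fun s => B (b s) (y s)) :=
  exists_isPrimitiveOn_of_lipschitz (C := ‖B‖ * C) hT
    (fun _ hy => intervalIntegrable_bilin B hT hbm hbC hy.continuousOn)
    (fun s hs y z => by
      rw [← map_sub]
      exact B.le_of_opNorm₂_le_of_le le_rfl (hbC s hs) le_rfl) x

variable {A : Type*} [NormedRing A] {b : ℝ → A}

theorem exists_norm_mul_le_of_continuousOn {y : ℝ → A} (hy : ContinuousOn y (Icc 0 T))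
    (hbC : ∀ s ∈ Icc (0 : ℝ) T, ‖b s‖ ≤ C) :
    ∃ M, ∀ s ∈ Icc (0 : ℝ) T, ‖b s * y s‖ ≤ M ∧ ‖-(y s * b s)‖ ≤ M := by
  obtain ⟨M, hM⟩ := isCompact_Icc.exists_bound_of_continuousOn hy
  refine ⟨C * M, fun s hs => ⟨norm_mul_le_of_le (hbC s hs) (hM s hs), ?_⟩⟩
  rw [norm_neg, mul_comm C]
  exact norm_mul_le_of_le (hM s hs) (hbC s hs)

theorem continuousOn_ringInverse [CompleteSpace A] {α : Type*} [TopologicalSpace α] {s : Set α}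
    {Φ : α → A} (hΦ : ContinuousOn Φ s) (hunit : ∀ t ∈ s, IsUnit (Φ t)) :
    ContinuousOn (fun t => Ring.inverse (Φ t)) s := fun t ht => by
  obtain ⟨u, hu⟩ := hunit t ht
  have hinv : ContinuousAt Ring.inverse (Φ t) := hu ▸ NormedRing.inverse_continuousAt u
  exact hinv.comp_continuousWithinAt (hΦ t ht)

variable [NormedAlgebra ℝ A] [CompleteSpace A]

/-- If `Φ' = b Φ` and `Ψ' = -Ψ b`, then `(Ψ Φ)' = 0` and `Φ Ψ` solves `u' = b u - u b`, whose only
solution with `u 0 = 1` is constant. -/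
theorem IsPrimitiveOn.mul_eq_one {Φ Ψ : ℝ → A} (hΦ : IsPrimitiveOn T Φ (fun s => b s * Φ s))
    (hΨ : IsPrimitiveOn T Ψ (fun s => -(Ψ s * b s))) (hΦ0 : Φ 0 = 1) (hΨ0 : Ψ 0 = 1)
    (hbC : ∀ s ∈ Icc (0 : ℝ) T, ‖b s‖ ≤ C) {t : ℝ} (ht : t ∈ Icc 0 T) :
    Φ t * Ψ t = 1 ∧ Ψ t * Φ t = 1 := by
  have hT : 0 ≤ T := ht.1.trans ht.2
  obtain ⟨M₁, hM₁⟩ := exists_norm_mul_le_of_continuousOn hΦ.continuousOn hbC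
  obtain ⟨M₂, hM₂⟩ := exists_norm_mul_le_of_continuousOn hΨ.continuousOn hbC
  have hone : IsPrimitiveOn T (fun _ => (1 : A)) (fun _ => 0) := ⟨by simp, by simp⟩
  constructor
  · refine (IsPrimitiveOn.bilin (.mul ℝ A) hT hΦ hΨ (fun s hs => (hM₁ s hs).1)
      (fun s hs => (hM₂ s hs).2)).eqOn hone (C := C + C) (by simp [hΦ0, hΨ0])
      (fun s hs => ?_) ht
    calc ‖b s * Φ s * Ψ s + Φ s * -(Ψ s * b s) - 0‖
        = ‖b s * (Φ s * Ψ s - 1) - (Φ s * Ψ s - 1) * b s‖ := by noncomm_ring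
      _ ≤ C * ‖Φ s * Ψ s - 1‖ + ‖Φ s * Ψ s - 1‖ * C :=
        norm_sub_le_of_le (norm_mul_le_of_le (hbC s hs) le_rfl)
          (norm_mul_le_of_le le_rfl (hbC s hs))
      _ = (C + C) * ‖Φ s * Ψ s - 1‖ := by ring
  · refine (IsPrimitiveOn.bilin (.mul ℝ A) hT hΨ hΦ (fun s hs => (hM₂ s hs).2)
      (fun s hs => (hM₁ s hs).1)).eqOn hone (C := 0) (by simp [hΦ0, hΨ0])
      (fun s _ => ?_) ht
    simp [mul_assoc]

theorem IsPrimitiveOn.isUnit {Φ : ℝ → A} (hΦ : IsPrimitiveOn T Φ (fun s => b s * Φ s))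
    (hΦ0 : Φ 0 = 1) (hbm : AEStronglyMeasurable b (volume.restrict (Icc 0 T)))
    (hbC : ∀ s ∈ Icc (0 : ℝ) T, ‖b s‖ ≤ C) {t : ℝ} (ht : t ∈ Icc 0 T) : IsUnit (Φ t) := by
  obtain ⟨Ψ, hΨ0, hΨ⟩ := exists_isPrimitiveOn_bilin (-(ContinuousLinearMap.mul ℝ A).flip)
    (ht.1.trans ht.2) hbm hbC 1
  obtain ⟨h₁, h₂⟩ := hΦ.mul_eq_one hΨ hΦ0 hΨ0 hbC ht
  exact ⟨⟨Φ t, Ψ t, h₁, h₂⟩, rfl⟩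

variable [CompleteSpace F] {β Φ : ℝ → F →L[ℝ] F} {a : ℝ → F} {M : ℝ}

theorem exists_norm_ringInverse_apply_le (hΦ : ContinuousOn Φ (Icc 0 T))
    (hunit : ∀ s ∈ Icc (0 : ℝ) T, IsUnit (Φ s)) (haM : ∀ s ∈ Icc (0 : ℝ) T, ‖a s‖ ≤ M) :
    ∃ N, ∀ s ∈ Icc (0 : ℝ) T, ‖Ring.inverse (Φ s) (a s)‖ ≤ N := by
  obtain ⟨N, hN⟩ :=
    isCompact_Icc.exists_bound_of_continuousOn (continuousOn_ringInverse hΦ hunit)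
  exact ⟨N * M, fun s hs => (Ring.inverse (Φ s)).le_of_opNorm_le_of_le (hN s hs) (haM s hs)⟩

theorem intervalIntegrable_ringInverse_apply (hT : 0 ≤ T) (hΦ : ContinuousOn Φ (Icc 0 T))
    (hunit : ∀ s ∈ Icc (0 : ℝ) T, IsUnit (Φ s))
    (ham : AEStronglyMeasurable a (volume.restrict (Icc 0 T)))
    (haM : ∀ s ∈ Icc (0 : ℝ) T, ‖a s‖ ≤ M) :
    IntervalIntegrable (fun s => Ring.inverse (Φ s) (a s)) volume 0 T :=
  intervalIntegrable_bilin (ContinuousLinearMap.id ℝ (F →L[ℝ] F)).flip hT ham haM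
    (continuousOn_ringInverse hΦ hunit)

theorem IsPrimitiveOn.apply_integral_ringInverse (hT : 0 ≤ T)
    (hΦ : IsPrimitiveOn T Φ (fun s => β s * Φ s)) (hβC : ∀ s ∈ Icc (0 : ℝ) T, ‖β s‖ ≤ C)
    (hunit : ∀ s ∈ Icc (0 : ℝ) T, IsUnit (Φ s))
    (ham : AEStronglyMeasurable a (volume.restrict (Icc 0 T)))
    (haM : ∀ s ∈ Icc (0 : ℝ) T, ‖a s‖ ≤ M) :
    IsPrimitiveOn T (fun t => Φ t (∫ s in (0 : ℝ)..t, Ring.inverse (Φ s) (a s)))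
      (fun t => a t + β t (Φ t (∫ s in (0 : ℝ)..t, Ring.inverse (Φ s) (a s)))) := by
  obtain ⟨K, hK⟩ := exists_norm_mul_le_of_continuousOn hΦ.continuousOn hβC
  obtain ⟨N, hN⟩ := exists_norm_ringInverse_apply_le hΦ.continuousOn hunit haM
  have hint := intervalIntegrable_ringInverse_apply hT hΦ.continuousOn hunit ham haM
  refine (hΦ.bilin (.id ℝ (F →L[ℝ] F)) hT (isPrimitiveOn_integral hint)
    (fun s hs => (hK s hs).1) hN).congr_right hT fun s hs' => ?_
  have hs : s ∈ Icc 0 T := Ioo_subset_Icc_self hs'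
  have hcancel : Φ s (Ring.inverse (Φ s) (a s)) = a s :=
    congrArg (fun L : F →L[ℝ] F => L (a s)) (Ring.mul_inverse_cancel _ (hunit s hs))
  simp only [ContinuousLinearMap.id_apply, hcancel]
  exact add_comm _ _

end LinearEquation

section VolterraEquation

variable {d : ℕ} {b Φ Φ₁ Φ₂ : ℝ → EuclideanSpace ℝ (Fin d) →L[ℝ] EuclideanSpace ℝ (Fin d)}
  {a w w₁ w₂ : ℝ → EuclideanSpace ℝ (Fin d)} {C M : ℝ}

theorem IsFundamentalSolution.apply_zero (h : IsFundamentalSolution b Φ) : Φ 0 = 1 :=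
  (h.eq_integral 0 (by simp)).trans (by
    rw [intervalIntegral.integral_same, add_zero, ContinuousLinearMap.one_def])

theorem IsFundamentalSolution.isPrimitiveOn (h : IsFundamentalSolution b Φ) :
    IsPrimitiveOn 1 Φ (fun s => b s * Φ s) :=
  ⟨h.integrable, fun t ht => by rw [h.apply_zero]; exact h.eq_integral t ht⟩

theorem IsFundamentalSolution.eqOn (hbC : ∀ s ∈ Icc (0 : ℝ) 1, ‖b s‖ ≤ C)
    (h₁ : IsFundamentalSolution b Φ₁) (h₂ : IsFundamentalSolution b Φ₂) :
    EqOn Φ₁ Φ₂ (Icc 0 1) :=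
  h₁.isPrimitiveOn.eqOn h₂.isPrimitiveOn (h₁.apply_zero.trans h₂.apply_zero.symm) fun s hs => by
    rw [← mul_sub]
    exact norm_mul_le_of_le (hbC s hs) le_rfl

theorem exists_isFundamentalSolution (hbm : AEStronglyMeasurable b (volume.restrict (Icc 0 1)))
    (hbC : ∀ s ∈ Icc (0 : ℝ) 1, ‖b s‖ ≤ C) : ∃ Φ, IsFundamentalSolution b Φ := by
  obtain ⟨Φ, hΦ0, hΦ⟩ := exists_isPrimitiveOn_bilin (.compL ℝ _ _ _) zero_le_one hbm hbC
    (ContinuousLinearMap.id ℝ _)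
  exact ⟨Φ, hΦ.intervalIntegrable, fun t ht => by
    rw [← hΦ0]; exact hΦ.eq_add_integral t ht⟩

theorem IsFundamentalSolution.isUnit (h : IsFundamentalSolution b Φ)
    (hbm : AEStronglyMeasurable b (volume.restrict (Icc 0 1)))
    (hbC : ∀ s ∈ Icc (0 : ℝ) 1, ‖b s‖ ≤ C) {t : ℝ} (ht : t ∈ Icc 0 1) : IsUnit (Φ t) :=
  h.isPrimitiveOn.isUnit h.apply_zero hbm hbC ht

theorem IsVolterraSolution.apply_zero (h : IsVolterraSolution b a w) : w 0 = 0 := by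
  simpa using h.eq_integral 0 (by simp)

theorem IsVolterraSolution.isPrimitiveOn (h : IsVolterraSolution b a w) :
    IsPrimitiveOn 1 w (fun s => a s + b s (w s)) :=
  ((isPrimitiveOn_integral h.integrable_drift).add
    (isPrimitiveOn_integral h.integrable)).congr_left h.eq_integral

theorem IsVolterraSolution.of_isPrimitiveOn (hw0 : w 0 = 0)
    (hw : IsPrimitiveOn 1 w (fun s => a s + b s (w s))) (ha : IntervalIntegrable a volume 0 1) :
    IsVolterraSolution b a w := by
  have hbw : IntervalIntegrable (fun s => b s (w s)) volume 0 1 := by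
    simpa using hw.intervalIntegrable.sub ha
  refine ⟨ha, hbw, fun t ht => ?_⟩
  rw [hw.eq_add_integral t ht, hw0, zero_add, intervalIntegral.integral_add
    (intervalIntegrable_of_mem_Icc ha (by simp) ht)
    (intervalIntegrable_of_mem_Icc hbw (by simp) ht)]

theorem IsVolterraSolution.eqOn (hbC : ∀ s ∈ Icc (0 : ℝ) 1, ‖b s‖ ≤ C)
    (h₁ : IsVolterraSolution b a w₁) (h₂ : IsVolterraSolution b a w₂) :
    EqOn w₁ w₂ (Icc 0 1) :=
  h₁.isPrimitiveOn.eqOn h₂.isPrimitiveOn (h₁.apply_zero.trans h₂.apply_zero.symm) fun s hs => by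
    rw [add_sub_add_left_eq_sub, ← map_sub]
    exact (b s).le_of_opNorm_le (hbC s hs) _

theorem IsFundamentalSolution.isVolterraSolution (h : IsFundamentalSolution b Φ)
    (hbC : ∀ s ∈ Icc (0 : ℝ) 1, ‖b s‖ ≤ C) (hunit : ∀ t ∈ Icc (0 : ℝ) 1, IsUnit (Φ t))
    (ham : AEStronglyMeasurable a (volume.restrict (Icc 0 1)))
    (haM : ∀ s ∈ Icc (0 : ℝ) 1, ‖a s‖ ≤ M) :
    IsVolterraSolution b a (fun t => Φ t (∫ s in (0 : ℝ)..t, Ring.inverse (Φ s) (a s))) :=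
  .of_isPrimitiveOn (by simp)
    (h.isPrimitiveOn.apply_integral_ringInverse zero_le_one hbC hunit ham haM)
    (intervalIntegrable_of_norm_le zero_le_one ham haM)

theorem isVolterraSolution_volterraSolution (h : ∃ w, IsVolterraSolution b a w) :
    IsVolterraSolution b a (volterraSolution b a) := by
  rw [volterraSolution, dif_pos h]
  exact h.choose_spec

end VolterraEquation

/-- The erosion of `Ω` by the closed ball of radius `ρ`; for `0 < ρ` these sets exhaust the interior
of `Ω`. -/
def core {E : Type*} [NormedAddCommGroup E] (Ω : Set E) (ρ : ℝ) : Set E :=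
  {z | ∀ e, ‖e‖ ≤ ρ → z + e ∈ Ω}

section Core

variable {E : Type*} [NormedAddCommGroup E] {Ω : Set E} {ρ ρ' : ℝ}

theorem core_subset (hρ : 0 ≤ ρ) : core Ω ρ ⊆ Ω := fun z hz => by
  simpa using hz 0 (by simpa using hρ)

theorem core_anti (h : ρ ≤ ρ') : core Ω ρ' ⊆ core Ω ρ :=
  fun _ hz e he => hz e (he.trans h)

theorem isClosed_core (hΩ : IsClosed Ω) : IsClosed (core Ω ρ) := by
  have heq : core Ω ρ = ⋂ (e : E) (_ : ‖e‖ ≤ ρ), (fun z => z + e) ⁻¹' Ω := by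
    ext z
    simp [core]
  rw [heq]
  exact isClosed_iInter fun e => isClosed_iInter fun _ => hΩ.preimage (by fun_prop)

theorem mem_core_of_norm_sub_le {z z' : E} (hz : z ∈ core Ω (ρ + ρ')) (h : ‖z' - z‖ ≤ ρ') :
    z' ∈ core Ω ρ := fun e he => by
  have hmem := hz (e + (z' - z)) (norm_add_le_of_le he h)
  rwa [add_comm e, ← add_assoc, add_sub_cancel] at hmem

theorem core_mem_nhds {z : E} (hρ' : 0 < ρ') (hz : z ∈ core Ω (ρ + ρ')) : core Ω ρ ∈ 𝓝 z :=
  mem_of_superset (Metric.closedBall_mem_nhds z hρ') fun w hw =>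
    mem_core_of_norm_sub_le hz (by rwa [← dist_eq_norm])

theorem core_subset_interior (hρ : 0 < ρ) : core Ω ρ ⊆ interior Ω := fun z hz =>
  mem_interior_iff_mem_nhds.2 (mem_of_superset (core_mem_nhds (ρ := 0) hρ (by rwa [zero_add]))
    (core_subset le_rfl))

theorem exists_subset_core {K : Set E} (hK : IsCompact K) (h : K ⊆ interior Ω) :
    ∃ ρ > 0, K ⊆ core Ω ρ := by
  obtain ⟨ρ, hρ, h⟩ := hK.exists_cthickening_subset_open isOpen_interior h
  exact ⟨ρ, hρ, fun z hz e he => interior_subset (h (Metric.mem_cthickening_of_dist_le _ _ _ _ hz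
    (by simpa using he)))⟩

theorem exists_mem_core_of_mem_interior {z : E} (hz : z ∈ interior Ω) : ∃ ρ > 0, z ∈ core Ω ρ := by
  simpa using exists_subset_core isCompact_singleton (singleton_subset_iff.2 hz)

variable [NormedSpace ℝ E]

theorem convex_core (hΩ : Convex ℝ Ω) : Convex ℝ (core Ω ρ) := by
  intro z hz z' hz' a b ha hb hab e he
  have hmem := hΩ (hz e he) (hz' e he) ha hb hab
  rwa [smul_add, smul_add, add_add_add_comm, ← add_smul, hab, one_smul] at hmem

theorem add_mul_norm_le_of_mem_core {z : E} (hρ : 0 ≤ ρ) (hz : z ∈ core Ω ρ)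
    {f : StrongDual ℝ E} {c : ℝ} (hf : ∀ y ∈ Ω, f y ≤ c) : f z + ρ * ‖f‖ ≤ c := by
  rcases hρ.eq_or_lt with rfl | hρ
  · simpa using hf z (core_subset le_rfl hz)
  have hball (e : E) (he : ‖e‖ ≤ ρ) : ‖f e‖ ≤ c - f z := by
    have hpos := hf _ (hz e he)
    have hneg := hf _ (hz (-e) (by rwa [norm_neg]))
    rw [map_add] at hpos hneg
    rw [map_neg] at hneg
    exact abs_le.2 ⟨by linarith, by linarith⟩
  have hnorm : ‖f‖ ≤ (c - f z) / ρ :=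
    f.opNorm_le_of_unit_norm (by have := hf z (core_subset hρ.le hz); positivity) fun e he => by
      have hρe := hball (ρ • e) (by rw [norm_smul, he, mul_one, Real.norm_of_nonneg hρ.le])
      rw [map_smul, norm_smul, Real.norm_of_nonneg hρ.le] at hρe
      rwa [le_div_iff₀' hρ]
  rw [le_div_iff₀ hρ] at hnorm
  linarith

theorem mem_core_of_forall_dual (hΩc : IsClosed Ω) (hΩ : Convex ℝ Ω) {z : E}
    (h : ∀ (f : StrongDual ℝ E) (c : ℝ), (∀ y ∈ Ω, f y ≤ c) → f z + ρ * ‖f‖ ≤ c) :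
    z ∈ core Ω ρ := by
  intro e he
  by_contra hne
  obtain ⟨f, c, hc, hfc⟩ := geometric_hahn_banach_closed_point hΩ hΩc hne
  have hz := h f c fun y hy => (hc y hy).le
  have hfe : f e ≤ ‖f‖ * ρ := (le_abs_self _).trans (f.le_opNorm_of_le he)
  rw [map_add] at hfc
  linarith

end Core

section Retraction

variable {E : Type*} [NormedAddCommGroup E] [InnerProductSpace ℝ E]

theorem norm_sub_le_of_inner_le_zero {y z y' z' : E} (hy : inner ℝ (y - y') (z' - y') ≤ 0)
    (hz : inner ℝ (z - z') (y' - z') ≤ 0) : ‖y' - z'‖ ≤ ‖y - z‖ := by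
  have hinner : ‖y' - z'‖ ^ 2 ≤ inner ℝ (y - z) (y' - z') := by
    have heq : inner ℝ (y - z) (y' - z') - inner ℝ (y' - z') (y' - z') =
        -inner ℝ (y - y') (z' - y') - inner ℝ (z - z') (y' - z') := by
      rw [← inner_neg_right, neg_sub, ← inner_sub_left, ← inner_sub_left]
      congr 1
      abel
    rw [← real_inner_self_eq_norm_sq]
    linarith
  have hcs := real_inner_le_norm (y - z) (y' - z')
  by_contra! hlt
  nlinarith [norm_nonneg (y - z)]

theorem exists_lipschitz_retraction {K : Set E} (hne : K.Nonempty) (hc : IsComplete K)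
    (hK : Convex ℝ K) :
    ∃ π : E → E, LipschitzWith 1 π ∧ (∀ y, π y ∈ K) ∧ ∀ y ∈ K, π y = y := by
  choose π hπ using exists_norm_eq_iInf_of_complete_convex hne hc hK
  have hin (y : E) : ∀ w ∈ K, inner ℝ (y - π y) (w - π y) ≤ 0 :=
    (norm_eq_iInf_iff_real_inner_le_zero hK (hπ y).1).1 (hπ y).2
  refine ⟨π, .of_dist_le_mul fun y z => ?_, fun y => (hπ y).1, fun y hy => ?_⟩
  · simpa [dist_eq_norm] using
      norm_sub_le_of_inner_le_zero (hin y _ (hπ z).1) (hin z _ (hπ y).1)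
  · exact (sub_eq_zero.1 (real_inner_self_nonpos.1 (hin y y hy))).symm

end Retraction

section InwardField

theorem forall_mem_of_bootstrap {X : Type*} [TopologicalSpace X] {y : ℝ → X} {K : Set X} {T : ℝ}
    (hy : ContinuousOn y (Icc 0 T)) (hK : IsClosed K) (h0 : y 0 ∈ K)
    (h : ∀ τ ∈ Ico (0 : ℝ) T, (∀ r ∈ Icc 0 τ, y r ∈ K) → K ∈ 𝓝 (y τ)) :
    ∀ t ∈ Icc (0 : ℝ) T, y t ∈ K := by
  by_contra! ⟨t, ht, htK⟩
  set S : Set ℝ := {r ∈ Icc (0 : ℝ) T | y r ∉ K}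
  have hS : IsGLB S (sInf S) := isGLB_csInf ⟨t, ht, htK⟩ ⟨0, fun r hr => hr.1.1⟩
  have hτ0 : 0 ≤ sInf S := hS.2 fun r hr => hr.1.1
  have hτt : sInf S ≤ t := hS.1 ⟨ht, htK⟩
  have hbefore : MapsTo y (Ico 0 (sInf S)) K := fun r hr => by
    by_contra hrK
    exact hr.2.not_ge (hS.1 ⟨⟨hr.1, hr.2.le.trans (hτt.trans ht.2)⟩, hrK⟩)
  have hupto : ∀ r ∈ Icc 0 (sInf S), y r ∈ K := by
    rcases hτ0.eq_or_lt with hτ | hτ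
    · simpa [← hτ] using h0
    · have hcl := hbefore.closure_of_continuousOn
        (hy.mono (closure_Ico hτ.ne ▸ Icc_subset_Icc_right (hτt.trans ht.2)))
      rwa [closure_Ico hτ.ne, hK.closure_eq] at hcl
  have hτT : sInf S < T :=
    (hτt.lt_of_ne fun hτ => htK (hτ ▸ hupto _ ⟨hτ0, le_rfl⟩)).trans_le ht.2
  have hnhds : ∀ᶠ r in 𝓝[Icc 0 T] (sInf S), y r ∈ K :=
    hy _ ⟨hτ0, hτT.le⟩ (h _ ⟨hτ0, hτT⟩ hupto)
  obtain ⟨r, hr, hrK⟩ := ((hS.frequently_nhds_mem ⟨t, ht, htK⟩).and_eventually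
    (eventually_nhdsWithin_iff.1 hnhds)).exists
  exact hr.2 (hrK hr.1)

theorem IsPrimitiveOn.one_sub_mul_le {u k : ℝ → ℝ} {T t : ℝ} (h : IsPrimitiveOn T u k) (hT : T < 1)
    (hk : ∀ s ∈ Icc (0 : ℝ) T, -(u s / (1 - s)) ≤ k s) (ht : t ∈ Icc 0 T) :
    (1 - t) * u 0 ≤ u t := by
  have hpos {r : ℝ} (hr : r ≤ T) : 0 < 1 - r := by linarith
  -- At a maximum `s` of `u r / (1 - r)` on `[0, t]` the right-hand side is at least its value
  -- at `s` throughout `[s, t]`.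
  have hw : ContinuousOn (fun r => u r / (1 - r)) (Icc 0 t) :=
    (h.continuousOn.mono (Icc_subset_Icc_right ht.2)).div (by fun_prop)
      fun r hr => (hpos (hr.2.trans ht.2)).ne'
  obtain ⟨s, hs, hmax⟩ := isCompact_Icc.exists_isMaxOn (nonempty_Icc.2 ht.1) hw
  have hsT : s ∈ Icc 0 T := ⟨hs.1, hs.2.trans ht.2⟩
  have hint : (t - s) * -(u s / (1 - s)) ≤ u t - u s := by
    rw [h.sub_eq_integral hsT ht, ← smul_eq_mul, ← intervalIntegral.integral_const]
    refine intervalIntegral.integral_mono_on hs.2 (by simp)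
      (intervalIntegrable_of_mem_Icc h.intervalIntegrable hsT ht) fun r hr => ?_
    have hr0 : r ∈ Icc 0 t := ⟨hs.1.trans hr.1, hr.2⟩
    exact (neg_le_neg (hmax hr0)).trans (hk r ⟨hr0.1, hr.2.trans ht.2⟩)
  have hu0 : u 0 ≤ u s / (1 - s) := by simpa using hmax (left_mem_Icc.2 ht.1)
  calc (1 - t) * u 0 ≤ (1 - t) * (u s / (1 - s)) :=
        mul_le_mul_of_nonneg_left hu0 (hpos ht.2).le
    _ = u s + (t - s) * -(u s / (1 - s)) := by
        have := (hpos hsT.2).ne'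
        field_simp
        ring
    _ ≤ u t := by linarith

theorem aestronglyMeasurable_apply_of_continuousOn {E : Type*} [NormedAddCommGroup E]
    [MeasurableSpace E] [BorelSpace E] {v : ℝ → E → E} {y : ℝ → E}
    (hv : StronglyMeasurable fun w : ℝ × E => v w.1 w.2) {S : Set ℝ} (hS : MeasurableSet S)
    (hy : ContinuousOn y S) : AEStronglyMeasurable (fun s => v s (y s)) (volume.restrict S) :=
  hv.aestronglyMeasurable.comp_aemeasurable (f := fun s => (s, y s))
    (aemeasurable_id.prodMk (hy.aemeasurable hS))

variable {E : Type*} [NormedAddCommGroup E] [InnerProductSpace ℝ E] [MeasurableSpace E]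
  {Ω : Set E} {v : ℝ → E → E} {D T ρ : ℝ} {x : E} {y y₁ y₂ : ℝ → E}

/-- A bounded measurable time-dependent field on the interior of `Ω`, locally Lipschitz in space
uniformly in time, that at `(t, z)` steers towards no point outside `Ω`: `z + (1 - t) v(t, z)` lies
in every closed half-space that contains `Ω`. Its integral curves cannot reach the boundary before
time `1`. -/
structure IsInwardField (Ω : Set E) (v : ℝ → E → E) (D : ℝ) : Prop where
  stronglyMeasurable : StronglyMeasurable fun w : ℝ × E => v w.1 w.2
  norm_le : ∀ t ∈ Icc (0 : ℝ) 1, ∀ z ∈ interior Ω, ‖v t z‖ ≤ D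
  exists_lipschitzOnWith : ∀ ρ > 0, ∃ C, ∀ t ∈ Icc (0 : ℝ) 1,
    LipschitzOnWith C (v t) (core Ω ρ)
  dual_le : ∀ t ∈ Ico (0 : ℝ) 1, ∀ z ∈ interior Ω, ∀ (f : StrongDual ℝ E) (c : ℝ),
    (∀ w ∈ Ω, f w ≤ c) → f (v t z) ≤ (c - f z) / (1 - t)

namespace IsInwardField

theorem mem_core [CompleteSpace E] (h : IsInwardField Ω v D) (hΩc : IsClosed Ω)
    (hΩ : Convex ℝ Ω) (hT : T < 1) (hρ : 0 ≤ ρ) (hy0 : y 0 ∈ core Ω ρ)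
    (hy : IsPrimitiveOn T y (fun s => v s (y s)))
    (hyΩ : ∀ t ∈ Icc (0 : ℝ) T, y t ∈ interior Ω) {t : ℝ} (ht : t ∈ Icc 0 T) :
    y t ∈ core Ω ((1 - t) * ρ) := by
  refine mem_core_of_forall_dual hΩc hΩ fun f c hf => ?_
  have hconst : IsPrimitiveOn T (fun _ => c) (fun _ => 0) := ⟨by simp, by simp⟩
  have hle : (1 - t) * (c - f (y 0)) ≤ c - f (y t) :=
    (hconst.sub (hy.clm_apply f)).one_sub_mul_le hT (fun s hs => by
      rw [zero_sub, neg_le_neg_iff]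
      exact h.dual_le s ⟨hs.1, hs.2.trans_lt hT⟩ _ (hyΩ s hs) f c hf) ht
  have h0 : (1 - t) * (ρ * ‖f‖) ≤ (1 - t) * (c - f (y 0)) :=
    mul_le_mul_of_nonneg_left (by linarith [add_mul_norm_le_of_mem_core hρ hy0 hf])
      (by linarith [ht.2])
  linarith

theorem eqOn (h : IsInwardField Ω v D) (hT : T ≤ 1)
    (h₁ : IsPrimitiveOn T y₁ (fun s => v s (y₁ s))) (h₂ : IsPrimitiveOn T y₂ (fun s => v s (y₂ s)))
    (h0 : y₁ 0 = y₂ 0) (hΩ₁ : ∀ t ∈ Ico (0 : ℝ) T, y₁ t ∈ interior Ω)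
    (hΩ₂ : ∀ t ∈ Ico (0 : ℝ) T, y₂ t ∈ interior Ω) : EqOn y₁ y₂ (Icc 0 T) := by
  have hlt (t : ℝ) (ht : t ∈ Ico 0 T) : y₁ t = y₂ t := by
    have ht' : t ∈ Icc 0 T := Ico_subset_Icc_self ht
    have hcpt {y : ℝ → E} (hy : ContinuousOn y (Icc 0 T)) : IsCompact (y '' Icc 0 t) :=
      isCompact_Icc.image_of_continuousOn (hy.mono (Icc_subset_Icc_right ht'.2))
    obtain ⟨ρ, hρ, hcore⟩ := exists_subset_core
      ((hcpt h₁.continuousOn).union (hcpt h₂.continuousOn))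
      (union_subset (image_subset_iff.2 fun s hs => hΩ₁ s ⟨hs.1, hs.2.trans_lt ht.2⟩)
        (image_subset_iff.2 fun s hs => hΩ₂ s ⟨hs.1, hs.2.trans_lt ht.2⟩))
    obtain ⟨C, hC⟩ := h.exists_lipschitzOnWith ρ hρ
    refine (h₁.mono ht').eqOn (h₂.mono ht') (C := C) h0 (fun s hs => ?_) ⟨ht.1, le_rfl⟩
    exact (hC s ⟨hs.1, hs.2.trans (ht'.2.trans hT)⟩).norm_sub_le
      (hcore (.inl (mem_image_of_mem _ hs))) (hcore (.inr (mem_image_of_mem _ hs)))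
  intro t ht
  rcases (ht.1.trans ht.2).eq_or_lt with rfl | hT0
  · rwa [le_antisymm ht.2 ht.1]
  · exact EqOn.of_subset_closure hlt h₁.continuousOn h₂.continuousOn Ico_subset_Icc_self
      (closure_Ico hT0.ne).ge ht

variable [BorelSpace E] [CompleteSpace E]

/-- Solve with the field frozen outside `core Ω ((1 - T) ρ)` by the retraction; by `mem_core` the
solution never leaves this set, so it solves the original equation. -/
theorem exists_isPrimitiveOn_of_lt_one (h : IsInwardField Ω v D) (hΩc : IsClosed Ω)
    (hΩ : Convex ℝ Ω) (hT0 : 0 ≤ T) (hT : T < 1) (hρ : 0 < ρ) (hx : x ∈ core Ω ρ) :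
    ∃ y, y 0 = x ∧ (∀ t ∈ Icc (0 : ℝ) T, y t ∈ interior Ω) ∧
      IsPrimitiveOn T y (fun s => v s (y s)) := by
  have hr : 0 < (1 - T) * ρ := mul_pos (by linarith) hρ
  set K := core Ω ((1 - T) * ρ)
  have hKΩ : K ⊆ interior Ω := core_subset_interior hr
  have hKc : IsClosed K := isClosed_core hΩc
  have hxK : x ∈ K := core_anti (by nlinarith) hx
  obtain ⟨π, hπ, hπK, hπid⟩ := exists_lipschitz_retraction ⟨x, hxK⟩ hKc.isComplete (convex_core hΩ)
  obtain ⟨C, hC⟩ := h.exists_lipschitzOnWith _ hr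
  have hT1 {s : ℝ} (hs : s ∈ Icc 0 T) : s ∈ Icc (0 : ℝ) 1 := ⟨hs.1, hs.2.trans hT.le⟩
  obtain ⟨y, hy0, hy⟩ := exists_isPrimitiveOn_of_lipschitz (f := fun s z => v s (π z)) (C := C) hT0
    (fun y hy => intervalIntegrable_of_norm_le hT0
      (aestronglyMeasurable_apply_of_continuousOn h.stronglyMeasurable measurableSet_Icc
        (hπ.continuous.comp hy).continuousOn)
      fun s hs => h.norm_le s (hT1 hs) _ (hKΩ (hπK _)))
    (fun s hs y z => ((hC s (hT1 hs)).norm_sub_le (hπK y) (hπK z)).trans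
      (mul_le_mul_of_nonneg_left (by simpa using hπ.norm_sub_le y z) C.2)) x
  have hsol {τ : ℝ} (hτ : τ ∈ Icc 0 T) (hin : ∀ r ∈ Icc 0 τ, y r ∈ K) :
      IsPrimitiveOn τ y (fun s => v s (y s)) :=
    (hy.mono hτ).congr_right hτ.1 fun s hs => by rw [hπid _ (hin s (Ioo_subset_Icc_self hs))]
  have hyK : ∀ t ∈ Icc (0 : ℝ) T, y t ∈ K :=
    forall_mem_of_bootstrap hy.continuousOn hKc (by rwa [hy0]) fun τ hτ hin => by
      have hmem := h.mem_core hΩc hΩ (hτ.2.trans hT) hρ.le (by rwa [hy0])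
        (hsol (Ico_subset_Icc_self hτ) hin) (fun r hr => hKΩ (hin r hr)) ⟨hτ.1, le_rfl⟩
      refine core_mem_nhds (ρ' := (T - τ) * ρ) (mul_pos (sub_pos.2 hτ.2) hρ) ?_
      rwa [← add_mul, add_comm, sub_add_sub_cancel']
  exact ⟨y, hy0, fun t ht => hKΩ (hyK t ht), hsol ⟨hT0, le_rfl⟩ hyK⟩

theorem exists_isPrimitiveOn (h : IsInwardField Ω v D) (hΩc : IsClosed Ω) (hΩ : Convex ℝ Ω)
    (hx : x ∈ interior Ω) :
    ∃ y, y 0 = x ∧ (∀ t ∈ Ico (0 : ℝ) 1, y t ∈ interior Ω) ∧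
      IsPrimitiveOn 1 y (fun s => v s (y s)) := by
  obtain ⟨ρ, hρ, hxρ⟩ := exists_mem_core_of_mem_interior hx
  choose! Y hY0 hYΩ hY using fun T (hT : T ∈ Ico (0 : ℝ) 1) =>
    h.exists_isPrimitiveOn_of_lt_one hΩc hΩ hT.1 hT.2 hρ hxρ
  have hdiag {T : ℝ} (hT : T ∈ Ico 0 1) : EqOn (fun t => Y t t) (Y T) (Icc 0 T) := fun t ht => by
    have ht1 : t ∈ Ico (0 : ℝ) 1 := ⟨ht.1, ht.2.trans_lt hT.2⟩
    exact h.eqOn ht1.2.le (hY t ht1) ((hY T hT).mono ht) ((hY0 t ht1).trans (hY0 T hT).symm)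
      (fun s hs => hYΩ t ht1 s (Ico_subset_Icc_self hs))
      (fun s hs => hYΩ T hT s ⟨hs.1, hs.2.le.trans ht.2⟩) ⟨ht.1, le_rfl⟩
  have hprim {T : ℝ} (hT : T ∈ Ico 0 1) :
      IsPrimitiveOn T (fun t => Y t t) (fun s => v s (Y s s)) :=
    ((hY T hT).congr_left (hdiag hT)).congr_right hT.1 fun s hs => by
      simp only [← hdiag hT (Ioo_subset_Icc_self hs)]
  have hint : IntervalIntegrable (fun s => v s (Y s s)) volume 0 1 :=
    intervalIntegrable_of_forall_lt one_pos (fun T hT => (hprim hT).intervalIntegrable)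
      fun s hs => h.norm_le s (Ico_subset_Icc_self hs) _ (hYΩ s hs s ⟨hs.1, le_rfl⟩)
  set y : ℝ → E := fun t => x + ∫ s in (0 : ℝ)..t, v s (Y s s)
  have hyY : ∀ t ∈ Ico (0 : ℝ) 1, y t = Y t t := fun t ht => by
    rw [(hprim ht).eq_add_integral t ⟨ht.1, le_rfl⟩, hY0 0 (by simp)]
  have hy0 : y 0 = x := by simp [y]
  refine ⟨y, hy0, fun t ht => hyY t ht ▸ hYΩ t ht t ⟨ht.1, le_rfl⟩, ?_⟩
  exact IsPrimitiveOn.congr_right zero_le_one ⟨hint, fun t _ => by rw [hy0]⟩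
    fun s hs => by simp only [hyY s (Ioo_subset_Ico_self hs)]

end IsInwardField

end InwardField

/-- On `K`, the function `f` is bounded by `C` and Lipschitz with constant `C`: a bound on its
`C^{0,1}`-norm. -/
structure IsLipBoundedOn {X F : Type*} [SeminormedAddCommGroup X] [SeminormedAddCommGroup F]
    (f : X → F) (C : ℝ) (K : Set X) : Prop where
  norm_le : ∀ z ∈ K, ‖f z‖ ≤ C
  norm_sub_le : ∀ z ∈ K, ∀ z' ∈ K, ‖f z - f z'‖ ≤ C * ‖z - z'‖

namespace IsLipBoundedOn

variable {X F : Type*} [SeminormedAddCommGroup X] [SeminormedAddCommGroup F] {f g : X → F}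
  {C C' : ℝ} {K K' : Set X}

theorem nonneg (h : IsLipBoundedOn f C K) (hK : K.Nonempty) : 0 ≤ C :=
  hK.elim fun z hz => (norm_nonneg _).trans (h.norm_le z hz)

theorem mono (h : IsLipBoundedOn f C K) (hC : C ≤ C') : IsLipBoundedOn f C' K :=
  ⟨fun z hz => (h.norm_le z hz).trans hC, fun z hz z' hz' =>
    (h.norm_sub_le z hz z' hz').trans (by gcongr)⟩

theorem mono_set (h : IsLipBoundedOn f C K) (hK : K' ⊆ K) : IsLipBoundedOn f C K' :=
  ⟨fun z hz => h.norm_le z (hK hz), fun z hz z' hz' => h.norm_sub_le z (hK hz) z' (hK hz')⟩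

theorem congr (h : IsLipBoundedOn f C K) (hfg : EqOn g f K) : IsLipBoundedOn g C K :=
  ⟨fun z hz => by rw [hfg hz]; exact h.norm_le z hz, fun z hz z' hz' => by
    rw [hfg hz, hfg hz']; exact h.norm_sub_le z hz z' hz'⟩

theorem lipschitzOnWith (h : IsLipBoundedOn f C K) : LipschitzOnWith C.toNNReal f K :=
  LipschitzOnWith.of_dist_le_mul fun z hz z' hz' => by
    rw [dist_eq_norm, dist_eq_norm, Real.coe_toNNReal _ (h.nonneg ⟨z, hz⟩)]
    exact h.norm_sub_le z hz z' hz'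

theorem comp_add_right (h : IsLipBoundedOn f C K) (e : X) :
    IsLipBoundedOn (fun z => f (z + e)) C {z | z + e ∈ K} :=
  ⟨fun _ hz => h.norm_le _ hz, fun _ hz _ hz' => by
    simpa only [add_sub_add_right_eq_sub] using h.norm_sub_le _ hz _ hz'⟩

theorem add (hf : IsLipBoundedOn f C K) (hg : IsLipBoundedOn g C' K) :
    IsLipBoundedOn (fun z => f z + g z) (C + C') K :=
  ⟨fun z hz => norm_add_le_of_le (hf.norm_le z hz) (hg.norm_le z hz), fun z hz z' hz' => by
    rw [add_sub_add_comm, add_mul]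
    exact norm_add_le_of_le (hf.norm_sub_le z hz z' hz') (hg.norm_sub_le z hz z' hz')⟩

theorem neg (hf : IsLipBoundedOn f C K) : IsLipBoundedOn (fun z => -f z) C K :=
  ⟨fun z hz => by rw [norm_neg]; exact hf.norm_le z hz, fun z hz z' hz' => by
    rw [neg_sub_neg, norm_sub_rev]; exact hf.norm_sub_le z hz z' hz'⟩

theorem sub (hf : IsLipBoundedOn f C K) (hg : IsLipBoundedOn g C' K) :
    IsLipBoundedOn (fun z => f z - g z) (C + C') K := by
  simpa only [sub_eq_add_neg] using hf.add hg.neg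

theorem smul [NormedSpace ℝ F] {a : X → ℝ} (ha : IsLipBoundedOn a C K)
    (hf : IsLipBoundedOn f C' K) : IsLipBoundedOn (fun z => a z • f z) (2 * (C * C')) K where
  norm_le z hz := by
    have hprod : ‖a z • f z‖ ≤ C * C' := by
      rw [norm_smul]
      exact mul_le_mul (ha.norm_le z hz) (hf.norm_le z hz) (norm_nonneg _) (ha.nonneg ⟨z, hz⟩)
    linarith [mul_nonneg (ha.nonneg ⟨z, hz⟩) (hf.nonneg ⟨z, hz⟩)]
  norm_sub_le z hz z' hz' := by
    have hC := ha.nonneg ⟨z, hz⟩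
    calc ‖a z • f z - a z' • f z'‖ = ‖(a z - a z') • f z + a z' • (f z - f z')‖ := by
          congr 1; module
      _ ≤ C * ‖z - z'‖ * C' + C * (C' * ‖z - z'‖) := by
          refine norm_add_le_of_le ?_ ?_ <;> rw [norm_smul]
          · exact mul_le_mul (ha.norm_sub_le z hz z' hz') (hf.norm_le z hz) (norm_nonneg _)
              (by positivity)
          · exact mul_le_mul (ha.norm_le z' hz') (hf.norm_sub_le z hz z' hz') (norm_nonneg _) hC
      _ = 2 * (C * C') * ‖z - z'‖ := by ring

theorem inv {a : X → ℝ} {c : ℝ} (ha : IsLipBoundedOn a C K) (hc : 0 < c)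
    (hac : ∀ z ∈ K, c ≤ a z) : IsLipBoundedOn (fun z => (a z)⁻¹) (c⁻¹ + C * c⁻¹ ^ 2) K where
  norm_le z hz := by
    have hC := ha.nonneg ⟨z, hz⟩
    have hcz := hac z hz
    rw [norm_inv, Real.norm_of_nonneg (hc.le.trans hcz)]
    exact (inv_anti₀ hc hcz).trans (le_add_of_nonneg_right (by positivity))
  norm_sub_le z hz z' hz' := by
    have hC := ha.nonneg ⟨z, hz⟩
    have hcz := hac z hz
    have hcz' := hac z' hz'
    have hsub : (a z)⁻¹ - (a z')⁻¹ = (a z' - a z) * ((a z)⁻¹ * (a z')⁻¹) := by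
      field_simp [(hc.trans_le hcz).ne', (hc.trans_le hcz').ne']
    have hinv : ‖(a z)⁻¹ * (a z')⁻¹‖ ≤ c⁻¹ ^ 2 := by
      have := hc.le.trans hcz
      have := hc.le.trans hcz'
      rw [Real.norm_of_nonneg (by positivity), sq]
      gcongr
    calc ‖(a z)⁻¹ - (a z')⁻¹‖ = ‖a z - a z'‖ * ‖(a z)⁻¹ * (a z')⁻¹‖ := by
          rw [hsub, norm_mul, norm_sub_rev]
      _ ≤ C * ‖z - z'‖ * c⁻¹ ^ 2 :=
          mul_le_mul (ha.norm_sub_le z hz z' hz') hinv (norm_nonneg _) (by positivity)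
      _ = C * c⁻¹ ^ 2 * ‖z - z'‖ := by ring
      _ ≤ _ := by gcongr; exact le_add_of_nonneg_left (inv_nonneg.2 hc.le)

theorem of_norm_sub_le {ρ : ℝ} (hρ : 0 < ρ) (hC' : 0 ≤ C') (hf : ∀ z ∈ K, ‖f z‖ ≤ C)
    (hf' : ∀ z ∈ K, ∀ z' ∈ K, ‖z - z'‖ ≤ ρ → ‖f z - f z'‖ ≤ C' * ‖z - z'‖) :
    IsLipBoundedOn f (C + C' + 2 * C / ρ) K := by
  have hC {z : X} (hz : z ∈ K) : 0 ≤ C := (norm_nonneg _).trans (hf z hz)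
  have hle {z : X} (hz : z ∈ K) : 0 ≤ 2 * C / ρ := by have := hC hz; positivity
  refine ⟨fun z hz => ?_, fun z hz z' hz' => ?_⟩
  · linarith [hf z hz, hle hz]
  rcases le_or_gt ‖z - z'‖ ρ with hnear | hfar
  · refine (hf' z hz z' hz' hnear).trans ?_
    gcongr
    linarith [hC hz, hle hz]
  · calc ‖f z - f z'‖ ≤ C + C := norm_sub_le_of_le (hf z hz) (hf z' hz')
      _ = 2 * C / ρ * ρ := by field_simp; ring
      _ ≤ 2 * C / ρ * ‖z - z'‖ := mul_le_mul_of_nonneg_left hfar.le (hle hz)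
      _ ≤ _ := by gcongr; linarith [hC hz]

end IsLipBoundedOn

section Measure

variable {E F : Type*} [NormedAddCommGroup E] [NormedSpace ℝ E] [MeasurableSpace E]
  [BorelSpace E] [FiniteDimensional ℝ E] [NormedAddCommGroup F] [NormedSpace ℝ F]

open scoped Pointwise in
theorem measureReal_sdiff_le_of_smul_subset {μ : Measure E} [μ.IsAddHaarMeasure] {S S' : Set E}
    (hS : μ S ≠ ∞) (hS' : MeasurableSet S') {l : ℝ} (hl : l ≤ 1) (h : (1 - l) • S ⊆ S ∩ S') :
    μ.real (S \ S') ≤ Module.finrank ℝ E * l * μ.real S := by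
  set n := Module.finrank ℝ E
  have hsmul : (1 - l) ^ n * μ.real S ≤ μ.real (S ∩ S') := by
    have hmono := measureReal_mono h (measure_ne_top_of_subset inter_subset_left hS)
    rwa [measureReal_def, Measure.addHaar_smul, ENNReal.toReal_mul,
      ENNReal.toReal_ofReal (abs_nonneg _),
      abs_of_nonneg (pow_nonneg (sub_nonneg.2 hl) _)] at hmono
  have hbernoulli : (1 - n * l) * μ.real S ≤ (1 - l) ^ n * μ.real S := by
    gcongr
    have := one_add_mul_le_pow (a := -l) (by linarith) n
    rwa [mul_neg, ← sub_eq_add_neg, ← sub_eq_add_neg] at this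
  have hsplit := measureReal_inter_add_sdiff (s := S) hS' hS
  linarith

theorem norm_setIntegral_sub_setIntegral_le {X : Type*} [MeasurableSpace X] {μ : Measure X}
    {S S' : Set X} {f f' : X → F} {a b : ℝ} (hS : MeasurableSet S) (hS' : MeasurableSet S')
    (hμ : μ S ≠ ∞) (hμ' : μ S' ≠ ∞) (hf : IntegrableOn f S μ) (hf' : IntegrableOn f' S' μ)
    (hsub : ∀ x ∈ S ∩ S', ‖f x - f' x‖ ≤ a) (hb : ∀ x ∈ S, ‖f x‖ ≤ b)
    (hb' : ∀ x ∈ S', ‖f' x‖ ≤ b) :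
    ‖∫ x in S, f x ∂μ - ∫ x in S', f' x ∂μ‖ ≤
      a * μ.real (S ∩ S') + (b * μ.real (S \ S') + b * μ.real (S' \ S)) := by
  have heq : ∫ x in S, f x ∂μ - ∫ x in S', f' x ∂μ = ∫ x in S ∩ S', (f x - f' x) ∂μ +
      (∫ x in S \ S', f x ∂μ - ∫ x in S' \ S, f' x ∂μ) := by
    rw [← integral_inter_add_sdiff hS' hf, ← integral_inter_add_sdiff hS hf', inter_comm S',
      integral_sub (hf.mono_set inter_subset_left) (hf'.mono_set inter_subset_right)]
    abel
  rw [heq]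
  exact norm_add_le_of_le
    (norm_setIntegral_le_of_norm_le_const (measure_lt_top_of_subset inter_subset_left hμ) hsub)
    (norm_sub_le_of_le
      (norm_setIntegral_le_of_norm_le_const (measure_lt_top_of_subset sdiff_subset hμ)
        fun x hx => hb x hx.1)
      (norm_setIntegral_le_of_norm_le_const (measure_lt_top_of_subset sdiff_subset hμ')
        fun x hx => hb' x hx.1))

end Measure

section Admissible

variable {d : ℕ} {Ω : Set (EuclideanSpace ℝ (Fin d))} {t ρ D : ℝ}
  {z z' δ : EuclideanSpace ℝ (Fin d)}

theorem isClosed_admissible (hΩ : IsClosed Ω) : IsClosed (admissible Ω t z) :=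
  (hΩ.preimage (f := fun δ => z - t • δ) (by fun_prop)).inter
    (hΩ.preimage (f := fun δ => z + (1 - t) • δ) (by fun_prop))

theorem norm_le_of_mem_admissible (hD : ∀ x ∈ Ω, ∀ y ∈ Ω, ‖x - y‖ ≤ D)
    (hδ : δ ∈ admissible Ω t z) : ‖δ‖ ≤ D := by
  have hchord := hD _ hδ.2 _ hδ.1
  rwa [show z + (1 - t) • δ - (z - t • δ) = δ by module] at hchord

theorem admissible_subset_closedBall (hD : ∀ x ∈ Ω, ∀ y ∈ Ω, ‖x - y‖ ≤ D) :
    admissible Ω t z ⊆ Metric.closedBall 0 D :=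
  fun _ hδ => mem_closedBall_zero_iff.2 (norm_le_of_mem_admissible hD hδ)

theorem closedBall_subset_admissible (ht : t ∈ Icc (0 : ℝ) 1) (hz : z ∈ core Ω ρ) :
    Metric.closedBall 0 ρ ⊆ admissible Ω t z := fun δ hδ => by
  have hsmul (c : ℝ) (hc : |c| ≤ 1) : z + c • δ ∈ Ω := hz _ <| by
    rw [norm_smul, Real.norm_eq_abs]
    exact (mul_le_of_le_one_left (norm_nonneg _) hc).trans (mem_closedBall_zero_iff.1 hδ)
  refine ⟨?_, hsmul _ (by rw [abs_of_nonneg] <;> linarith [ht.1, ht.2])⟩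
  rw [sub_eq_add_neg, ← neg_smul]
  exact hsmul _ (by rw [abs_neg, abs_of_nonneg ht.1]; exact ht.2)

theorem combo_mem_admissible (hΩ : Convex ℝ Ω) {z₁ z₂ δ₁ δ₂ : EuclideanSpace ℝ (Fin d)}
    (h₁ : δ₁ ∈ admissible Ω t z₁) (h₂ : δ₂ ∈ admissible Ω t z₂) {a b : ℝ} (ha : 0 ≤ a)
    (hb : 0 ≤ b) (hab : a + b = 1) :
    a • δ₁ + b • δ₂ ∈ admissible Ω t (a • z₁ + b • z₂) := by
  constructor
  · convert hΩ h₁.1 h₂.1 ha hb hab using 1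
    module
  · convert hΩ h₁.2 h₂.2 ha hb hab using 1
    module

theorem zero_mem_admissible (hz : z ∈ Ω) : 0 ∈ admissible Ω t z := by
  simpa [admissible] using hz

theorem smul_mem_admissible (hΩ : Convex ℝ Ω) (hρ : 0 < ρ) (hz : z ∈ core Ω ρ)
    (h : ‖z' - z‖ ≤ ρ) (hδ : δ ∈ admissible Ω t z) :
    (1 - ‖z' - z‖ / ρ) • δ ∈ admissible Ω t z' := by
  rcases eq_or_ne z' z with rfl | hne
  · simpa using hδ
  set l := ‖z' - z‖ / ρ with hl
  have hn : 0 < ‖z' - z‖ := norm_pos_iff.2 (sub_ne_zero.2 hne)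
  have hl0 : 0 < l := div_pos hn hρ
  -- `z'` lies between `z` and a point of `Ω` on the sphere of radius `ρ` around `z`.
  have hw : z + l⁻¹ • (z' - z) ∈ Ω := hz _ <| by
    rw [norm_smul, norm_inv, Real.norm_of_nonneg hl0.le, hl, inv_div, div_mul_cancel₀ _ hn.ne']
  have hz' : (1 - l) • z + l • (z + l⁻¹ • (z' - z)) = z' := by
    rw [smul_add, smul_inv_smul₀ hl0.ne']
    module
  have hmem := combo_mem_admissible hΩ hδ (zero_mem_admissible hw)
    (sub_nonneg.2 ((div_le_one hρ).2 h)) hl0.le (sub_add_cancel 1 l)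
  rwa [hz', smul_zero, add_zero] at hmem

theorem volume_admissible_ne_top (hD : ∀ x ∈ Ω, ∀ y ∈ Ω, ‖x - y‖ ≤ D) :
    volume (admissible Ω t z) ≠ ∞ :=
  measure_ne_top_of_subset (admissible_subset_closedBall hD) measure_closedBall_lt_top.ne

theorem volume_admissible_le (hD : ∀ x ∈ Ω, ∀ y ∈ Ω, ‖x - y‖ ≤ D) :
    volume.real (admissible Ω t z) ≤
      volume.real (Metric.closedBall (0 : EuclideanSpace ℝ (Fin d)) D) :=
  measureReal_mono (admissible_subset_closedBall hD) measure_closedBall_lt_top.ne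

theorem volume_admissible_sdiff_le (hΩc : IsClosed Ω) (hΩ : Convex ℝ Ω)
    (hD : ∀ x ∈ Ω, ∀ y ∈ Ω, ‖x - y‖ ≤ D) (hρ : 0 < ρ) (hz : z ∈ core Ω ρ)
    (h : ‖z' - z‖ ≤ ρ) :
    volume.real (admissible Ω t z \ admissible Ω t z') ≤
      d * (‖z' - z‖ / ρ) * volume.real (Metric.closedBall (0 : EuclideanSpace ℝ (Fin d)) D) := by
  have hl : ‖z' - z‖ / ρ ≤ 1 := (div_le_one hρ).2 h
  refine (measureReal_sdiff_le_of_smul_subset (l := ‖z' - z‖ / ρ) (volume_admissible_ne_top hD)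
    (isClosed_admissible hΩc).measurableSet hl ?_).trans ?_
  · rintro _ ⟨δ, hδ, rfl⟩
    refine ⟨?_, smul_mem_admissible hΩ hρ hz h hδ⟩
    have hmem := combo_mem_admissible hΩ hδ (zero_mem_admissible (core_subset hρ.le hz))
      (sub_nonneg.2 hl) (by positivity) (sub_add_cancel 1 _)
    rwa [Convex.combo_self (sub_add_cancel 1 _), smul_zero, add_zero] at hmem
  · rw [finrank_euclideanSpace_fin]
    exact mul_le_mul_of_nonneg_left (volume_admissible_le hD) (by positivity)

end Admissible

/-- A measurable kernel `H` on `Ω × Ω` whose restrictions to the diagonals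
`{(x, x + e) | x ∈ Ω, x + e ∈ Ω}` have `C^{0,1}`-norm at most `A`. -/
structure IsChordKernel {d : ℕ} (Ω : Set (EuclideanSpace ℝ (Fin d)))
    (H : EuclideanSpace ℝ (Fin d) → EuclideanSpace ℝ (Fin d) → ℝ) (A : ℝ) : Prop where
  measurable : Measurable (Function.uncurry H)
  isLipBoundedOn : ∀ e, IsLipBoundedOn (fun x => H x (x + e)) A (Ω ∩ {x | x + e ∈ Ω})

/-- The integral of `H(z - tδ, z + (1-t)δ) F(δ)` over `δ ∈ S_t(z)`. The velocity is the quotient of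
two such integrals, with `F(δ) = δ` and with `F(δ) = 1`. -/
noncomputable def chordIntegral {d : ℕ} {G : Type*} [NormedAddCommGroup G] [NormedSpace ℝ G]
    (Ω : Set (EuclideanSpace ℝ (Fin d)))
    (H : EuclideanSpace ℝ (Fin d) → EuclideanSpace ℝ (Fin d) → ℝ)
    (F : EuclideanSpace ℝ (Fin d) → G) (t : ℝ) (z : EuclideanSpace ℝ (Fin d)) : G :=
  ∫ δ in admissible Ω t z, H (z - t • δ) (z + (1 - t) • δ) • F δ

section Chord

variable {d : ℕ} {G : Type*} [NormedAddCommGroup G] [NormedSpace ℝ G]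
  {Ω : Set (EuclideanSpace ℝ (Fin d))}
  {H : EuclideanSpace ℝ (Fin d) → EuclideanSpace ℝ (Fin d) → ℝ}
  {F : EuclideanSpace ℝ (Fin d) → G} {A D M t ρ : ℝ}
  {z z' δ : EuclideanSpace ℝ (Fin d)}

theorem stronglyMeasurable_chordIntegral (hΩc : IsClosed Ω)
    (hH : Measurable (Function.uncurry H)) (hF : StronglyMeasurable F) :
    StronglyMeasurable fun w : ℝ × EuclideanSpace ℝ (Fin d) => chordIntegral Ω H F w.1 w.2 := by
  have heq (w : ℝ × EuclideanSpace ℝ (Fin d)) : chordIntegral Ω H F w.1 w.2 =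
      ∫ δ, {u : (ℝ × EuclideanSpace ℝ (Fin d)) × EuclideanSpace ℝ (Fin d) |
          u.1.2 - u.1.1 • u.2 ∈ Ω ∧ u.1.2 + (1 - u.1.1) • u.2 ∈ Ω}.indicator
        (fun u => H (u.1.2 - u.1.1 • u.2) (u.1.2 + (1 - u.1.1) • u.2) • F u.2) (w, δ) := by
    rw [chordIntegral, ← integral_indicator (isClosed_admissible hΩc).measurableSet]
    rfl
  simp_rw [heq]
  refine StronglyMeasurable.integral_prod_right (f := fun w δ => indicator _ _ (w, δ)) ?_
  have hHm : Measurable fun u : (ℝ × EuclideanSpace ℝ (Fin d)) × EuclideanSpace ℝ (Fin d) =>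
      H (u.1.2 - u.1.1 • u.2) (u.1.2 + (1 - u.1.1) • u.2) :=
    hH.comp (f := fun u : (ℝ × EuclideanSpace ℝ (Fin d)) × EuclideanSpace ℝ (Fin d) =>
      (u.1.2 - u.1.1 • u.2, u.1.2 + (1 - u.1.1) • u.2)) (by fun_prop)
  exact (hHm.stronglyMeasurable.smul (hF.comp_measurable measurable_snd)).indicator
    ((hΩc.preimage (by fun_prop)).inter (hΩc.preimage (by fun_prop))).measurableSet

namespace IsChordKernel

theorem norm_sub_le (hH : IsChordKernel Ω H A) (hδ : δ ∈ admissible Ω t z ∩ admissible Ω t z') :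
    ‖H (z - t • δ) (z + (1 - t) • δ) - H (z' - t • δ) (z' + (1 - t) • δ)‖ ≤
      A * ‖z - z'‖ := by
  have hend (w : EuclideanSpace ℝ (Fin d)) : w - t • δ + δ = w + (1 - t) • δ := by module
  have hle := (hH.isLipBoundedOn δ).norm_sub_le (z - t • δ) ⟨hδ.1.1, by
    rw [mem_ofPred_eq, hend]; exact hδ.1.2⟩ (z' - t • δ) ⟨hδ.2.1, by
    rw [mem_ofPred_eq, hend]; exact hδ.2.2⟩
  rwa [hend, hend, sub_sub_sub_cancel_right] at hle

theorem norm_smul_le (hH : IsChordKernel Ω H A) (hD : ∀ x ∈ Ω, ∀ y ∈ Ω, ‖x - y‖ ≤ D)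
    (hM : ∀ δ, ‖δ‖ ≤ D → ‖F δ‖ ≤ M) (hδ : δ ∈ admissible Ω t z) :
    ‖H (z - t • δ) (z + (1 - t) • δ) • F δ‖ ≤ A * M := by
  have hend : z - t • δ + δ = z + (1 - t) • δ := by module
  have hle := (hH.isLipBoundedOn δ).norm_le (z - t • δ) ⟨hδ.1, by
    rw [mem_ofPred_eq, hend]; exact hδ.2⟩
  rw [hend] at hle
  rw [norm_smul]
  exact mul_le_mul hle (hM _ (norm_le_of_mem_admissible hD hδ)) (norm_nonneg _)
    ((norm_nonneg _).trans hle)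

theorem integrableOn (hH : IsChordKernel Ω H A) (hΩc : IsClosed Ω)
    (hD : ∀ x ∈ Ω, ∀ y ∈ Ω, ‖x - y‖ ≤ D) (hF : StronglyMeasurable F)
    (hM : ∀ δ, ‖δ‖ ≤ D → ‖F δ‖ ≤ M) :
    IntegrableOn (fun δ => H (z - t • δ) (z + (1 - t) • δ) • F δ) (admissible Ω t z) := by
  have hHm : Measurable fun δ : EuclideanSpace ℝ (Fin d) => H (z - t • δ) (z + (1 - t) • δ) :=
    hH.measurable.comp (f := fun δ => (z - t • δ, z + (1 - t) • δ)) (by fun_prop)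
  exact IntegrableOn.of_bound (volume_admissible_ne_top hD).lt_top
    (hHm.stronglyMeasurable.smul hF).aestronglyMeasurable (A * M)
    (ae_restrict_of_forall_mem (isClosed_admissible hΩc).measurableSet
      fun _ => hH.norm_smul_le hD hM)

theorem norm_chordIntegral_sub_le (hH : IsChordKernel Ω H A) (hA : 0 ≤ A) (hM0 : 0 ≤ M)
    (hΩc : IsClosed Ω) (hΩ : Convex ℝ Ω) (hD : ∀ x ∈ Ω, ∀ y ∈ Ω, ‖x - y‖ ≤ D)
    (hF : StronglyMeasurable F) (hM : ∀ δ, ‖δ‖ ≤ D → ‖F δ‖ ≤ M) (hρ : 0 < ρ)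
    (hz : z ∈ core Ω ρ) (hz' : z' ∈ core Ω ρ) (h : ‖z - z'‖ ≤ ρ) :
    ‖chordIntegral Ω H F t z - chordIntegral Ω H F t z'‖ ≤
      A * (M * volume.real (Metric.closedBall (0 : EuclideanSpace ℝ (Fin d)) D) *
        (1 + 2 * d / ρ)) * ‖z - z'‖ := by
  set V := volume.real (Metric.closedBall (0 : EuclideanSpace ℝ (Fin d)) D)
  have hinter : volume.real (admissible Ω t z ∩ admissible Ω t z') ≤ V :=
    (measureReal_mono inter_subset_left (volume_admissible_ne_top hD)).trans
      (volume_admissible_le hD)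
  have hzz' := volume_admissible_sdiff_le (t := t) hΩc hΩ hD hρ hz (by rwa [norm_sub_rev])
  have hz'z := volume_admissible_sdiff_le (t := t) hΩc hΩ hD hρ hz' h
  rw [norm_sub_rev] at hzz'
  calc ‖chordIntegral Ω H F t z - chordIntegral Ω H F t z'‖
      ≤ A * ‖z - z'‖ * M * volume.real (admissible Ω t z ∩ admissible Ω t z') +
        (A * M * volume.real (admissible Ω t z \ admissible Ω t z') +
          A * M * volume.real (admissible Ω t z' \ admissible Ω t z)) := by
        refine norm_setIntegral_sub_setIntegral_le (isClosed_admissible hΩc).measurableSet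
          (isClosed_admissible hΩc).measurableSet (volume_admissible_ne_top hD)
          (volume_admissible_ne_top hD) (hH.integrableOn hΩc hD hF hM)
          (hH.integrableOn hΩc hD hF hM) (fun δ hδ => ?_)
          (fun _ => hH.norm_smul_le hD hM) (fun _ => hH.norm_smul_le hD hM)
        rw [← sub_smul, norm_smul]
        exact mul_le_mul (hH.norm_sub_le hδ) (hM _ (norm_le_of_mem_admissible hD hδ.1))
          (norm_nonneg _) (by positivity)
    _ ≤ A * ‖z - z'‖ * M * V +
        (A * M * (d * (‖z - z'‖ / ρ) * V) + A * M * (d * (‖z - z'‖ / ρ) * V)) := by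
        gcongr
    _ = _ := by ring

end IsChordKernel

theorem exists_isLipBoundedOn_chordIntegral (hΩc : IsClosed Ω) (hΩ : Convex ℝ Ω)
    (hD : ∀ x ∈ Ω, ∀ y ∈ Ω, ‖x - y‖ ≤ D) (hF : StronglyMeasurable F) (hM0 : 0 ≤ M)
    (hM : ∀ δ, ‖δ‖ ≤ D → ‖F δ‖ ≤ M) (hρ : 0 < ρ) :
    ∃ b ≥ 0, ∀ H A, 0 ≤ A → IsChordKernel Ω H A → ∀ t,
      IsLipBoundedOn (chordIntegral Ω H F t) (A * b) (core Ω ρ) := by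
  set V := volume.real (Metric.closedBall (0 : EuclideanSpace ℝ (Fin d)) D)
  have : 0 ≤ V := measureReal_nonneg
  refine ⟨M * V + M * V * (1 + 2 * d / ρ) + 2 * (M * V) / ρ, by positivity,
    fun H A hA hH t => ?_⟩
  have hbound (z : EuclideanSpace ℝ (Fin d)) : ‖chordIntegral Ω H F t z‖ ≤ A * (M * V) :=
    calc ‖chordIntegral Ω H F t z‖ ≤ A * M * volume.real (admissible Ω t z) :=
          norm_setIntegral_le_of_norm_le_const (volume_admissible_ne_top hD).lt_top
            fun _ => hH.norm_smul_le hD hM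
      _ ≤ A * M * V := by gcongr; exact volume_admissible_le hD
      _ = A * (M * V) := mul_assoc _ _ _
  refine (IsLipBoundedOn.of_norm_sub_le hρ (by positivity) (fun z _ => hbound z)
    fun z hz z' hz' h => hH.norm_chordIntegral_sub_le hA hM0 hΩc hΩ hD hF hM hρ hz hz' h).mono
    (le_of_eq (by ring))

end Chord

/-- `p` is measurable, and on `Ω` it is bounded below by `m > 0` and has `C^{0,1}`-norm at most
`M`. -/
structure IsRegularOn {d : ℕ} (p : EuclideanSpace ℝ (Fin d) → ℝ) (m M : ℝ)
    (Ω : Set (EuclideanSpace ℝ (Fin d))) : Prop where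
  measurable : Measurable p
  pos : 0 < m
  le : ∀ x ∈ Ω, m ≤ p x
  isLipBoundedOn : IsLipBoundedOn p M Ω

section Velocity

variable {d : ℕ} {Ω : Set (EuclideanSpace ℝ (Fin d))}
  {p q : EuclideanSpace ℝ (Fin d) → ℝ} {m M D t ρ : ℝ}
  {z z' : EuclideanSpace ℝ (Fin d)}

theorem IsRegularOn.isChordKernel (hp : IsRegularOn p m M Ω) (hq : IsRegularOn q m M Ω) :
    IsChordKernel Ω (fun x y => p x * q y) (2 * (M * M)) where
  measurable := (hp.measurable.comp measurable_fst).mul (hq.measurable.comp measurable_snd)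
  isLipBoundedOn e := (hp.isLipBoundedOn.mono_set inter_subset_left).smul
    ((hq.isLipBoundedOn.comp_add_right e).mono_set inter_subset_right)

theorem IsRegularOn.sq_le_mul (hp : IsRegularOn p m M Ω) (hq : IsRegularOn q m M Ω)
    {x y : EuclideanSpace ℝ (Fin d)} (hx : x ∈ Ω) (hy : y ∈ Ω) : m ^ 2 ≤ p x * q y := by
  rw [sq]
  exact mul_le_mul (hp.le x hx) (hq.le y hy) hp.pos.le (hp.pos.le.trans (hp.le x hx))

theorem velocity_eq_chordIntegral : velocity Ω p q t z =
    (chordIntegral Ω (fun x y => p x * q y) (fun _ => (1 : ℝ)) t z)⁻¹ •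
      chordIntegral Ω (fun x y => p x * q y) id t z := by
  simp only [velocity, chordIntegral, smul_eq_mul, mul_one, id_eq]

theorem stronglyMeasurable_velocity (hΩc : IsClosed Ω) (hp : Measurable p) (hq : Measurable q) :
    StronglyMeasurable fun w : ℝ × EuclideanSpace ℝ (Fin d) => velocity Ω p q w.1 w.2 := by
  simp_rw [velocity_eq_chordIntegral]
  have hH : Measurable (Function.uncurry fun x y => p x * q y) :=
    (hp.comp measurable_fst).mul (hq.comp measurable_snd)
  exact (stronglyMeasurable_chordIntegral hΩc hH
      (stronglyMeasurable_const (b := (1 : ℝ)))).measurable.inv.stronglyMeasurable.smul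
    (stronglyMeasurable_chordIntegral hΩc hH stronglyMeasurable_id)

theorem IsChordKernel.mul_volume_le_chordIntegral
    {H : EuclideanSpace ℝ (Fin d) → EuclideanSpace ℝ (Fin d) → ℝ} {A c : ℝ}
    (hH : IsChordKernel Ω H A) (hΩc : IsClosed Ω) (hD : ∀ x ∈ Ω, ∀ y ∈ Ω, ‖x - y‖ ≤ D)
    (hc : 0 ≤ c) (hHc : ∀ x ∈ Ω, ∀ y ∈ Ω, c ≤ H x y) (ht : t ∈ Icc (0 : ℝ) 1)
    (hz : z ∈ core Ω ρ) :
    c * volume.real (Metric.closedBall (0 : EuclideanSpace ℝ (Fin d)) ρ) ≤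
      chordIntegral Ω H (fun _ => (1 : ℝ)) t z :=
  calc c * volume.real (Metric.closedBall (0 : EuclideanSpace ℝ (Fin d)) ρ)
      ≤ c * volume.real (admissible Ω t z) := mul_le_mul_of_nonneg_left
        (measureReal_mono (closedBall_subset_admissible ht hz) (volume_admissible_ne_top hD)) hc
    _ = ∫ _ in admissible Ω t z, c := by rw [setIntegral_const, smul_eq_mul, mul_comm]
    _ ≤ chordIntegral Ω H (fun _ => (1 : ℝ)) t z :=
        setIntegral_mono_on (integrableOn_const (volume_admissible_ne_top hD))
          (hH.integrableOn (M := 1) hΩc hD stronglyMeasurable_const (by simp))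
          (isClosed_admissible hΩc).measurableSet fun δ hδ => by
            simpa using hHc _ hδ.1 _ hδ.2

theorem volume_closedBall_pos (hρ : 0 < ρ) :
    0 < volume.real (Metric.closedBall (0 : EuclideanSpace ℝ (Fin d)) ρ) :=
  ENNReal.toReal_pos (Metric.measure_closedBall_pos volume _ hρ).ne'
    measure_closedBall_lt_top.ne

theorem exists_pos_le_chordIntegral_one (hΩc : IsClosed Ω)
    (hD : ∀ x ∈ Ω, ∀ y ∈ Ω, ‖x - y‖ ≤ D) (hp : IsRegularOn p m M Ω)
    (hq : IsRegularOn q m M Ω) (hρ : 0 < ρ) :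
    ∃ c > 0, ∀ t ∈ Icc (0 : ℝ) 1, ∀ z ∈ core Ω ρ,
      c ≤ chordIntegral Ω (fun x y => p x * q y) (fun _ => (1 : ℝ)) t z :=
  ⟨_, mul_pos (pow_pos hp.pos 2) (volume_closedBall_pos hρ), fun _ ht _ hz =>
    (hp.isChordKernel hq).mul_volume_le_chordIntegral hΩc hD (sq_nonneg m)
      (fun _ hx _ hy => hp.sq_le_mul hq hx hy) ht hz⟩

theorem dual_velocity_le (hΩc : IsClosed Ω) (hD : ∀ x ∈ Ω, ∀ y ∈ Ω, ‖x - y‖ ≤ D)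
    (hp : IsRegularOn p m M Ω) (hq : IsRegularOn q m M Ω) (ht : t ∈ Icc (0 : ℝ) 1)
    (hz : z ∈ interior Ω) {f : StrongDual ℝ (EuclideanSpace ℝ (Fin d))} {c : ℝ}
    (hc : ∀ δ ∈ admissible Ω t z, f δ ≤ c) : f (velocity Ω p q t z) ≤ c := by
  have hK := hp.isChordKernel hq
  obtain ⟨ρ, hρ, hzρ⟩ := exists_mem_core_of_mem_interior hz
  obtain ⟨b, hb, hbn⟩ := exists_pos_le_chordIntegral_one hΩc hD hp hq hρ
  have hone := hK.integrableOn (F := fun _ => (1 : ℝ)) (M := 1) (t := t) (z := z) hΩc hD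
    stronglyMeasurable_const (by simp)
  have hid := hK.integrableOn (F := id) (t := t) (z := z) hΩc hD stronglyMeasurable_id
    fun δ hδ => hδ
  rw [velocity_eq_chordIntegral, map_smul, smul_eq_mul,
    inv_mul_le_iff₀ (hb.trans_le (hbn t ht z hzρ)), chordIntegral,
    ← f.integral_comp_comm hid, chordIntegral, ← integral_mul_const]
  refine setIntegral_mono_on (f.integrable_comp hid) (hone.mul_const c)
    (isClosed_admissible hΩc).measurableSet fun δ hδ => ?_
  rw [map_smul, smul_eq_mul, smul_eq_mul, mul_one]
  exact mul_le_mul_of_nonneg_left (hc δ hδ)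
    ((sq_nonneg m).trans (hp.sq_le_mul hq hδ.1 hδ.2))

theorem norm_velocity_le (hΩc : IsClosed Ω) (hD : ∀ x ∈ Ω, ∀ y ∈ Ω, ‖x - y‖ ≤ D)
    (hp : IsRegularOn p m M Ω) (hq : IsRegularOn q m M Ω) (ht : t ∈ Icc (0 : ℝ) 1)
    (hz : z ∈ interior Ω) : ‖velocity Ω p q t z‖ ≤ D := by
  set v := velocity Ω p q t z
  have hle : innerSL ℝ v v ≤ ‖v‖ * D := dual_velocity_le hΩc hD hp hq ht hz fun δ hδ =>
    (real_inner_le_norm _ _).trans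
      (mul_le_mul_of_nonneg_left (norm_le_of_mem_admissible hD hδ) (norm_nonneg _))
  rw [innerSL_apply_apply, real_inner_self_eq_norm_mul_norm] at hle
  rcases (norm_nonneg v).eq_or_lt with h0 | hpos
  · rw [← h0]
    exact norm_zero.symm.trans_le
      (norm_le_of_mem_admissible hD (zero_mem_admissible (t := t) (interior_subset hz)))
  · exact le_of_mul_le_mul_left hle hpos

theorem dual_velocity_le_div_one_sub (hΩc : IsClosed Ω) (hD : ∀ x ∈ Ω, ∀ y ∈ Ω, ‖x - y‖ ≤ D)
    (hp : IsRegularOn p m M Ω) (hq : IsRegularOn q m M Ω) (ht : t ∈ Ico (0 : ℝ) 1)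
    (hz : z ∈ interior Ω) {f : StrongDual ℝ (EuclideanSpace ℝ (Fin d))} {c : ℝ}
    (hc : ∀ y ∈ Ω, f y ≤ c) : f (velocity Ω p q t z) ≤ (c - f z) / (1 - t) := by
  refine dual_velocity_le hΩc hD hp hq (Ico_subset_Icc_self ht) hz fun δ hδ => ?_
  have hend := hc _ hδ.2
  rw [map_add, map_smul, smul_eq_mul] at hend
  rw [le_div_iff₀ (sub_pos.2 ht.2)]
  linarith

theorem exists_isLipBoundedOn_velocity (hΩc : IsClosed Ω) (hΩ : Convex ℝ Ω)
    (hD : ∀ x ∈ Ω, ∀ y ∈ Ω, ‖x - y‖ ≤ D) (hD0 : 0 ≤ D) (hp : IsRegularOn p m M Ω)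
    (hq : IsRegularOn q m M Ω) (hρ : 0 < ρ) :
    ∃ C, ∀ t ∈ Icc (0 : ℝ) 1, IsLipBoundedOn (velocity Ω p q t) C (core Ω ρ) := by
  obtain ⟨c, hc, hcn⟩ := exists_pos_le_chordIntegral_one hΩc hD hp hq hρ
  obtain ⟨b, -, hb⟩ := exists_isLipBoundedOn_chordIntegral (F := fun _ => (1 : ℝ)) (M := 1)
    hΩc hΩ hD stronglyMeasurable_const zero_le_one (by simp) hρ
  obtain ⟨b', -, hb'⟩ := exists_isLipBoundedOn_chordIntegral (F := id)
    hΩc hΩ hD stronglyMeasurable_id hD0 (fun _ hδ => hδ) hρ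
  have hK := hp.isChordKernel hq
  have hM : 0 ≤ 2 * (M * M) := mul_nonneg zero_le_two (mul_self_nonneg M)
  exact ⟨_, fun t ht => (((hb _ _ hM hK t).inv hc (hcn t ht)).smul (hb' _ _ hM hK t)).congr
    fun z _ => velocity_eq_chordIntegral⟩

theorem IsRegularOn.isInwardField_velocity (hΩc : IsClosed Ω) (hΩ : Convex ℝ Ω)
    (hD : ∀ x ∈ Ω, ∀ y ∈ Ω, ‖x - y‖ ≤ D) (hD0 : 0 ≤ D) (hp : IsRegularOn p m M Ω)
    (hq : IsRegularOn q m M Ω) : IsInwardField Ω (velocity Ω p q) D where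
  stronglyMeasurable := stronglyMeasurable_velocity hΩc hp.measurable hq.measurable
  norm_le _ ht _ hz := norm_velocity_le hΩc hD hp hq ht hz
  exists_lipschitzOnWith _ hρ :=
    (exists_isLipBoundedOn_velocity hΩc hΩ hD hD0 hp hq hρ).imp'
      Real.toNNReal fun _ hC t ht => (hC t ht).lipschitzOnWith
  dual_le _ ht _ hz _ _ hc := dual_velocity_le_div_one_sub hΩc hD hp hq ht hz hc

section Perturbation

variable {G : Type*} [NormedAddCommGroup G] [NormedSpace ℝ G]
  {H H' : EuclideanSpace ℝ (Fin d) → EuclideanSpace ℝ (Fin d) → ℝ}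
  {F : EuclideanSpace ℝ (Fin d) → G} {A A' : ℝ}

theorem IsChordKernel.chordIntegral_add (hH : IsChordKernel Ω H A)
    (hH' : IsChordKernel Ω (fun x y => H' x y - H x y) A') (hΩc : IsClosed Ω)
    (hD : ∀ x ∈ Ω, ∀ y ∈ Ω, ‖x - y‖ ≤ D) (hF : StronglyMeasurable F)
    (hM : ∀ δ, ‖δ‖ ≤ D → ‖F δ‖ ≤ M) :
    chordIntegral Ω H F t z + chordIntegral Ω (fun x y => H' x y - H x y) F t z =
      chordIntegral Ω H' F t z := by
  rw [chordIntegral, chordIntegral, ← integral_add (hH.integrableOn hΩc hD hF hM)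
    (hH'.integrableOn hΩc hD hF hM)]
  simp only [← add_smul, add_sub_cancel, chordIntegral]

theorem inv_smul_sub_inv_smul {n n' : ℝ} (hn : n ≠ 0) (hn' : n' ≠ 0) (g g' : G) :
    n'⁻¹ • g' - n⁻¹ • g = n'⁻¹ • (g' - g - (n' - n) • n⁻¹ • g) := by
  match_scalars <;> field_simp
  ring

theorem exists_isLipBoundedOn_velocity_sub (hΩc : IsClosed Ω) (hΩ : Convex ℝ Ω)
    (hD : ∀ x ∈ Ω, ∀ y ∈ Ω, ‖x - y‖ ≤ D) (hD0 : 0 ≤ D) (hp : IsRegularOn p m M Ω)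
    (hq : IsRegularOn q m M Ω) (hρ : 0 < ρ) :
    ∃ C, ∃ κ₀ > 0, ∀ κ ∈ Icc 0 κ₀, ∀ p' q' : EuclideanSpace ℝ (Fin d) → ℝ,
      IsChordKernel Ω (fun x y => p' x * q' y - p x * q y) κ →
      ∀ t ∈ Icc (0 : ℝ) 1, IsLipBoundedOn (fun z => velocity Ω p' q' t z - velocity Ω p q t z)
        (C * κ) (core Ω ρ) := by
  obtain ⟨Cv, hCv⟩ := exists_isLipBoundedOn_velocity hΩc hΩ hD hD0 hp hq hρ
  obtain ⟨c, hc, hcn⟩ := exists_pos_le_chordIntegral_one hΩc hD hp hq hρ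
  obtain ⟨b, hb0, hb⟩ := exists_isLipBoundedOn_chordIntegral (F := fun _ => (1 : ℝ)) (M := 1)
    hΩc hΩ hD stronglyMeasurable_const zero_le_one (by simp) hρ
  obtain ⟨b', -, hb'⟩ := exists_isLipBoundedOn_chordIntegral (F := id)
    hΩc hΩ hD stronglyMeasurable_id hD0 (fun _ hδ => hδ) hρ
  have hK := hp.isChordKernel hq
  have hM : 0 ≤ 2 * (M * M) := mul_nonneg zero_le_two (mul_self_nonneg M)
  refine ⟨2 * (((c / 2)⁻¹ + (2 * (M * M) + 1) * b * (c / 2)⁻¹ ^ 2) * (b' + 2 * (b * Cv))),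
    min 1 (c / (2 * (b + 1))), by positivity, fun κ hκ p' q' hE t ht => ?_⟩
  obtain ⟨hκ1, hκc⟩ := le_min_iff.1 hκ.2
  set n := chordIntegral Ω (fun x y => p x * q y) (fun _ => (1 : ℝ)) t
  set n' := chordIntegral Ω (fun x y => p' x * q' y) (fun _ => (1 : ℝ)) t
  set e := chordIntegral Ω (fun x y => p' x * q' y - p x * q y) (fun _ => (1 : ℝ)) t
  set e' := chordIntegral Ω (fun x y => p' x * q' y - p x * q y) id t
  have he : IsLipBoundedOn e (κ * b) (core Ω ρ) := hb _ _ hκ.1 hE t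
  have hn' (z : EuclideanSpace ℝ (Fin d)) : n z + e z = n' z :=
    hK.chordIntegral_add (M := 1) hE hΩc hD stronglyMeasurable_const (by simp)
  have hlow (z : EuclideanSpace ℝ (Fin d)) (hz : z ∈ core Ω ρ) : c / 2 ≤ n' z := by
    have hez : ‖e z‖ ≤ c / 2 := calc
      ‖e z‖ ≤ κ * b := he.norm_le z hz
      _ ≤ c / (2 * (b + 1)) * (b + 1) := by gcongr; linarith
      _ = c / 2 := by field_simp
    linarith [hn' z, hcn t ht z hz, (abs_le.1 hez).1]
  have hinv : IsLipBoundedOn (fun z => (n' z)⁻¹)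
      ((c / 2)⁻¹ + (2 * (M * M) + 1) * b * (c / 2)⁻¹ ^ 2) (core Ω ρ) := by
    refine IsLipBoundedOn.inv ?_ (half_pos hc) hlow
    refine (((hb _ _ hM hK t).add he).congr fun z _ => (hn' z).symm).mono ?_
    rw [← add_mul]
    gcongr
  refine ((hinv.smul ((hb' _ _ hκ.1 hE t).sub (he.smul (hCv t ht)))).congr fun z hz => ?_).mono
    (le_of_eq (by ring))
  simp_rw [velocity_eq_chordIntegral]
  rw [inv_smul_sub_inv_smul (hc.trans_le (hcn t ht z hz)).ne'
    ((half_pos hc).trans_le (hlow z hz)).ne', ← hn' z, add_sub_cancel_left,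
    ← hK.chordIntegral_add hE hΩc hD stronglyMeasurable_id (fun _ hδ => hδ), add_sub_cancel_left]

end Perturbation

end Velocity

section LipschitzOfFDeriv

variable {E : Type*} [NormedAddCommGroup E] [NormedSpace ℝ E]

theorem abs_sub_le_of_ae_norm_fderiv_le_along {g : E → ℝ} {s : Set E} {K : ℝ≥0} {κ : ℝ} {x v : E}
    (hg : LipschitzOnWith K g s) (hs : ∀ t ∈ Icc (0 : ℝ) 1, x + t • v ∈ s)
    (h : ∀ᵐ t : ℝ, x + t • v ∈ s →
      DifferentiableAt ℝ g (x + t • v) ∧ ‖fderiv ℝ g (x + t • v)‖ ≤ κ) :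
    |g (x + v) - g x| ≤ κ * ‖v‖ := by
  have hline (t : ℝ) : HasDerivAt (fun t : ℝ => x + t • v) v t := by
    simpa using ((hasDerivAt_id t).smul_const v).const_add x
  have hlip : LipschitzOnWith (K * ‖v‖₊) (fun t : ℝ => g (x + t • v)) (uIcc 0 1) := by
    rw [uIcc_of_le zero_le_one]
    refine hg.comp (LipschitzOnWith.of_dist_le_mul fun t _ t' _ => ?_) hs
    rw [dist_add_left, dist_eq_norm, ← sub_smul, norm_smul, dist_eq_norm, mul_comm, coe_nnnorm]
  have hFTC := hlip.absolutelyContinuousOnInterval.integral_deriv_eq_sub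
  simp only [one_smul, zero_smul, add_zero] at hFTC
  rw [← hFTC, ← Real.norm_eq_abs]
  refine (intervalIntegral.norm_integral_le_of_norm_le_const_ae (C := κ * ‖v‖) ?_).trans
    (by simp)
  filter_upwards [h] with t ht ht01
  rw [uIoc_of_le zero_le_one] at ht01
  obtain ⟨hdiff, hle⟩ := ht (hs t (Ioc_subset_Icc_self ht01))
  have hderiv : HasDerivAt (fun t : ℝ => g (x + t • v)) (fderiv ℝ g (x + t • v) v) t :=
    hdiff.hasFDerivAt.comp_hasDerivAt t (hline t)
  rw [hderiv.deriv]
  exact ContinuousLinearMap.le_of_opNorm_le _ hle v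

variable [FiniteDimensional ℝ E] [MeasurableSpace E] [BorelSpace E] {μ : Measure E}
  [μ.IsAddHaarMeasure]

theorem ae_ae_add_smul {P : E → Prop} (h : ∀ᵐ x ∂μ, P x) (v : E) :
    ∀ᵐ x ∂μ, ∀ᵐ t : ℝ, P (x + t • v) := by
  have hmp : Measure.QuasiMeasurePreserving (fun w : E × ℝ => w.1 + w.2 • v)
      (μ.prod volume) μ :=
    QuasiMeasurePreserving.prod_of_left (by fun_prop) (.of_forall fun t =>
      (measurePreserving_add_right μ (t • v)).quasiMeasurePreserving)
  exact Measure.ae_ae_of_ae_prod (hmp.ae h)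

theorem ae_differentiableAt_of_lipschitzOnWith {g : E → ℝ} {s : Set E} {K : ℝ≥0}
    (hg : LipschitzOnWith K g s) : ∀ᵐ x ∂μ, x ∈ interior s → DifferentiableAt ℝ g x := by
  filter_upwards [hg.ae_differentiableWithinAt_of_mem (μ := μ)] with x hx hxi
  exact (hx (interior_subset hxi)).differentiableAt (mem_interior_iff_mem_nhds.1 hxi)

theorem lipschitzOnWith_of_ae_norm_fderiv_le {g : E → ℝ} {Ω : Set E} {K κ : ℝ≥0}
    (hΩc : IsClosed Ω) (hΩ : Convex ℝ Ω) (hne : (interior Ω).Nonempty)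
    (hg : LipschitzOnWith K g Ω) (h : ∀ᵐ x ∂μ, x ∈ interior Ω → ‖fderiv ℝ g x‖ ≤ κ) :
    LipschitzOnWith κ g Ω := by
  have hcl : closure (interior Ω) = Ω := by
    rw [hΩ.closure_interior_eq_closure_of_nonempty_interior hne, hΩc.closure_eq]
  have hg' : ∀ z ∈ interior Ω, ContinuousAt g z := fun z hz =>
    hg.continuousOn.continuousAt (mem_interior_iff_mem_nhds.1 hz)
  rw [← hcl]
  refine LipschitzOnWith.closure (hcl.symm ▸ hg.continuousOn)
    (LipschitzOnWith.of_dist_le_mul fun y hy x hx => ?_)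
  obtain ⟨v, rfl⟩ : ∃ v, y = x + v := ⟨y - x, (add_sub_cancel x y).symm⟩
  -- For almost all `x'` near `x`, almost every point of the line `x' + ℝ v` is good.
  have hgood : ∃ᶠ x' in 𝓝 x, ∀ᵐ t : ℝ, x' + t • v ∈ interior Ω →
      DifferentiableAt ℝ g (x' + t • v) ∧ ‖fderiv ℝ g (x' + t • v)‖ ≤ κ := by
    suffices hae : ∀ᵐ z ∂μ, z ∈ interior Ω → DifferentiableAt ℝ g z ∧ ‖fderiv ℝ g z‖ ≤ κ from
      mem_closure_iff_frequently.1 (Measure.dense_of_ae (ae_ae_add_smul hae v) x)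
    filter_upwards [ae_differentiableAt_of_lipschitzOnWith hg, h] with z hz hz' hzi
      using ⟨hz hzi, hz' hzi⟩
  have hshift : Tendsto (· + v) (𝓝 x) (𝓝 (x + v)) := (continuous_add_const v).tendsto x
  rw [Real.dist_eq, dist_eq_norm, add_sub_cancel_left]
  refine le_of_tendsto_of_frequently (((hg' _ hy).tendsto.comp hshift).sub (hg' x hx)).abs
    ((hgood.and_eventually ((isOpen_interior.eventually_mem hx).and
      (hshift.eventually (isOpen_interior.eventually_mem hy)))).mono ?_)
  rintro x' ⟨hx'v, hx', hyx'⟩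
  exact abs_sub_le_of_ae_norm_fderiv_le_along (hg.mono interior_subset)
    (fun t ht => hΩ.interior.add_smul_mem hx' hyx' ht) hx'v

end LipschitzOfFDeriv

section Modulus

variable {d : ℕ} {Ω : Set (EuclideanSpace ℝ (Fin d))}
  {p q : EuclideanSpace ℝ (Fin d) → ℝ} {D : ℝ}

theorem HasLinearModulus.symm (h : HasLinearModulus Ω p q) : HasLinearModulus Ω q p := by
  simpa only [HasLinearModulus, modulus, max_comm] using h

theorem HasLinearModulus.exists_abs_div_sub_one_le_mul (h : HasLinearModulus Ω p q) :
    ∃ L : ℝ≥0, ∀ η > 0, ∀ z ∈ Ω, ∀ z' ∈ Ω, ‖z - z'‖ ≤ η → |p z / p z' - 1| ≤ L * η := by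
  obtain ⟨L, hL⟩ := h
  refine ⟨L.toNNReal, fun η hη z hz z' hz' hzz' => ?_⟩
  rw [← ENNReal.ofReal_le_ofReal_iff (by positivity)]
  calc ENNReal.ofReal |p z / p z' - 1|
      ≤ ENNReal.ofReal (max |p z / p z' - 1| |q z / q z' - 1|) :=
        ENNReal.ofReal_le_ofReal (le_max_left _ _)
    _ ≤ modulus Ω p q η := le_iSup₂_of_le z hz (le_iSup₂_of_le z' hz' (le_iSup_of_le hzz' le_rfl))
    _ ≤ ENNReal.ofReal (L * η) := hL η hη
    _ ≤ ENNReal.ofReal (L.toNNReal * η) := ENNReal.ofReal_le_ofReal (by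
        gcongr
        exact Real.le_coe_toNNReal L)

theorem HasLinearModulus.ne_zero (h : HasLinearModulus Ω p q) {z : EuclideanSpace ℝ (Fin d)}
    (hz : z ∈ Ω) : p z ≠ 0 := by
  obtain ⟨L, hL⟩ := h.exists_abs_div_sub_one_le_mul
  intro hpz
  have hη : (0 : ℝ) < (L + 1 : ℝ)⁻¹ := by positivity
  have hle := hL _ hη z hz z hz (by rw [sub_self, norm_zero]; exact hη.le)
  rw [hpz, div_zero, zero_sub, abs_neg, abs_one, ← div_eq_mul_inv,
    one_le_div (by positivity)] at hle
  linarith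

theorem HasLinearModulus.exists_abs_div_sub_one_le (h : HasLinearModulus Ω p q) :
    ∃ L : ℝ≥0, ∀ z ∈ Ω, ∀ z' ∈ Ω, |p z / p z' - 1| ≤ L * ‖z - z'‖ := by
  obtain ⟨L, hL⟩ := h.exists_abs_div_sub_one_le_mul
  refine ⟨L, fun z hz z' hz' => ?_⟩
  rcases eq_or_ne z z' with rfl | hne
  · simp [div_self (h.ne_zero hz)]
  · exact hL _ (norm_pos_iff.2 (sub_ne_zero.2 hne)) z hz z' hz' le_rfl

theorem HasLinearModulus.exists_lipschitzOnWith_log (h : HasLinearModulus Ω p q) :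
    ∃ L, LipschitzOnWith L (fun x => Real.log (p x)) Ω := by
  obtain ⟨L, hL⟩ := h.exists_abs_div_sub_one_le
  refine ⟨L, LipschitzOnWith.of_le_add_mul L fun z hz z' hz' => sub_le_iff_le_add'.1 ?_⟩
  rw [← Real.log_div (h.ne_zero hz) (h.ne_zero hz'), dist_eq_norm, ← Real.log_abs]
  calc Real.log |p z / p z'|
      ≤ |p z / p z'| - 1 := Real.log_le_sub_one_of_pos
        (abs_pos.2 (div_ne_zero (h.ne_zero hz) (h.ne_zero hz')))
    _ ≤ |p z / p z' - 1| := by simpa using abs_sub_abs_le_abs_sub (p z / p z') 1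
    _ ≤ L * ‖z - z'‖ := hL z hz z' hz'

theorem HasLinearModulus.exists_abs_sub_le (h : HasLinearModulus Ω p q) :
    ∃ L : ℝ≥0, ∀ z ∈ Ω, ∀ z' ∈ Ω, |p z - p z'| ≤ L * |p z'| * ‖z - z'‖ := by
  obtain ⟨L, hL⟩ := h.exists_abs_div_sub_one_le
  refine ⟨L, fun z hz z' hz' => ?_⟩
  have hz0 := h.ne_zero hz'
  calc |p z - p z'| = |p z / p z' - 1| * |p z'| := by
        rw [← abs_mul, sub_mul, one_mul, div_mul_cancel₀ _ hz0]
    _ ≤ L * ‖z - z'‖ * |p z'| := by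
        gcongr
        exact hL z hz z' hz'
    _ = L * |p z'| * ‖z - z'‖ := by ring

theorem HasLinearModulus.exists_pos_le_abs_le (h : HasLinearModulus Ω p q)
    (hD : ∀ x ∈ Ω, ∀ y ∈ Ω, ‖x - y‖ ≤ D) (hne : Ω.Nonempty) :
    ∃ m > 0, ∃ M, ∀ z ∈ Ω, m ≤ |p z| ∧ |p z| ≤ M := by
  obtain ⟨L, hL⟩ := h.exists_abs_sub_le
  obtain ⟨w, hw⟩ := hne
  have hD0 : 0 ≤ D := (norm_nonneg _).trans (hD w hw w hw)
  have hle (z : EuclideanSpace ℝ (Fin d)) (hz : z ∈ Ω) (z' : EuclideanSpace ℝ (Fin d))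
      (hz' : z' ∈ Ω) : |p z| ≤ (1 + L * D) * |p z'| := calc
    |p z| ≤ |p z - p z'| + |p z'| := by simpa using abs_add_le (p z - p z') (p z')
    _ ≤ L * |p z'| * D + |p z'| := by
        gcongr
        exact (hL z hz z' hz').trans (by gcongr; exact hD z hz z' hz')
    _ = (1 + L * D) * |p z'| := by ring
  have hw0 : 0 < |p w| := abs_pos.2 (h.ne_zero hw)
  refine ⟨|p w| / (1 + L * D), by positivity, (1 + L * D) * |p w|, fun z hz =>
    ⟨(div_le_iff₀' (by positivity)).2 (hle w hw z hz), hle z hz w hw⟩⟩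

/-- `|p|` on `Ω`, extended by zero. For a function `p` on `Ω` with a linear modulus, this is a
Borel measurable and positive function that can replace `p` in the velocity. -/
noncomputable def absOn (Ω : Set (EuclideanSpace ℝ (Fin d))) (p : EuclideanSpace ℝ (Fin d) → ℝ) :
    EuclideanSpace ℝ (Fin d) → ℝ :=
  Ω.indicator fun x => |p x|

theorem absOn_of_mem {x : EuclideanSpace ℝ (Fin d)} (hx : x ∈ Ω) : absOn Ω p x = |p x| :=
  indicator_of_mem hx _

theorem IsRegularOn.mono {m m' M M' : ℝ} (h : IsRegularOn p m M Ω) (hm' : 0 < m') (hm : m' ≤ m)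
    (hM : M ≤ M') : IsRegularOn p m' M' Ω :=
  ⟨h.measurable, hm', fun x hx => hm.trans (h.le x hx), h.isLipBoundedOn.mono hM⟩

theorem HasLinearModulus.exists_isLipBoundedOn (h : HasLinearModulus Ω p q)
    (hD : ∀ x ∈ Ω, ∀ y ∈ Ω, ‖x - y‖ ≤ D) (hne : Ω.Nonempty) : ∃ M, IsLipBoundedOn p M Ω := by
  obtain ⟨L, hL⟩ := h.exists_abs_sub_le
  obtain ⟨m, -, M, hM⟩ := h.exists_pos_le_abs_le hD hne
  refine ⟨max M (L * M), fun z hz => (hM z hz).2.trans (le_max_left _ _), fun z hz z' hz' =>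
    (hL z hz z' hz').trans ?_⟩
  gcongr
  exact (mul_le_mul_of_nonneg_left (hM z' hz').2 L.2).trans (le_max_right _ _)

theorem HasLinearModulus.exists_isRegularOn_absOn (h : HasLinearModulus Ω p q)
    (hΩc : IsClosed Ω) (hD : ∀ x ∈ Ω, ∀ y ∈ Ω, ‖x - y‖ ≤ D) (hne : Ω.Nonempty) :
    ∃ m M, IsRegularOn (absOn Ω p) m M Ω := by
  obtain ⟨m, hm, _, hmM⟩ := h.exists_pos_le_abs_le hD hne
  obtain ⟨M, hM⟩ := h.exists_isLipBoundedOn hD hne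
  have habs : IsLipBoundedOn (fun x => |p x|) M Ω :=
    ⟨fun z hz => (abs_abs (p z)).trans_le (hM.norm_le z hz), fun z hz z' hz' =>
      (abs_abs_sub_abs_le (p z) (p z')).trans (hM.norm_sub_le z hz z' hz')⟩
  refine ⟨m, M, ?_, hm, fun x hx => (hmM x hx).1.trans_eq (absOn_of_mem hx).symm,
    habs.congr fun x hx => absOn_of_mem hx⟩
  classical
  rw [absOn, ← piecewise_eq_indicator]
  exact habs.lipschitzOnWith.continuousOn.measurable_piecewise continuousOn_const
    hΩc.measurableSet

theorem HasLinearModulus.exists_isRegularOn_absOn_pair (h : HasLinearModulus Ω p q)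
    (hΩc : IsClosed Ω) (hD : ∀ x ∈ Ω, ∀ y ∈ Ω, ‖x - y‖ ≤ D) (hne : Ω.Nonempty) :
    ∃ m M, IsRegularOn (absOn Ω p) m M Ω ∧ IsRegularOn (absOn Ω q) m M Ω := by
  obtain ⟨m, M, hp⟩ := h.exists_isRegularOn_absOn hΩc hD hne
  obtain ⟨m', M', hq⟩ := h.symm.exists_isRegularOn_absOn hΩc hD hne
  have hpos := lt_min hp.pos hq.pos
  exact ⟨_, _, hp.mono hpos (min_le_left m m') (le_max_left M M'),
    hq.mono hpos (min_le_right m m') (le_max_right M M')⟩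

theorem HasLinearModulus.exists_absOn_eq_mul (h : HasLinearModulus Ω p q)
    (hΩ : IsPreconnected Ω) (hD : ∀ x ∈ Ω, ∀ y ∈ Ω, ‖x - y‖ ≤ D) (hne : Ω.Nonempty) :
    ∃ σ : ℝ, σ ≠ 0 ∧ ∀ x ∈ Ω, absOn Ω p x = σ * p x := by
  obtain ⟨M, hM⟩ := h.exists_isLipBoundedOn hD hne
  have hcont := hM.lipschitzOnWith.continuousOn
  rcases hΩ.eq_or_eq_neg_of_sq_eq hcont.abs hcont (fun x _ => sq_abs (p x))
    fun hx => h.ne_zero hx with heq | heq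
  · exact ⟨1, one_ne_zero, fun x hx => by rw [absOn_of_mem hx, one_mul]; exact heq hx⟩
  · exact ⟨-1, by norm_num, fun x hx => by rw [absOn_of_mem hx, neg_one_mul]; exact heq hx⟩

theorem velocity_eq_of_eq_mul {p' q' : EuclideanSpace ℝ (Fin d) → ℝ} {σ τ : ℝ}
    (hΩc : IsClosed Ω) (hσ : σ ≠ 0) (hτ : τ ≠ 0) (hp : ∀ x ∈ Ω, p' x = σ * p x)
    (hq : ∀ x ∈ Ω, q' x = τ * q x) : velocity Ω p' q' = velocity Ω p q := by
  funext t z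
  have hS := (isClosed_admissible hΩc (t := t) (z := z)).measurableSet
  have hmul : ∀ δ ∈ admissible Ω t z, p' (z - t • δ) * q' (z + (1 - t) • δ) =
      (σ * τ) * (p (z - t • δ) * q (z + (1 - t) • δ)) := fun δ hδ => by
    rw [hp _ hδ.1, hq _ hδ.2]
    ring
  rw [velocity, velocity, setIntegral_congr_fun hS hmul,
    setIntegral_congr_fun hS (g := fun δ => (σ * τ) • (p (z - t • δ) * q (z + (1 - t) • δ)) • δ)
      fun δ hδ => by rw [hmul δ hδ, mul_smul],
    integral_const_mul, integral_smul, smul_smul, mul_inv, mul_comm _ (σ * τ),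
    mul_inv_cancel_left₀ (mul_ne_zero hσ hτ)]

theorem HasLinearModulus.velocity_absOn (h : HasLinearModulus Ω p q) (hΩc : IsClosed Ω)
    (hΩ : IsPreconnected Ω) (hD : ∀ x ∈ Ω, ∀ y ∈ Ω, ‖x - y‖ ≤ D) (hne : Ω.Nonempty) :
    velocity Ω (absOn Ω p) (absOn Ω q) = velocity Ω p q := by
  obtain ⟨σ, hσ, hp⟩ := h.exists_absOn_eq_mul hΩ hD hne
  obtain ⟨τ, hτ, hq⟩ := h.symm.exists_absOn_eq_mul hΩ hD hne
  exact velocity_eq_of_eq_mul hΩc hσ hτ hp hq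

end Modulus

theorem IsLipBoundedOn.exp_sub_one {X : Type*} [SeminormedAddCommGroup X] {f : X → ℝ} {C : ℝ}
    {K : Set X} (hf : IsLipBoundedOn f C K) (hC : C ≤ 1 / 2) :
    IsLipBoundedOn (fun z => Real.exp (f z) - 1) (4 * C) K where
  norm_le z hz := by
    have hfz : |f z| ≤ C := hf.norm_le z hz
    have hexp : |Real.exp (f z) - 1| ≤ 2 * |f z| := Real.abs_exp_sub_one_le (by linarith)
    exact hexp.trans (by linarith [abs_nonneg (f z)])
  norm_sub_le z hz z' hz' := by
    have hfz : |f z| ≤ C := hf.norm_le z hz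
    have hfz' : |f z'| ≤ C := hf.norm_le z' hz'
    have hfactor : Real.exp (f z) - 1 - (Real.exp (f z') - 1) =
        Real.exp (f z') * (Real.exp (f z - f z') - 1) := by
      rw [mul_sub, ← Real.exp_add, add_sub_cancel, mul_one, sub_sub_sub_cancel_right]
    have hexp : Real.exp (f z') ≤ 2 := by
      have := le_of_abs_le (Real.abs_exp_sub_one_le (x := f z') (by linarith))
      linarith
    have hexp_sub : |Real.exp (f z - f z') - 1| ≤ 2 * |f z - f z'| :=
      Real.abs_exp_sub_one_le ((abs_sub _ _).trans (by linarith))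
    calc ‖Real.exp (f z) - 1 - (Real.exp (f z') - 1)‖
        = Real.exp (f z') * |Real.exp (f z - f z') - 1| := by
          rw [hfactor, Real.norm_eq_abs, abs_mul, Real.abs_exp]
      _ ≤ 2 * (2 * (C * ‖z - z'‖)) := by
          refine mul_le_mul hexp (hexp_sub.trans ?_) (abs_nonneg _) zero_le_two
          gcongr
          exact hf.norm_sub_le z hz z' hz'
      _ = 4 * C * ‖z - z'‖ := by ring

theorem absLogRatio_le_coe_iff {a b : ℝ} {κ : ℝ≥0} :
    absLogRatio a b ≤ κ ↔ 0 < a ∧ |Real.log (a / b)| ≤ κ := by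
  unfold absLogRatio
  split_ifs with ha
  · simp [ha, ENNReal.ofReal_le_coe]
  · simp [ha]

section Errors

variable {d : ℕ} {Ω : Set (EuclideanSpace ℝ (Fin d))}
  {p₀ p₁ q₀ q₁ : EuclideanSpace ℝ (Fin d) → ℝ} {κ : ℝ≥0} {m M ρ : ℝ}

theorem logRatioError_comm : logRatioError Ω p₀ p₁ q₀ q₁ = logRatioError Ω p₁ p₀ q₁ q₀ := by
  simp only [logRatioError, max_comm]

theorem scoreError_comm : scoreError Ω p₀ p₁ q₀ q₁ = scoreError Ω p₁ p₀ q₁ q₀ := by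
  simp only [scoreError, max_comm]

theorem pos_and_abs_log_div_le_of_logRatioError_le (h : logRatioError Ω p₀ p₁ q₀ q₁ ≤ κ)
    {x : EuclideanSpace ℝ (Fin d)} (hx : x ∈ Ω) :
    0 < q₀ x ∧ |Real.log (q₀ x / p₀ x)| ≤ κ :=
  absLogRatio_le_coe_iff.1 ((le_max_left _ _).trans (iSup₂_le_iff.1 h x hx))

theorem ae_norm_gradient_log_sub_le_of_scoreError_le (h : scoreError Ω p₀ p₁ q₀ q₁ ≤ κ) :
    ∀ᵐ x, x ∈ interior Ω →
      ‖gradient (fun y => Real.log (q₀ y)) x - gradient (fun y => Real.log (p₀ y)) x‖ ≤ κ := by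
  refine (ae_restrict_iff' isOpen_interior.measurableSet).1 ?_
  filter_upwards [ENNReal.ae_le_essSup _] with x hx
  exact enorm_le_coe.1 ((le_max_left _ _).trans (hx.trans h))

theorem HasLinearModulus.isLipBoundedOn_log_sub_log (hΩc : IsClosed Ω) (hΩ : Convex ℝ Ω)
    (hne : (interior Ω).Nonempty) (hp : HasLinearModulus Ω p₀ p₁) (hq : HasLinearModulus Ω q₀ q₁)
    (hr : logRatioError Ω p₀ p₁ q₀ q₁ ≤ κ) (hs : scoreError Ω p₀ p₁ q₀ q₁ ≤ κ) :
    IsLipBoundedOn (fun x => Real.log (q₀ x) - Real.log (p₀ x)) κ Ω := by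
  obtain ⟨Lp, hLp⟩ := hp.exists_lipschitzOnWith_log
  obtain ⟨Lq, hLq⟩ := hq.exists_lipschitzOnWith_log
  have hderiv : ∀ᵐ x, x ∈ interior Ω →
      ‖fderiv ℝ (fun x => Real.log (q₀ x) - Real.log (p₀ x)) x‖ ≤ κ := by
    filter_upwards [ae_differentiableAt_of_lipschitzOnWith (μ := volume) hLp,
      ae_differentiableAt_of_lipschitzOnWith (μ := volume) hLq,
      ae_norm_gradient_log_sub_le_of_scoreError_le hs] with x hpx hqx hx hxi
    rw [fderiv_fun_sub (hqx hxi) (hpx hxi), ← toDual_gradient, ← toDual_gradient, ← map_sub,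
      LinearIsometryEquiv.norm_map]
    exact hx hxi
  have hlip := lipschitzOnWith_of_ae_norm_fderiv_le hΩc hΩ hne (hLq.sub hLp) hderiv
  refine ⟨fun x hx => ?_, fun x hx y hy => hlip.norm_sub_le hx hy⟩
  rw [← Real.log_div (hq.ne_zero hx) (hp.ne_zero hx)]
  exact (pos_and_abs_log_div_le_of_logRatioError_le hr hx).2

theorem IsRegularOn.isChordKernel_mul_sub_mul (hp₀ : IsRegularOn p₀ m M Ω)
    (hp₁ : IsRegularOn p₁ m M Ω) (hq₀m : Measurable q₀) (hq₁m : Measurable q₁)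
    (hq₀ : ∀ x ∈ Ω, 0 < q₀ x) (hq₁ : ∀ x ∈ Ω, 0 < q₁ x) {κ : ℝ} (hκ : κ ≤ 1 / 4)
    (h₀ : IsLipBoundedOn (fun x => Real.log (q₀ x) - Real.log (p₀ x)) κ Ω)
    (h₁ : IsLipBoundedOn (fun x => Real.log (q₁ x) - Real.log (p₁ x)) κ Ω) :
    IsChordKernel Ω (fun x y => q₀ x * q₁ y - p₀ x * p₁ y) (32 * (M * M) * κ) where
  measurable := ((hq₀m.comp measurable_fst).mul (hq₁m.comp measurable_snd)).sub
    (hp₀.isChordKernel hp₁).measurable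
  isLipBoundedOn e := by
    have hlog := (h₀.mono_set (inter_subset_left (t := {x | x + e ∈ Ω}))).add
      ((h₁.comp_add_right e).mono_set inter_subset_right)
    have hexp := ((hp₀.isChordKernel hp₁).isLipBoundedOn e).smul
      (hlog.exp_sub_one (by linarith))
    refine (hexp.congr ?_).mono (by linarith)
    rintro x ⟨hx, hxe⟩
    have hx₀ := hp₀.pos.trans_le (hp₀.le x hx)
    have hx₁ := hp₁.pos.trans_le (hp₁.le _ hxe)
    simp only [smul_eq_mul, Real.exp_add, Real.exp_sub, Real.exp_log (hq₀ x hx),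
      Real.exp_log (hq₁ _ hxe), Real.exp_log hx₀, Real.exp_log hx₁]
    field_simp

theorem HasLinearModulus.exists_isLipBoundedOn_velocity_sub (hΩK : IsCompact Ω)
    (hΩ : Convex ℝ Ω) (hne : (interior Ω).Nonempty) (hp : HasLinearModulus Ω p₀ p₁)
    (hp₀ : ∀ x ∈ Ω, 0 < p₀ x) (hp₁ : ∀ x ∈ Ω, 0 < p₁ x) (hρ : 0 < ρ) :
    ∃ C : ℝ, ∃ κ₀ > (0 : ℝ), ∀ κ : ℝ≥0, κ ≤ κ₀ → ∀ q₀ q₁ : EuclideanSpace ℝ (Fin d) → ℝ,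
      HasLinearModulus Ω q₀ q₁ → logRatioError Ω p₀ p₁ q₀ q₁ ≤ κ →
      scoreError Ω p₀ p₁ q₀ q₁ ≤ κ → ∀ t ∈ Icc (0 : ℝ) 1,
      IsLipBoundedOn (fun z => velocity Ω q₀ q₁ t z - velocity Ω p₀ p₁ t z) (C * κ)
        (core Ω ρ) := by
  have hD : ∀ x ∈ Ω, ∀ y ∈ Ω, ‖x - y‖ ≤ Metric.diam Ω := fun x hx y hy =>
    (dist_eq_norm x y).symm.trans_le (Metric.dist_le_diam_of_mem hΩK.isBounded hx hy)
  have hΩne := hne.mono interior_subset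
  have habs {r : EuclideanSpace ℝ (Fin d) → ℝ} (hr : ∀ x ∈ Ω, 0 < r x) : EqOn (absOn Ω r) r Ω :=
    fun x hx => (absOn_of_mem hx).trans (abs_of_pos (hr x hx))
  obtain ⟨m, M, hpm₀, hpm₁⟩ := hp.exists_isRegularOn_absOn_pair hΩK.isClosed hD hΩne
  obtain ⟨C, κ₀, hκ₀, hC⟩ := RectifiedFlow.exists_isLipBoundedOn_velocity_sub hΩK.isClosed hΩ hD
    Metric.diam_nonneg hpm₀ hpm₁ hρ
  set A := 32 * (M * M)
  have hA : 0 ≤ A := mul_nonneg (by norm_num) (mul_self_nonneg M)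
  refine ⟨C * A, min (1 / 4) (κ₀ / (A + 1)), by positivity, fun κ hκ q₀ q₁ hq hr hs t ht => ?_⟩
  obtain ⟨hκ4, hκA⟩ := le_min_iff.1 hκ
  have hr' := logRatioError_comm.trans_le hr
  have hq₀ x (hx : x ∈ Ω) := (pos_and_abs_log_div_le_of_logRatioError_le hr hx).1
  have hq₁ x (hx : x ∈ Ω) := (pos_and_abs_log_div_le_of_logRatioError_le hr' hx).1
  have h₀ := hp.isLipBoundedOn_log_sub_log hΩK.isClosed hΩ hne hq hr hs
  have h₁ := hp.symm.isLipBoundedOn_log_sub_log hΩK.isClosed hΩ hne hq.symm hr'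
    (scoreError_comm.trans_le hs)
  obtain ⟨_, _, hqm₀, hqm₁⟩ := hq.exists_isRegularOn_absOn_pair hΩK.isClosed hD hΩne
  have hker := hpm₀.isChordKernel_mul_sub_mul hpm₁ hqm₀.measurable hqm₁.measurable
    (fun x hx => (habs hq₀ hx).symm ▸ hq₀ x hx) (fun x hx => (habs hq₁ hx).symm ▸ hq₁ x hx) hκ4
    (h₀.congr fun x hx => by rw [habs hq₀ hx, habs hp₀ hx])
    (h₁.congr fun x hx => by rw [habs hq₁ hx, habs hp₁ hx])
  have hAκ : A * κ ≤ κ₀ := calc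
    A * κ ≤ (A + 1) * κ := by gcongr; exact (lt_add_one A).le
    _ ≤ κ₀ := (le_div_iff₀' (by positivity)).1 hκA
  have hvel := hC (A * κ) ⟨by positivity, hAκ⟩ _ _ hker t ht
  rwa [hq.velocity_absOn hΩK.isClosed hΩ.isPreconnected hD hΩne,
    hp.velocity_absOn hΩK.isClosed hΩ.isPreconnected hD hΩne, ← mul_assoc] at hvel

end Errors

theorem aestronglyMeasurable_clm_of_apply {α E F : Type*} [MeasurableSpace α] {μ : Measure α}
    [NormedAddCommGroup E] [NormedSpace ℝ E] [FiniteDimensional ℝ E] [NormedAddCommGroup F]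
    [NormedSpace ℝ F] {b : α → E →L[ℝ] F}
    (h : ∀ e, AEStronglyMeasurable (fun s => b s e) μ) : AEStronglyMeasurable b μ := by
  let e := Module.finBasis ℝ E
  have hb : b = fun s => ∑ i, ContinuousLinearMap.smulRightL ℝ E F
      (LinearMap.toContinuousLinearMap (e.coord i)) (b s (e i)) := by
    funext s
    ext x
    conv_lhs => rw [← e.sum_repr x, map_sum]
    simp [_root_.sum_apply]
  rw [hb]
  exact Finset.aestronglyMeasurable_fun_sum _ fun i _ =>
    (ContinuousLinearMap.continuous _).comp_aestronglyMeasurable (h _)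

/-- `y` is a trajectory of the field `v` on `[0,1]` along which `v` is Lipschitz on balls of radius
`ρ` and, at almost every time, differentiable with derivative `b`. -/
structure IsDifferentiableTrajectory {E : Type*} [NormedAddCommGroup E] [NormedSpace ℝ E]
    [MeasurableSpace E] (v : ℝ → E → E) (b : ℝ → E →L[ℝ] E) (y : ℝ → E) (C : ℝ≥0) (ρ : ℝ) :
    Prop where
  pos : 0 < ρ
  stronglyMeasurable : StronglyMeasurable fun w : ℝ × E => v w.1 w.2
  isPrimitiveOn : IsPrimitiveOn 1 y fun s => v s (y s)
  lipschitzOnWith : ∀ s ∈ Icc (0 : ℝ) 1, LipschitzOnWith C (v s) (Metric.closedBall (y s) ρ)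
  hasFDerivAt : ∀ᵐ s ∂volume.restrict (Icc (0 : ℝ) 1), HasFDerivAt (v s) (b s) (y s)
  norm_le : ∀ s ∈ Icc (0 : ℝ) 1, ‖b s‖ ≤ C

/-- The error at `h` of the linearization of `v s` at the point `y s` with derivative `b s`. -/
def linearizationError {E : Type*} [NormedAddCommGroup E] [NormedSpace ℝ E] (v : ℝ → E → E)
    (b : ℝ → E →L[ℝ] E) (y : ℝ → E) (s : ℝ) (h : E) : E :=
  v s (y s + h) - v s (y s) - b s h

namespace IsDifferentiableTrajectory

variable {E : Type*} [NormedAddCommGroup E] [NormedSpace ℝ E] [MeasurableSpace E]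
  {v v' : ℝ → E → E} {b : ℝ → E →L[ℝ] E} {y y' w D : ℝ → E} {C : ℝ≥0} {ρ κ ε S T : ℝ}

theorem of_fderiv (hρ : 0 < ρ) (hv : StronglyMeasurable fun w : ℝ × E => v w.1 w.2)
    (hy : IsPrimitiveOn 1 y fun s => v s (y s))
    (hC : ∀ s ∈ Icc (0 : ℝ) 1, LipschitzOnWith C (v s) (Metric.closedBall (y s) ρ))
    (hd : ∀ᵐ s ∂volume.restrict (Icc (0 : ℝ) 1), DifferentiableAt ℝ (v s) (y s)) :
    IsDifferentiableTrajectory v (fun s => fderiv ℝ (v s) (y s)) y C ρ :=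
  ⟨hρ, hv, hy, hC, hd.mono fun _ hs => hs.hasFDerivAt, fun s hs =>
    norm_fderiv_le_of_lipschitzOn ℝ (Metric.closedBall_mem_nhds _ hρ) (hC s hs)⟩

theorem norm_linearizationError_le (h : IsDifferentiableTrajectory v b y C ρ) {s : ℝ}
    (hs : s ∈ Icc (0 : ℝ) 1) {e : E} (he : ‖e‖ ≤ ρ) :
    ‖linearizationError v b y s e‖ ≤ 2 * C * ‖e‖ := by
  have hv := (h.lipschitzOnWith s hs).norm_sub_le (x := y s + e) (y := y s)
    (by simpa using he) (Metric.mem_closedBall_self h.pos.le)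
  rw [add_sub_cancel_left] at hv
  refine (norm_sub_le_of_le hv ((b s).le_of_opNorm_le (h.norm_le s hs) e)).trans_eq ?_
  ring

theorem norm_sub_le_of_forall_norm_sub_le (h : IsDifferentiableTrajectory v b y C ρ)
    (hκ : 0 ≤ κ) (hv' : ∀ s ∈ Icc (0 : ℝ) 1, ∀ z ∈ Metric.closedBall (y s) ρ,
      ‖v' s z - v s z‖ ≤ κ)
    (hy' : IsPrimitiveOn 1 y' fun s => v' s (y' s)) (h0 : y' 0 = y 0) (hT : T ∈ Icc (0 : ℝ) 1)
    (hρ : ∀ t ∈ Icc 0 T, ‖y' t - y t‖ ≤ ρ) :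
    ∀ t ∈ Icc 0 T, ‖y' t - y t‖ ≤ κ * Real.exp C := by
  intro t ht
  have hexp := ((hy'.sub h.isPrimitiveOn).mono hT).norm_le_mul_exp C.2
    (intervalIntegrable_const (c := κ)) (fun _ _ => hκ) (fun s hs => ?_) t ht
  · rw [h0, sub_self, norm_zero, zero_add, intervalIntegral.integral_const, sub_zero] at hexp
    refine hexp.trans (mul_le_mul (mul_le_of_le_one_left hκ hT.2) ?_ (Real.exp_pos _).le hκ)
    exact Real.exp_le_exp.2 (mul_le_of_le_one_right C.2 (ht.2.trans hT.2))
  · have hs1 : s ∈ Icc (0 : ℝ) 1 := ⟨hs.1, hs.2.trans hT.2⟩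
    have hmem : y' s ∈ Metric.closedBall (y s) ρ := mem_closedBall_iff_norm.2 (hρ s hs)
    rw [← sub_add_sub_cancel _ (v s (y' s))]
    exact norm_add_le_of_le (hv' s hs1 _ hmem)
      ((h.lipschitzOnWith s hs1).norm_sub_le hmem (Metric.mem_closedBall_self h.pos.le))

theorem norm_sub_le (h : IsDifferentiableTrajectory v b y C ρ) (hκ : 0 ≤ κ)
    (hv' : ∀ s ∈ Icc (0 : ℝ) 1, ∀ z ∈ Metric.closedBall (y s) ρ, ‖v' s z - v s z‖ ≤ κ)
    (hy' : IsPrimitiveOn 1 y' fun s => v' s (y' s)) (h0 : y' 0 = y 0)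
    (hκρ : κ * Real.exp C < ρ) : ∀ t ∈ Icc (0 : ℝ) 1, ‖y' t - y t‖ ≤ κ * Real.exp C := by
  have hmem : ∀ t ∈ Icc (0 : ℝ) 1, y' t - y t ∈ Metric.closedBall 0 ρ := by
    refine forall_mem_of_bootstrap (hy'.continuousOn.sub h.isPrimitiveOn.continuousOn)
      Metric.isClosed_closedBall (by simp [h0, h.pos.le]) fun τ hτ hin => ?_
    refine Metric.closedBall_mem_nhds_of_mem (mem_ball_zero_iff.2 (lt_of_le_of_lt ?_ hκρ))
    exact h.norm_sub_le_of_forall_norm_sub_le hκ hv' hy' h0 ⟨hτ.1, hτ.2.le⟩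
      (fun t ht => mem_closedBall_zero_iff.1 (hin t ht)) τ ⟨hτ.1, le_rfl⟩
  exact h.norm_sub_le_of_forall_norm_sub_le hκ hv' hy' h0 (right_mem_Icc.2 zero_le_one)
    fun t ht => mem_closedBall_zero_iff.1 (hmem t ht)

variable [BorelSpace E]

theorem aestronglyMeasurable_derivative [FiniteDimensional ℝ E]
    (h : IsDifferentiableTrajectory v b y C ρ) :
    AEStronglyMeasurable b (volume.restrict (Icc 0 1)) := by
  have hy := h.isPrimitiveOn.continuousOn
  refine aestronglyMeasurable_clm_of_apply fun e => aestronglyMeasurable_of_tendsto_ae atTop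
    (f := fun (n : ℕ) s => (n : ℝ) • (v s (y s + (n : ℝ)⁻¹ • e) - v s (y s))) (fun n => ?_) ?_
  · exact ((aestronglyMeasurable_apply_of_continuousOn h.stronglyMeasurable measurableSet_Icc
      (hy.add continuousOn_const)).sub (aestronglyMeasurable_apply_of_continuousOn
      h.stronglyMeasurable measurableSet_Icc hy)).const_smul (n : ℝ)
  · filter_upwards [h.hasFDerivAt] with s hs
    exact hs.lim e (by simpa using tendsto_natCast_atTop_atTop (R := ℝ))

theorem aestronglyMeasurable_linearizationError [FiniteDimensional ℝ E]
    (h : IsDifferentiableTrajectory v b y C ρ) (hD : ContinuousOn D (Icc 0 1)) :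
    AEStronglyMeasurable (fun s => linearizationError v b y s (D s))
      (volume.restrict (Icc 0 1)) := by
  have hy := h.isPrimitiveOn.continuousOn
  exact ((aestronglyMeasurable_apply_of_continuousOn h.stronglyMeasurable measurableSet_Icc
    (hy.add hD)).sub (aestronglyMeasurable_apply_of_continuousOn h.stronglyMeasurable
    measurableSet_Icc hy)).sub ((ContinuousLinearMap.id ℝ (E →L[ℝ] E)).aestronglyMeasurable_comp₂
    h.aestronglyMeasurable_derivative (hD.aestronglyMeasurable measurableSet_Icc))

theorem tendsto_integral_linearizationError_div [FiniteDimensional ℝ E]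
    (h : IsDifferentiableTrajectory v b y C ρ) {D : ℕ → ℝ → E} {N : ℕ → ℝ}
    (hN : Tendsto N atTop (𝓝 0)) (hNρ : ∀ n, N n ≤ ρ) (hD : ∀ n, ContinuousOn (D n) (Icc 0 1))
    (hDN : ∀ n, ∀ s ∈ Icc (0 : ℝ) 1, ‖D n s‖ ≤ N n) :
    Tendsto (fun n => ∫ s in (0 : ℝ)..1, ‖linearizationError v b y s (D n s)‖ / N n) atTop
      (𝓝 0) := by
  have hN0 n : 0 ≤ N n := (norm_nonneg _).trans (hDN n 0 (left_mem_Icc.2 zero_le_one))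
  simp_rw [intervalIntegral.integral_of_le zero_le_one, ← integral_Icc_eq_integral_Ioc]
  rw [show 𝓝 (0 : ℝ) = 𝓝 (∫ _ in Icc (0 : ℝ) 1, (0 : ℝ)) by rw [integral_zero]]
  refine tendsto_integral_of_dominated_convergence (fun _ => 2 * C)
    (fun n => (((h.aestronglyMeasurable_linearizationError (hD n)).norm.aemeasurable).div_const
      _).aestronglyMeasurable)
    (integrable_const _)
    (fun n => ae_restrict_of_forall_mem measurableSet_Icc fun s hs => ?_) ?_
  · rw [norm_div, norm_norm, Real.norm_of_nonneg (hN0 n)]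
    refine div_le_of_le_mul₀ (hN0 n) (by positivity)
      ((h.norm_linearizationError_le hs ((hDN n s hs).trans (hNρ n))).trans ?_)
    gcongr
    exact hDN n s hs
  · filter_upwards [h.hasFDerivAt, ae_restrict_mem measurableSet_Icc] with s hs hs01
    have hDs : Tendsto (fun n => D n s) atTop (𝓝 0) :=
      squeeze_zero_norm (fun n => hDN n s hs01) hN
    have hDO : (fun n => D n s) =O[atTop] N := Asymptotics.IsBigO.of_norm_le fun n => hDN n s hs01
    exact (((hasFDerivAt_iff_isLittleO_nhds_zero.1 hs).comp_tendsto hDs).norm_left.trans_isBigO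
      hDO).tendsto_div_nhds_zero

/-- Although `v s` is differentiable at `y s` with a rate that depends on `s`, the linearization is
uniform in the mean: by dominated convergence, as `v` is Lipschitz. -/
theorem exists_integral_linearizationError_le [FiniteDimensional ℝ E]
    (h : IsDifferentiableTrajectory v b y C ρ) (hε : 0 < ε) :
    ∃ η ∈ Ioc 0 ρ, ∀ (D : ℝ → E) (N : ℝ), ContinuousOn D (Icc 0 1) →
      (∀ s ∈ Icc (0 : ℝ) 1, ‖D s‖ ≤ N) → N ≤ η →
      ∫ s in (0 : ℝ)..1, ‖linearizationError v b y s (D s)‖ ≤ ε * N := by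
  by_contra! hcon
  have hη (n : ℕ) : ρ / (n + 1) ∈ Ioc 0 ρ :=
    ⟨div_pos h.pos (by positivity), div_le_self h.pos.le (by simp)⟩
  choose D N hD hDN hNη hlt using fun n : ℕ => hcon _ (hη n)
  have h0 : (0 : ℝ) ∈ Icc 0 1 := left_mem_Icc.2 zero_le_one
  have hN0 n : 0 ≤ N n := (norm_nonneg _).trans (hDN n 0 h0)
  have hNρ n : N n ≤ ρ := (hNη n).trans (hη n).2
  have hN : Tendsto N atTop (𝓝 0) := squeeze_zero hN0 hNη (by
    simpa [div_eq_mul_inv] using tendsto_one_div_add_atTop_nhds_zero_nat.const_mul ρ)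
  obtain ⟨n, hn⟩ :=
    ((h.tendsto_integral_linearizationError_div hN hNρ hD hDN).eventually_lt_const hε).exists
  rw [intervalIntegral.integral_div] at hn
  have hNn : 0 < N n := (hN0 n).lt_of_ne' fun hzero => by
    have hDn : ∀ s ∈ uIcc (0 : ℝ) 1, ‖linearizationError v b y s (D n s)‖ = 0 := fun s hs => by
      rw [uIcc_of_le zero_le_one] at hs
      have hDs : D n s = 0 := norm_le_zero_iff.1 ((hDN n s hs).trans_eq hzero)
      simp [linearizationError, hDs]
    simpa [hzero, intervalIntegral.integral_congr hDn] using hlt n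
  exact lt_asymm (hlt n) ((div_lt_iff₀ hNn).1 hn)

theorem norm_sub_sub_le [FiniteDimensional ℝ E] (h : IsDifferentiableTrajectory v b y C ρ)
    (hv' : ∀ t ∈ Icc (0 : ℝ) 1,
      IsLipBoundedOn (fun z => v' t z - v t z) κ (Metric.closedBall (y t) ρ))
    (hy' : IsPrimitiveOn 1 y' fun s => v' s (y' s)) (h0 : y' 0 = y 0)
    (hw : IsPrimitiveOn 1 w fun s => v' s (y s) - v s (y s) + b s (w s)) (hw0 : w 0 = 0)
    {N : ℝ} (hN : ∀ t ∈ Icc (0 : ℝ) 1, ‖y' t - y t‖ ≤ N) (hNρ : N ≤ ρ) :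
    ∀ t ∈ Icc (0 : ℝ) 1, ‖y' t - y t - w t‖ ≤
      (κ * N + ∫ s in (0 : ℝ)..1, ‖linearizationError v b y s (y' s - y s)‖) * Real.exp C := by
  have h01 : (0 : ℝ) ∈ Icc 0 1 := left_mem_Icc.2 zero_le_one
  have hN0 : 0 ≤ N := (norm_nonneg _).trans (hN 0 h01)
  have hself t : y t ∈ Metric.closedBall (y t) ρ := Metric.mem_closedBall_self h.pos.le
  have hκ : 0 ≤ κ := (hv' 0 h01).nonneg ⟨_, hself 0⟩
  have hD := hy'.sub h.isPrimitiveOn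
  have herr : IntervalIntegrable (fun s => ‖linearizationError v b y s (y' s - y s)‖) volume 0 1 :=
    intervalIntegrable_of_norm_le (C := 2 * C * N) zero_le_one
      (h.aestronglyMeasurable_linearizationError hD.continuousOn).norm fun s hs => by
        rw [norm_norm]
        refine (h.norm_linearizationError_le hs ((hN s hs).trans hNρ)).trans ?_
        gcongr
        exact hN s hs
  -- The derivative of `y' - y - w` is `[(v' - v)(y') - (v' - v)(y)] + error + b (y' - y - w)`.
  have hgronwall := (hD.sub hw).norm_le_mul_exp C.2
    ((intervalIntegrable_const (c := κ * N)).add herr) (fun _ _ => by positivity) fun s hs => by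
      have hb := (b s).le_of_opNorm_le (h.norm_le s hs) (y' s - y s - w s)
      have hvs := (hv' s hs).norm_sub_le (y' s)
        (mem_closedBall_iff_norm.2 ((hN s hs).trans hNρ)) (y s) (hself s)
      refine (congrArg norm ?_).trans_le (norm_add_le_of_le (norm_add_le_of_le
        (hvs.trans (mul_le_mul_of_nonneg_left (hN s hs) hκ)) le_rfl) hb)
      simp only [linearizationError, map_sub, add_sub_cancel]
      abel
  intro t ht
  refine (hgronwall t ht).trans (mul_le_mul (le_of_eq ?_) (Real.exp_le_exp.2
    (mul_le_of_le_one_right C.2 ht.2)) (Real.exp_pos _).le (add_nonneg (by positivity)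
    (intervalIntegral.integral_nonneg zero_le_one fun _ _ => norm_nonneg _)))
  rw [h0, hw0, sub_self, sub_zero, norm_zero, zero_add,
    intervalIntegral.integral_add intervalIntegrable_const herr]
  simp

theorem exists_norm_sub_sub_le [FiniteDimensional ℝ E] (h : IsDifferentiableTrajectory v b y C ρ)
    (hε : 0 < ε) :
    ∃ κ > 0, ∀ (v' : ℝ → E → E) (y' w : ℝ → E),
      (∀ t ∈ Icc (0 : ℝ) 1,
        IsLipBoundedOn (fun z => v' t z - v t z) κ (Metric.closedBall (y t) ρ)) →
      IsPrimitiveOn 1 y' (fun s => v' s (y' s)) → y' 0 = y 0 →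
      IsPrimitiveOn 1 w (fun s => v' s (y s) - v s (y s) + b s (w s)) → w 0 = 0 →
      ∀ S, (∀ t ∈ Icc (0 : ℝ) 1, ‖w t‖ ≤ S) →
        ∀ t ∈ Icc (0 : ℝ) 1, ‖y' t - y t - w t‖ ≤ ε * S := by
  have hexp := Real.exp_pos C
  obtain ⟨θ, hθ, hθε⟩ : ∃ θ > 0, θ = min (1 / 2) (ε / 2) := ⟨_, by positivity, rfl⟩
  obtain ⟨η, ⟨hη, hηρ⟩, herr⟩ :=
    h.exists_integral_linearizationError_le (ε := θ / (2 * Real.exp C)) (by positivity)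
  obtain ⟨κ, hκ, hκmin⟩ : ∃ κ > 0, κ = min (η / 2) (θ / 2) / Real.exp C :=
    ⟨_, by positivity, rfl⟩
  have hκexp : κ * Real.exp C = min (η / 2) (θ / 2) := by rw [hκmin, div_mul_cancel₀ _ hexp.ne']
  have hκη : κ * Real.exp C < η := hκexp.trans_lt ((min_le_left _ _).trans_lt (half_lt_self hη))
  refine ⟨κ, hκ, fun v' y' w hv' hy' h0 hw hw0 S hS => ?_⟩
  have hDcont := hy'.continuousOn.sub h.isPrimitiveOn.continuousOn
  obtain ⟨τ, hτ, hmax⟩ := isCompact_Icc.exists_isMaxOn (nonempty_Icc.2 zero_le_one) hDcont.norm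
  set N := ‖y' τ - y τ‖
  have hN : ∀ t ∈ Icc (0 : ℝ) 1, ‖y' t - y t‖ ≤ N := isMaxOn_iff.1 hmax
  have hNη : N ≤ η := (h.norm_sub_le hκ.le (fun s hs => (hv' s hs).norm_le) hy' h0
    (hκη.trans_le hηρ) τ hτ).trans hκη.le
  have hmain : ∀ t ∈ Icc (0 : ℝ) 1, ‖y' t - y t - w t‖ ≤ θ * N := fun t ht => by
    refine (h.norm_sub_sub_le hv' hy' h0 hw hw0 hN (hNη.trans hηρ) t ht).trans ?_
    calc _ ≤ (κ * N + θ / (2 * Real.exp C) * N) * Real.exp C := by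
          gcongr
          exact herr _ N hDcont hN hNη
      _ = (κ * Real.exp C + θ / 2) * N := by field_simp
      _ ≤ θ * N := by
          gcongr
          linarith [hκexp.trans_le (min_le_right _ _)]
  have hNS : N ≤ 2 * S := by
    have hθN : θ * N ≤ 1 / 2 * N := by
      gcongr
      exact hθε.trans_le (min_le_left _ _)
    linarith [norm_sub_norm_le (y' τ - y τ) (w τ), hmain τ hτ, hS τ hτ]
  intro t ht
  calc ‖y' t - y t - w t‖ ≤ θ * N := hmain t ht
    _ ≤ ε / 2 * (2 * S) := by
        gcongr
        exact hθε.trans_le (min_le_right _ _)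
    _ = ε * S := by ring

end IsDifferentiableTrajectory

section Trajectory

variable {d : ℕ} {Ω : Set (EuclideanSpace ℝ (Fin d))}
  {v v' : ℝ → EuclideanSpace ℝ (Fin d) → EuclideanSpace ℝ (Fin d)} {x : EuclideanSpace ℝ (Fin d)}
  {y : ℝ → EuclideanSpace ℝ (Fin d)} {p q p₀ p₁ : EuclideanSpace ℝ (Fin d) → ℝ} {D D' ρ ε : ℝ}

theorem isSolution_iff : IsSolution Ω v x y ↔
    y 0 = x ∧ (∀ t ∈ Ico (0 : ℝ) 1, y t ∈ interior Ω) ∧ IsPrimitiveOn 1 y fun s => v s (y s) := by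
  constructor
  · intro h
    have h0 : y 0 = x := by simpa using h.eq_integral 0 (by simp)
    exact ⟨h0, h.mem_interior, h.integrable, fun t ht => by rw [h0]; exact h.eq_integral t ht⟩
  · rintro ⟨rfl, hΩ, hy⟩
    exact ⟨hΩ, hy.intervalIntegrable, hy.eq_add_integral⟩

theorem IsSolution.apply_zero (h : IsSolution Ω v x y) : y 0 = x := (isSolution_iff.1 h).1

theorem IsSolution.isPrimitiveOn (h : IsSolution Ω v x y) :
    IsPrimitiveOn 1 y fun s => v s (y s) :=
  (isSolution_iff.1 h).2.2

theorem IsSolution.apply_one_mem (hΩc : IsClosed Ω) (h : IsSolution Ω v x y) : y 1 ∈ Ω := by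
  rw [← hΩc.closure_eq]
  refine ((h.isPrimitiveOn.continuousOn 1 (by simp)).mono Ico_subset_Icc_self).mem_closure ?_
    fun t ht => interior_subset (h.mem_interior t ht)
  simp [closure_Ico (zero_ne_one (α := ℝ))]

theorem IsSolution.exists_forall_mem_core (h : IsSolution Ω v x y) (h1 : y 1 ∈ interior Ω) :
    ∃ ρ > 0, ∀ t ∈ Icc (0 : ℝ) 1, y t ∈ core Ω ρ := by
  have hmem : ∀ t ∈ Icc (0 : ℝ) 1, y t ∈ interior Ω := fun t ht => by
    rcases ht.2.eq_or_lt with rfl | ht1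
    · exact h1
    · exact h.mem_interior t ⟨ht.1, ht1⟩
  obtain ⟨ρ, hρ, hK⟩ := exists_subset_core
    (isCompact_Icc.image_of_continuousOn h.isPrimitiveOn.continuousOn) (image_subset_iff.2 hmem)
  exact ⟨ρ, hρ, fun t ht => hK (mem_image_of_mem _ ht)⟩

theorem isSolution_flow (h : ∃ y, IsSolution Ω v x y) :
    IsSolution Ω v x (fun t => flow Ω v t x) := by
  simp only [flow, dif_pos h]
  exact h.choose_spec

theorem mem_interior_of_infDist_frontier_pos (hΩc : IsClosed Ω) (hx : x ∈ Ω)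
    (h : 0 < Metric.infDist x (frontier Ω)) : x ∈ interior Ω := by
  by_contra hxi
  have hfr : x ∈ frontier Ω := hΩc.frontier_eq ▸ ⟨hx, hxi⟩
  exact h.ne' (Metric.infDist_zero_of_mem hfr)

theorem E₁_subset_interior (hΩc : IsClosed Ω) : E₁ Ω ⊆ interior Ω := fun _ hx =>
  mem_interior_of_infDist_frontier_pos hΩc hx.1 hx.2

namespace IsInwardField

theorem isSolution_flow (h : IsInwardField Ω v D) (hΩc : IsClosed Ω) (hΩ : Convex ℝ Ω)
    (hx : x ∈ interior Ω) : IsSolution Ω v x (fun t => flow Ω v t x) :=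
  RectifiedFlow.isSolution_flow ((h.exists_isPrimitiveOn hΩc hΩ hx).imp fun _ => isSolution_iff.2)

theorem eqOn_flow (h : IsInwardField Ω v D) (hy : IsSolution Ω v x y) :
    EqOn y (fun t => flow Ω v t x) (Icc 0 1) := by
  have hflow := RectifiedFlow.isSolution_flow ⟨y, hy⟩
  exact h.eqOn le_rfl hy.isPrimitiveOn hflow.isPrimitiveOn
    (hy.apply_zero.trans hflow.apply_zero.symm) hy.mem_interior hflow.mem_interior

theorem exists_isDifferentiableTrajectory_flow (h : IsInwardField Ω v D) (hΩc : IsClosed Ω)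
    (hΩ : Convex ℝ Ω) (hx : x ∈ E₁ Ω ∩ E₂ Ω v ∩ E₄ Ω v) :
    ∃ C ρ, (∀ t ∈ Icc (0 : ℝ) 1, flow Ω v t x ∈ core Ω (ρ + ρ)) ∧ IsDifferentiableTrajectory v
      (fun s => fderiv ℝ (v s) (flow Ω v s x)) (fun t => flow Ω v t x) C ρ := by
  obtain ⟨⟨hx₁, -, hx₂⟩, -, hx₄⟩ := hx
  have hsol := h.isSolution_flow hΩc hΩ (E₁_subset_interior hΩc hx₁)
  obtain ⟨ρ', hρ', hcore⟩ := hsol.exists_forall_mem_core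
    (mem_interior_of_infDist_frontier_pos hΩc (hsol.apply_one_mem hΩc) hx₂)
  have hdiff : ∀ᵐ s ∂volume.restrict (Icc (0 : ℝ) 1),
      DifferentiableAt ℝ (v s) (flow Ω v s x) := by
    rw [ae_restrict_iff' measurableSet_Icc]
    filter_upwards [measure_eq_zero_iff_ae_notMem.1 hx₄] with s hs hs01
    by_contra hnot
    exact hs ⟨hs01, core_subset hρ'.le (hcore s hs01), hnot⟩
  obtain ⟨C, hC⟩ := h.exists_lipschitzOnWith (ρ' / 2) (half_pos hρ')
  rw [← add_halves ρ'] at hcore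
  refine ⟨C, ρ' / 2, hcore, .of_fderiv (half_pos hρ') h.stronglyMeasurable hsol.isPrimitiveOn
    (fun s hs => (hC s hs).mono fun z hz => ?_) hdiff⟩
  exact mem_core_of_norm_sub_le (hcore s hs) (mem_closedBall_iff_norm.1 hz)

theorem aestronglyMeasurable_sub_apply (h : IsInwardField Ω v D) (h' : IsInwardField Ω v' D')
    (hy : ContinuousOn y (Icc 0 1)) :
    AEStronglyMeasurable (fun s => v' s (y s) - v s (y s)) (volume.restrict (Icc 0 1)) :=
  (aestronglyMeasurable_apply_of_continuousOn h'.stronglyMeasurable measurableSet_Icc hy).sub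
    (aestronglyMeasurable_apply_of_continuousOn h.stronglyMeasurable measurableSet_Icc hy)

theorem norm_sub_apply_le (h : IsInwardField Ω v D) (h' : IsInwardField Ω v' D')
    (hyΩ : ∀ t ∈ Icc (0 : ℝ) 1, y t ∈ interior Ω) :
    ∀ s ∈ Icc (0 : ℝ) 1, ‖v' s (y s) - v s (y s)‖ ≤ D' + D := fun s hs =>
  norm_sub_le_of_le (h'.norm_le s hs _ (hyΩ s hs)) (h.norm_le s hs _ (hyΩ s hs))

end IsInwardField

theorem HasLinearModulus.isInwardField_velocity (h : HasLinearModulus Ω p q) (hΩK : IsCompact Ω)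
    (hΩ : Convex ℝ Ω) (hne : Ω.Nonempty) :
    IsInwardField Ω (velocity Ω p q) (Metric.diam Ω) := by
  have hD : ∀ x ∈ Ω, ∀ y ∈ Ω, ‖x - y‖ ≤ Metric.diam Ω := fun x hx y hy =>
    (dist_eq_norm x y).symm.trans_le (Metric.dist_le_diam_of_mem hΩK.isBounded hx hy)
  obtain ⟨m, M, hp, hq⟩ := h.exists_isRegularOn_absOn_pair hΩK.isClosed hD hne
  rw [← h.velocity_absOn hΩK.isClosed hΩ.isPreconnected hD hne]
  exact hp.isInwardField_velocity hΩK.isClosed hΩ hD Metric.diam_nonneg hq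

theorem IsDensityOn.pos (hp : IsDensityOn Ω p) : ∀ x ∈ Ω, 0 < p x := fun x hx => by
  obtain ⟨c, hc, hcp⟩ := hp.bounded_below
  exact hc.trans_le (hcp x hx)

section Volterra

variable {b Φ : ℝ → EuclideanSpace ℝ (Fin d) →L[ℝ] EuclideanSpace ℝ (Fin d)}
  {a w y' : ℝ → EuclideanSpace ℝ (Fin d)} {C : ℝ≥0} {M : ℝ}

theorem IsFundamentalSolution.volterraSolution_spec (hΦ : IsFundamentalSolution b Φ)
    (hbm : AEStronglyMeasurable b (volume.restrict (Icc 0 1)))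
    (hbC : ∀ s ∈ Icc (0 : ℝ) 1, ‖b s‖ ≤ C)
    (ham : AEStronglyMeasurable a (volume.restrict (Icc 0 1)))
    (haM : ∀ s ∈ Icc (0 : ℝ) 1, ‖a s‖ ≤ M) :
    IsVolterraSolution b a (volterraSolution b a) ∧
      (∀ w, IsVolterraSolution b a w → EqOn w (volterraSolution b a) (Icc 0 1)) ∧
      IntervalIntegrable (fun s => Ring.inverse (Φ s) (a s)) volume 0 1 ∧
      ∀ t ∈ Icc (0 : ℝ) 1,
        volterraSolution b a t = Φ t (∫ s in (0 : ℝ)..t, Ring.inverse (Φ s) (a s)) := by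
  have hunit := fun t ht => hΦ.isUnit hbm hbC (t := t) ht
  have hw := hΦ.isVolterraSolution hbC hunit ham haM
  have hvs := isVolterraSolution_volterraSolution ⟨_, hw⟩
  exact ⟨hvs, fun w hw' => hw'.eqOn hbC hvs, intervalIntegrable_ringInverse_apply zero_le_one
    hΦ.isPrimitiveOn.continuousOn hunit ham haM, hvs.eqOn hbC hw⟩

theorem iSup_enorm_le_ofReal_mul_iSup_enorm {α E F : Type*} [TopologicalSpace α]
    [SeminormedAddCommGroup E] [SeminormedAddCommGroup F] {s : Set α} (hs : IsCompact s)
    {u : α → E} {w : α → F} (hw : ContinuousOn w s) (hε : 0 ≤ ε)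
    (h : ∀ S, (∀ t ∈ s, ‖w t‖ ≤ S) → ∀ t ∈ s, ‖u t‖ ≤ ε * S) :
    ⨆ t ∈ s, ‖u t‖ₑ ≤ ENNReal.ofReal ε * ⨆ t ∈ s, ‖w t‖ₑ := by
  refine iSup₂_le fun t ht => ?_
  obtain ⟨τ, hτ, hmax⟩ := hs.exists_isMaxOn ⟨t, ht⟩ hw.norm
  calc ‖u t‖ₑ ≤ ENNReal.ofReal (ε * ‖w τ‖) := by
        rw [← ofReal_norm]
        exact ENNReal.ofReal_le_ofReal (h _ (isMaxOn_iff.1 hmax) t ht)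
    _ = ENNReal.ofReal ε * ‖w τ‖ₑ := by rw [ENNReal.ofReal_mul hε, ofReal_norm]
    _ ≤ _ := by
        gcongr
        exact le_iSup₂ (f := fun t (_ : t ∈ s) => ‖w t‖ₑ) τ hτ

theorem HasLinearModulus.exists_iSup_enorm_sub_sub_le (hΩK : IsCompact Ω) (hΩ : Convex ℝ Ω)
    (hne : (interior Ω).Nonempty) (hp : HasLinearModulus Ω p₀ p₁) (hp₀ : ∀ x ∈ Ω, 0 < p₀ x)
    (hp₁ : ∀ x ∈ Ω, 0 < p₁ x)
    (hy : IsDifferentiableTrajectory (velocity Ω p₀ p₁) b y C ρ)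
    (hcore : ∀ t ∈ Icc (0 : ℝ) 1, y t ∈ core Ω (ρ + ρ)) (hε : 0 < ε) :
    ∃ κ > 0, ∀ q₀ q₁, HasLinearModulus Ω q₀ q₁ →
      logRatioError Ω p₀ p₁ q₀ q₁ + scoreError Ω p₀ p₁ q₀ q₁ ≤ ENNReal.ofReal κ →
      ∀ y' w, IsSolution Ω (velocity Ω q₀ q₁) (y 0) y' →
        IsVolterraSolution b (fun s => velocity Ω q₀ q₁ s (y s) - velocity Ω p₀ p₁ s (y s)) w →
        ⨆ t ∈ Icc (0 : ℝ) 1, ‖y' t - y t - w t‖ₑ ≤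
          ENNReal.ofReal ε * ⨆ t ∈ Icc (0 : ℝ) 1, ‖w t‖ₑ := by
  obtain ⟨κ₁, hκ₁, hlin⟩ := hy.exists_norm_sub_sub_le hε
  obtain ⟨A, κ₀, hκ₀, hA⟩ := hp.exists_isLipBoundedOn_velocity_sub hΩK hΩ hne hp₀ hp₁ hy.pos
  obtain ⟨κ, hκ, hκκ₀, hAκ⟩ : ∃ κ > 0, κ ≤ κ₀ ∧ A * κ ≤ κ₁ := by
    refine ⟨min κ₀ (κ₁ / (|A| + 1)), by positivity, min_le_left _ _, ?_⟩
    calc A * min κ₀ (κ₁ / (|A| + 1)) ≤ (|A| + 1) * (κ₁ / (|A| + 1)) := by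
          gcongr
          · linarith [le_abs_self A]
          · exact min_le_right _ _
      _ = κ₁ := by field_simp
  lift κ to ℝ≥0 using hκ.le
  refine ⟨κ, hκ, fun q₀ q₁ hq hqκ y' w hy' hw => ?_⟩
  rw [ENNReal.ofReal_coe_nnreal] at hqκ
  refine iSup_enorm_le_ofReal_mul_iSup_enorm isCompact_Icc hw.isPrimitiveOn.continuousOn hε.le
    (hlin _ y' w (fun t ht => ?_) hy'.isPrimitiveOn hy'.apply_zero hw.isPrimitiveOn hw.apply_zero)
  have hLip := hA κ hκκ₀ q₀ q₁ hq (le_self_add.trans hqκ) (le_add_self.trans hqκ) t ht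
  refine (hLip.mono hAκ).mono_set fun z hz => ?_
  exact mem_core_of_norm_sub_le (hcore t ht) (mem_closedBall_iff_norm.1 hz)

end Volterra

end Trajectory

theorem IsLittleOP.of_forall_exists {Ξ : Type*} [MeasurableSpace Ξ] {P : Measure Ξ}
    {G : ℕ → Ξ → Prop} {A B A' B' : ℕ → Ξ → ℝ≥0∞}
    (hG : Tendsto (fun n => P {ξ | ¬ G n ξ}) atTop (𝓝 0)) (hAB : IsLittleOP P A B)
    (h : ∀ ε > 0, ∃ κ > 0, ∀ n ξ, G n ξ → A n ξ ≤ ENNReal.ofReal κ * B n ξ →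
      A' n ξ ≤ ENNReal.ofReal ε * B' n ξ) : IsLittleOP P A' B' := fun ε hε => by
  obtain ⟨κ, hκ, hκε⟩ := h ε hε
  have hsum := hG.add (hAB κ hκ)
  rw [add_zero] at hsum
  refine tendsto_of_tendsto_of_tendsto_of_le_of_le tendsto_const_nhds hsum (fun _ => zero_le)
    fun n => (measure_mono fun ξ hξ => ?_).trans (measure_union_le _ _)
  by_contra! hcon
  simp only [mem_union, mem_ofPred_eq, not_or, not_not, not_lt] at hcon
  exact (mem_ofPred_eq.le hξ).not_ge (hκε n ξ hcon.1 hcon.2)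

end RectifiedFlow

theorem mainTheorem9 {d : ℕ} {Ω : Set (EuclideanSpace ℝ (Fin d))}
    (hΩ_compact : IsCompact Ω) (hΩ_convex : Convex ℝ Ω) (hΩ_interior : (interior Ω).Nonempty)
    -- the densities, with a linear modulus of continuity
    {p₀ p₁ : EuclideanSpace ℝ (Fin d) → ℝ}
    (hp₀ : RectifiedFlow.IsDensityOn Ω p₀) (hp₁ : RectifiedFlow.IsDensityOn Ω p₁)
    (hp : RectifiedFlow.HasLinearModulus Ω p₀ p₁)
    -- the estimators of the densities, with a linear modulus of continuity with probability
    -- tending to one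
    {Ξ : Type*} [MeasurableSpace Ξ] (P : Measure Ξ) [IsProbabilityMeasure P]
    (phat₀ phat₁ : ℕ → Ξ → EuclideanSpace ℝ (Fin d) → ℝ)
    (hphat : Tendsto
      (fun n => P {ξ | ¬ RectifiedFlow.HasLinearModulus Ω (phat₀ n ξ) (phat₁ n ξ)}) atTop (𝓝 0))
    -- the velocity field and its estimator, the flow and its estimator
    (v : ℝ → EuclideanSpace ℝ (Fin d) → EuclideanSpace ℝ (Fin d))
    (hv : v = RectifiedFlow.velocity Ω p₀ p₁)
    (vhat : ℕ → Ξ → ℝ → EuclideanSpace ℝ (Fin d) → EuclideanSpace ℝ (Fin d))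
    (hvhat : ∀ n ξ, vhat n ξ = RectifiedFlow.velocity Ω (phat₀ n ξ) (phat₁ n ξ))
    (R : ℝ → EuclideanSpace ℝ (Fin d) → EuclideanSpace ℝ (Fin d))
    (hR : R = RectifiedFlow.flow Ω v)
    (Rhat : ℕ → Ξ → ℝ → EuclideanSpace ℝ (Fin d) → EuclideanSpace ℝ (Fin d))
    (hRhat : ∀ n ξ, Rhat n ξ = RectifiedFlow.flow Ω (vhat n ξ))
    -- the starting point
    (x : EuclideanSpace ℝ (Fin d))
    (hx : x ∈ RectifiedFlow.E₁ Ω ∩ RectifiedFlow.E₂ Ω v ∩ RectifiedFlow.E₄ Ω v)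
    -- the derivative of `v` along the path, the drift, and the linearized error
    (b : ℝ → EuclideanSpace ℝ (Fin d) →L[ℝ] EuclideanSpace ℝ (Fin d))
    (hb : ∀ s, b s = fderiv ℝ (v s) (R s x))
    (a : ℕ → Ξ → ℝ → EuclideanSpace ℝ (Fin d))
    (ha : ∀ n ξ s, a n ξ s = vhat n ξ s (R s x) - v s (R s x))
    (Etilde : ℕ → Ξ → ℝ → EuclideanSpace ℝ (Fin d))
    (hEtilde : ∀ n ξ, Etilde n ξ = RectifiedFlow.volterraSolution b (a n ξ)) :
    -- the flows are well defined
    (RectifiedFlow.IsSolution Ω v x (fun t => R t x) ∧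
      ∀ y, RectifiedFlow.IsSolution Ω v x y → EqOn y (fun t => R t x) (Icc 0 1)) ∧
    (∀ n ξ, RectifiedFlow.HasLinearModulus Ω (phat₀ n ξ) (phat₁ n ξ) →
      RectifiedFlow.IsSolution Ω (vhat n ξ) x (fun t => Rhat n ξ t x) ∧
      ∀ y, RectifiedFlow.IsSolution Ω (vhat n ξ) x y →
        EqOn y (fun t => Rhat n ξ t x) (Icc 0 1)) ∧
    -- differentiability of `v` along the path
    (∀ᵐ s ∂(volume.restrict (Icc (0 : ℝ) 1)), DifferentiableAt ℝ (v s) (R s x)) ∧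
    -- the fundamental matrix, and the linearized error expressed through it
    (∃ Φ : ℝ → EuclideanSpace ℝ (Fin d) →L[ℝ] EuclideanSpace ℝ (Fin d),
      RectifiedFlow.IsFundamentalSolution b Φ ∧
      (∀ Ψ, RectifiedFlow.IsFundamentalSolution b Ψ → EqOn Ψ Φ (Icc 0 1)) ∧
      (∀ t ∈ Icc (0 : ℝ) 1, IsUnit (Φ t)) ∧
      ∀ n ξ, RectifiedFlow.HasLinearModulus Ω (phat₀ n ξ) (phat₁ n ξ) →
        RectifiedFlow.IsVolterraSolution b (a n ξ) (Etilde n ξ) ∧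
        (∀ w, RectifiedFlow.IsVolterraSolution b (a n ξ) w → EqOn w (Etilde n ξ) (Icc 0 1)) ∧
        (IntervalIntegrable (fun s => Ring.inverse (Φ s) (a n ξ s)) volume 0 1 ∧
          ∀ t ∈ Icc (0 : ℝ) 1,
            Etilde n ξ t = Φ t (∫ s in (0 : ℝ)..t, Ring.inverse (Φ s) (a n ξ s)))) ∧
    -- the linearization
    (RectifiedFlow.IsLittleOP P
        (fun n ξ => RectifiedFlow.logRatioError Ω p₀ p₁ (phat₀ n ξ) (phat₁ n ξ) +
          RectifiedFlow.scoreError Ω p₀ p₁ (phat₀ n ξ) (phat₁ n ξ))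
        (fun _ _ => 1) →
      RectifiedFlow.IsLittleOP P
        (fun n ξ => ⨆ t ∈ Icc (0 : ℝ) 1, ‖Rhat n ξ t x - R t x - Etilde n ξ t‖ₑ)
        (fun n ξ => ⨆ t ∈ Icc (0 : ℝ) 1, ‖Etilde n ξ t‖ₑ)) := by
  rcases hv, hR, funext hb, funext₃ ha, funext₂ hvhat, funext₂ hRhat, funext₂ hEtilde with
    ⟨rfl, rfl, rfl, rfl, rfl, rfl, rfl⟩
  have hΩ_closed := hΩ_compact.isClosed
  have hfield {q₀ q₁} (hq : RectifiedFlow.HasLinearModulus Ω q₀ q₁) :=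
    hq.isInwardField_velocity hΩ_compact hΩ_convex (hΩ_interior.mono interior_subset)
  have hflow {q₀ q₁} (hq : RectifiedFlow.HasLinearModulus Ω q₀ q₁) :=
    (hfield hq).isSolution_flow hΩ_closed hΩ_convex
      (RectifiedFlow.E₁_subset_interior hΩ_closed hx.1.1)
  obtain ⟨C, ρ, hcore, hR⟩ :=
    (hfield hp).exists_isDifferentiableTrajectory_flow hΩ_closed hΩ_convex hx
  have hb_meas := hR.aestronglyMeasurable_derivative
  obtain ⟨Φ, hΦ⟩ := RectifiedFlow.exists_isFundamentalSolution hb_meas hR.norm_le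
  have hRΩ := fun t ht => RectifiedFlow.core_subset_interior (add_pos hR.pos hR.pos) (hcore t ht)
  have hE {n ξ} (hG : RectifiedFlow.HasLinearModulus Ω (phat₀ n ξ) (phat₁ n ξ)) :=
    hΦ.volterraSolution_spec hb_meas hR.norm_le
      ((hfield hp).aestronglyMeasurable_sub_apply (hfield hG) hR.isPrimitiveOn.continuousOn)
      ((hfield hp).norm_sub_apply_le (hfield hG) hRΩ)
  refine ⟨⟨hflow hp, fun y => (hfield hp).eqOn_flow⟩,
    fun n ξ hG => ⟨hflow hG, fun y => (hfield hG).eqOn_flow⟩,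
    hR.hasFDerivAt.mono fun s hs => hs.differentiableAt,
    ⟨Φ, hΦ, fun Ψ hΨ => hΨ.eqOn hR.norm_le hΦ, fun t => hΦ.isUnit hb_meas hR.norm_le,
      fun n ξ hG => hE hG⟩,
    fun hrs => .of_forall_exists hphat hrs fun ε hε => ?_⟩
  obtain ⟨κ, hκ, hκε⟩ := hp.exists_iSup_enorm_sub_sub_le hΩ_compact hΩ_convex hΩ_interior
    hp₀.pos hp₁.pos hR hcore hε
  exact ⟨κ, hκ, fun n ξ hG hle => hκε _ _ hG (hle.trans_eq (mul_one _)) _ _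
    ((hflow hp).apply_zero.symm ▸ hflow hG) (hE hG).1⟩
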